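/- Let $N\ge 2$. Let $C(O_N^+)$ be the universal unital $C^*$-algebra generated by self-adjoint elements $u_{ij}$, $1\le i,j\le N$, subject to $uu^t=u^tu=1$, where $u=(u_{ij})$, and let $\otimes$ denote the maximal tensor product of $C^*$-algebras. It is a compact quantum group algebra, with morphisms $\Delta:C(O_N^+)\to C(O_N^+)\otimes C(O_N^+)$, $\varepsilon:C(O_N^+)\to\mathbb C$, $S:C(O_N^+)\to C(O_N^+)^{opp}$ given by $$\Delta(u_{ij})=\sum_k u_{ik}\otimes u_{kj},\qquad \varepsilon(u_{ij})=\delta_{ij},\qquad S(u_{ij})=u_{ji}^*.$$ Let $\mathcal A\subset C(O_N^+)$ be the dense $*$-algebra generated by the $u_{ij}$. A representation of $O_N^+$ of dimension $n$ is a unitary matrix $v\in M_n(\mathcal A)$ with $\Delta(v_{ij})=\sum_kv_{ik}\otimes v_{kj}$, $\varepsilon(v_{ij})=\delta_{ij}$, $S(v_{ij})=v_{ji}^*$. Write $v\sim w$ if $Tv=wT$ for some invertible scalar matrix $T$; call $v$ irreducible if $n\ge1$ and the only scalar matrices $T$ with $Tv=vT$ are the multiples of $1$; call $v$ self-adjoint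 if $v\sim\bar v=(v_{ij}^*)$; and let $v+w=\mathrm{diag}(v,w)$ and $(v\otimes w)_{ia,jb}=v_{ij}w_{ab}$. Then: 1. There is a unique Haar integration on $O_N^+$, that is, a unique positive unital trace $\int:C(O_N^+)\to\mathbb C$ with $(\int\otimes id)\Delta=(id\otimes\int)\Delta=\int(\cdot)1$, and with respect to it the main character $\chi=\sum_iu_{ii}$ is self-adjoint and follows the standard Wigner semicircle law, for every $N\geq 2$: for any polynomial $P\in\mathbb C[X]$, $$\int P(\chi)=\frac1{2\pi}\int_{-2}^2P(x)\sqrt{4-x^2}\,dx.$$ 2. The irreducible representations of $O_N^+$ are all self-adjoint, and can be labelled by $\mathbb N=\{0,1,2,\ldots\}$: there are pairwise inequivalent irreducible representations $r_0,r_1,r_2,\ldots$ such that every irreducible representation is equivalent to one of them, and such that the fusion rules are the Clebsch–Gordan ones, as for the group $SU_2$: for all $k,l\ge0$, $$r_k\otimes r_l\sim r_{|k-l|}+r_{|k-l|+2}+\ldots+r_{k+l}.$$ 3. For these representations, $$\dim r_k=\frac{q^{k+1}-q^{-k-1}}{q-q^{-1}},$$ where $q,q^{-1}$ are the solutions of $X^2-NX+1=0$;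 for $N=2$, where $q=q^{-1}=1$, the fraction is read as its limit as $q\to1$, so that $\dim r_k=k+1$. -/

import Mathlib

open scoped ENNReal

noncomputable section

/-! ### Bounded products of C⋆-algebras -/

instance lpInftyCStarAlgebra {I : Type*} {B : I → Type*} [∀ i, CStarAlgebra (B i)]
    [∀ i, Nontrivial (B i)] : CStarAlgebra (lp B ∞) where

/-- The `ℓ^∞`-product of a family of nonzero C⋆-algebras, with pointwise operations and the supremum
norm. -/
def BddProd {I : Type*} (B : I → Type*) [∀ i, CStarAlgebra (B i)] [∀ i, Nontrivial (B i)] :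
    Type _ :=
  lp B ∞

namespace BddProd

variable {I : Type*} {B : I → Type*} [∀ i, CStarAlgebra (B i)] [∀ i, Nontrivial (B i)]

instance : CStarAlgebra (BddProd B) := inferInstanceAs (CStarAlgebra (lp B ∞))

/-- The element of the product given by a bounded family. -/
def mk (x : ∀ i, B i) (C : ℝ) (hx : ∀ i, ‖x i‖ ≤ C) : BddProd B :=
  (⟨x, memℓp_infty ⟨C, by rintro _ ⟨i, rfl⟩; exact hx i⟩⟩ : lp B ∞)

/-- Evaluation at one index. -/
def eval (i : I) : BddProd B →⋆ₐ[ℂ] B i where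
  toFun a := (show lp B ∞ from a) i
  map_one' := rfl
  map_mul' _ _ := rfl
  map_zero' := rfl
  map_add' _ _ := rfl
  commutes' _ := rfl
  map_star' _ := rfl

theorem eval_mk (x : ∀ i, B i) (C : ℝ) (hx : ∀ i, ‖x i‖ ≤ C) (i : I) :
    eval i (mk x C hx) = x i := rfl

theorem ext {a b : BddProd B} (h : ∀ i, eval i a = eval i b) : a = b :=
  lp.ext (funext h)

/-- The morphism to the product given by a family of morphisms. -/
def pi {D : Type*} [CStarAlgebra D] (ρ : ∀ i, D →⋆ₐ[ℂ] B i) : D →⋆ₐ[ℂ] BddProd B where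
  toFun a := mk (fun i => ρ i a) ‖a‖ fun i => NonUnitalStarAlgHom.norm_apply_le (ρ i) a
  map_one' := ext fun i => map_one (ρ i)
  map_mul' a b := ext fun i => map_mul (ρ i) a b
  map_zero' := ext fun i => map_zero (ρ i)
  map_add' a b := ext fun i => map_add (ρ i) a b
  commutes' c := ext fun i => AlgHomClass.commutes (ρ i) c
  map_star' a := ext fun i => map_star (ρ i) a

/-- The same, with the opposite multiplications at the target. -/
def piOp {D : Type*} [CStarAlgebra D] (ρ : ∀ i, D →⋆ₐ[ℂ] (B i)ᵐᵒᵖ) :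
    D →⋆ₐ[ℂ] (BddProd B)ᵐᵒᵖ where
  toFun a := MulOpposite.op (mk (fun i => (ρ i a).unop) ‖a‖ fun i =>
    NonUnitalStarAlgHom.norm_apply_le (ρ i) a)
  map_one' := MulOpposite.unop_injective <| ext fun i =>
    congrArg MulOpposite.unop (map_one (ρ i))
  map_mul' a b := MulOpposite.unop_injective <| ext fun i =>
    congrArg MulOpposite.unop (map_mul (ρ i) a b)
  map_zero' := MulOpposite.unop_injective <| ext fun i =>
    congrArg MulOpposite.unop (map_zero (ρ i))
  map_add' a b := MulOpposite.unop_injective <| ext fun i =>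
    congrArg MulOpposite.unop (map_add (ρ i) a b)
  commutes' c := MulOpposite.unop_injective <| ext fun i =>
    congrArg MulOpposite.unop (AlgHomClass.commutes (ρ i) c)
  map_star' a := MulOpposite.unop_injective <| ext fun i =>
    congrArg MulOpposite.unop (map_star (ρ i) a)

end BddProd

/-- The C⋆-subalgebra generated by a set. -/
abbrev cstarClosure {A : Type*} [CStarAlgebra A] (s : Set A) : StarSubalgebra ℂ A :=
  (StarAlgebra.adjoin ℂ s).topologicalClosure

instance cstarClosureAlgebra {A : Type*} [CStarAlgebra A] (s : Set A) :
    CStarAlgebra (cstarClosure s) :=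
  StarSubalgebra.cstarAlgebra _ (h_closed := StarSubalgebra.isClosed_topologicalClosure _)

/-! ### The maximal tensor product -/

/-- A pair of morphisms of C⋆-algebras with commuting ranges, that is, a `⋆`-representation of the
algebraic tensor product of `A` and `B` in a C⋆-algebra `C`. -/
structure CommutingPair (A B : Type*) [CStarAlgebra A] [CStarAlgebra B] where
  C : Type
  [instC : CStarAlgebra C]
  [nontriv : Nontrivial C]
  f : A →⋆ₐ[ℂ] C
  g : B →⋆ₐ[ℂ] C
  comm : ∀ a b, Commute (f a) (g b)

attribute [instance] CommutingPair.instC CommutingPair.nontriv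

/-- The elementary tensor `a ⊗ b`, as the bounded family of all the elements `f a * g b`. -/
def tmulFamily {A B : Type*} [CStarAlgebra A] [CStarAlgebra B] (a : A) (b : B) :
    BddProd fun c : CommutingPair A B => c.C :=
  BddProd.mk (fun c => c.f a * c.g b) (‖a‖ * ‖b‖) fun c =>
    (norm_mul_le _ _).trans (mul_le_mul (NonUnitalStarAlgHom.norm_apply_le c.f a)
      (NonUnitalStarAlgHom.norm_apply_le c.g b) (norm_nonneg _) (norm_nonneg _))

/-- The universal C⋆-algebraic completion `A ⊗ B` of the algebraic tensor product: the C⋆-algebra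
generated by the elementary tensors for the norm `‖x‖ = sup ‖π x‖`, with `π` ranging over the
`⋆`-representations of the algebraic tensor product in C⋆-algebras. The latter live in `Type`,
which is no restriction when `A` and `B` are finitely generated (so separable), as they are below,
since then so is the C⋆-algebra generated by the range of `π`. -/
def MaxTensor (A B : Type*) [CStarAlgebra A] [CStarAlgebra B] : Type _ :=
  cstarClosure (Set.range fun p : A × B => tmulFamily p.1 p.2)

instance {A B : Type*} [CStarAlgebra A] [CStarAlgebra B] : CStarAlgebra (MaxTensor A B) :=
  inferInstanceAs (CStarAlgebra (cstarClosure (Set.range fun p : A × B => tmulFamily p.1 p.2)))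

/-- The elementary tensor `a ⊗ b` in `MaxTensor A B`. -/
def tmul {A B : Type*} [CStarAlgebra A] [CStarAlgebra B] (a : A) (b : B) : MaxTensor A B :=
  ⟨tmulFamily a b, StarSubalgebra.le_topologicalClosure _
    (StarAlgebra.subset_adjoin ℂ _ ⟨(a, b), rfl⟩)⟩

/-- A commuting pair `(f, g)` extends to the morphism `a ⊗ b ↦ f a * g b`. -/
def MaxTensor.lift {A B : Type*} [CStarAlgebra A] [CStarAlgebra B] (c : CommutingPair A B) :
    MaxTensor A B →⋆ₐ[ℂ] c.C :=
  (BddProd.eval c).comp (StarSubalgebra.subtype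
    (cstarClosure (Set.range fun p : A × B => tmulFamily p.1 p.2)))

theorem MaxTensor.lift_tmul {A B : Type*} [CStarAlgebra A] [CStarAlgebra B]
    (c : CommutingPair A B) (a : A) (b : B) : MaxTensor.lift c (tmul a b) = c.f a * c.g b := rfl

/-! ### Woronowicz algebras -/

open scoped Matrix in
/-- A Woronowicz algebra: a C⋆-algebra `A` with a unitary matrix `u ∈ M_N(A)` whose entries
generate `A`, such that `Δ(u_ij) = ∑_k u_ik ⊗ u_kj`, `ε(u_ij) = δ_ij`, `S(u_ij) = u_ji⋆` define
morphisms `Δ : A → A ⊗ A`, `ε : A → ℂ` and `S : A → Aᵒᵖ`. -/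
structure WoronowiczAlgebra (N : ℕ) where
  A : Type*
  [instA : CStarAlgebra A]
  u : Matrix (Fin N) (Fin N) A
  star_mul_u : uᴴ * u = 1
  mul_star_u : u * uᴴ = 1
  generate : cstarClosure (Set.range fun p : Fin N × Fin N => u p.1 p.2) = ⊤
  comul : A →⋆ₐ[ℂ] MaxTensor A A
  comul_u : ∀ i j, comul (u i j) = ∑ k, tmul (u i k) (u k j)
  counit : A →⋆ₐ[ℂ] ℂ
  counit_u : ∀ i j, counit (u i j) = if i = j then 1 else 0
  antipode : A →⋆ₐ[ℂ] Aᵐᵒᵖ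
  antipode_u : ∀ i j, antipode (u i j) = MulOpposite.op (star (u j i))

attribute [instance] WoronowiczAlgebra.instA

namespace WoronowiczAlgebra

variable {N : ℕ} (G : WoronowiczAlgebra N)

/-- The dense `⋆`-subalgebra of smooth elements, generated by the `u_ij`. -/
def smooth : StarSubalgebra ℂ G.A :=
  StarAlgebra.adjoin ℂ (Set.range fun p : Fin N × Fin N => G.u p.1 p.2)

/-- The main character `χ = ∑_i u_ii`. -/
def mainCharacter : G.A := ∑ i, G.u i i

open scoped Matrix in
/-- Corepresentations: unitary matrices over the smooth elements, which satisfy the same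
conditions as `u`. -/
structure IsCorep {ι : Type*} [Fintype ι] [DecidableEq ι] (v : Matrix ι ι G.A) : Prop where
  mem_smooth : ∀ i j, v i j ∈ G.smooth
  star_mul_self : vᴴ * v = 1
  mul_star_self : v * vᴴ = 1
  comul_eq : ∀ i j, G.comul (v i j) = ∑ k, tmul (v i k) (v k j)
  counit_eq : ∀ i j, G.counit (v i j) = if i = j then 1 else 0
  antipode_eq : ∀ i j, G.antipode (v i j) = MulOpposite.op (star (v j i))

variable {G}

/-- `T ∈ Hom(v, w)`, that is, `T v = w T`. -/
def IsIntertwiner {ι κ : Type*} [Fintype ι] [Fintype κ] (v : Matrix ι ι G.A) (w : Matrix κ κ G.A)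
    (T : Matrix κ ι ℂ) : Prop :=
  T.map (algebraMap ℂ G.A) * v = w * T.map (algebraMap ℂ G.A)

/-- `v ∼ w`: the space `Hom(v, w)` contains an invertible element. -/
def Equivalent {ι κ : Type*} [Fintype ι] [DecidableEq ι] [Fintype κ] [DecidableEq κ]
    (v : Matrix ι ι G.A) (w : Matrix κ κ G.A) : Prop :=
  ∃ (T : Matrix κ ι ℂ) (T' : Matrix ι κ ℂ), T * T' = 1 ∧ T' * T = 1 ∧ IsIntertwiner v w T

/-- Irreducible corepresentations, those of nonzero dimension with `End(v) = ℂ 1`. -/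
def IsIrreducible {ι : Type*} [Fintype ι] [DecidableEq ι] (v : Matrix ι ι G.A) : Prop :=
  G.IsCorep v ∧ Nonempty ι ∧ ∀ T : Matrix ι ι ℂ, IsIntertwiner v v T → ∃ c : ℂ, T = c • 1

/-- The tensor product, `(v ⊗ w)_{ia,jb} = v_ij w_ab`. -/
def tensor {ι κ : Type*} (v : Matrix ι ι G.A) (w : Matrix κ κ G.A) :
    Matrix (ι × κ) (ι × κ) G.A :=
  Matrix.of fun p q => v p.1 q.1 * w p.2 q.2

/-- The conjugate, `(v̄)_ij = v_ij⋆`. -/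
def conj {ι : Type*} (v : Matrix ι ι G.A) : Matrix ι ι G.A := v.map star

/-- The sum of finitely many corepresentations, as a block diagonal matrix. -/
def directSum {m : ℕ} {n : Fin m → ℕ} (v : ∀ j, Matrix (Fin (n j)) (Fin (n j)) G.A) :
    Matrix (Σ j, Fin (n j)) (Σ j, Fin (n j)) G.A :=
  Matrix.blockDiagonal' v

variable (G)

open scoped ComplexOrder in
/-- Haar integrations: positive unital traces `h` with `(h ⊗ id)Δ = (id ⊗ h)Δ = h(·)1`. The
invariance is imposed on the dense subalgebra `𝒜` of smooth elements, on which `Δ` takes values in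
the algebraic tensor product `𝒜 ⊗ 𝒜`, and `h ⊗ id`, `id ⊗ h` are computed there. -/
structure IsHaar (h : G.A →ₗ[ℂ] ℂ) : Prop where
  nonneg : ∀ a, 0 ≤ h (star a * a)
  map_one : h 1 = 1
  tracial : ∀ a b, h (a * b) = h (b * a)
  left_invariant : ∀ a ∈ G.smooth, ∀ (m : ℕ) (x y : Fin m → G.A),
    (∀ i, x i ∈ G.smooth) → (∀ i, y i ∈ G.smooth) → G.comul a = ∑ i, tmul (x i) (y i) →
    ∑ i, h (x i) • y i = h a • (1 : G.A)
  right_invariant : ∀ a ∈ G.smooth, ∀ (m : ℕ) (x y : Fin m → G.A),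
    (∀ i, x i ∈ G.smooth) → (∀ i, y i ∈ G.smooth) → G.comul a = ∑ i, tmul (x i) (y i) →
    ∑ i, h (y i) • x i = h a • (1 : G.A)

end WoronowiczAlgebra

/-! ### Laws -/

/-- The standard Wigner semicircle law `(2π)⁻¹ √(4 - x²) dx`; the square root of a negative real
is `0` here, so this measure lives on `[-2, 2]`. -/
def wignerLaw : MeasureTheory.Measure ℝ :=
  MeasureTheory.volume.withDensity fun x =>
    ENNReal.ofReal (1 / (2 * Real.pi) * Real.sqrt (4 - x ^ 2))

/-- The self-adjoint variable `a` follows the law `μ`, with respect to the linear form `h`: one has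
`h (P a) = ∫ P dμ` for any polynomial `P`. -/
def HasLaw {A : Type*} [CStarAlgebra A] (h : A →ₗ[ℂ] ℂ) (a : A) (μ : MeasureTheory.Measure ℝ) :
    Prop :=
  IsSelfAdjoint a ∧ ∀ P : Polynomial ℂ,
    MeasureTheory.Integrable (fun x : ℝ => P.eval (x : ℂ)) μ ∧
      h (Polynomial.aeval a P) = ∫ x : ℝ, P.eval (x : ℂ) ∂μ

/-! ### The quantum group `O_N^+` -/

open scoped Matrix in
/-- The relations `u = ū`, `uᵗ = u⁻¹`. -/
structure IsOrthogonal {N : ℕ} {B : Type*} [CStarAlgebra B] (v : Matrix (Fin N) (Fin N) B) :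
    Prop where
  selfAdjoint : ∀ i j, star (v i j) = v i j
  transpose_mul : vᵀ * v = 1
  mul_transpose : v * vᵀ = 1

/-- A representation of these relations in a C⋆-algebra. -/
structure OrthRep (N : ℕ) where
  B : Type
  [instB : CStarAlgebra B]
  [nontriv : Nontrivial B]
  v : Matrix (Fin N) (Fin N) B
  orth : IsOrthogonal v

attribute [instance] OrthRep.instB OrthRep.nontriv

namespace FreeOrthogonal

theorem norm_entry_le {N : ℕ} {B : Type*} [CStarAlgebra B] [Nontrivial B]
    {v : Matrix (Fin N) (Fin N) B} (hv : IsOrthogonal v) (i j : Fin N) : ‖v i j‖ ≤ 1 := by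
  let _ := CStarAlgebra.spectralOrder B
  have _ := CStarAlgebra.spectralOrderedRing B
  have h1 : ∑ k, star (v k j) * v k j = 1 := by
    have h := congrFun (congrFun hv.transpose_mul j) j
    simpa [Matrix.mul_apply, hv.selfAdjoint] using h
  have h2 : star (v i j) * v i j ≤ 1 := by
    rw [← h1]
    exact Finset.single_le_sum (f := fun k => star (v k j) * v k j)
      (fun k _ => star_mul_self_nonneg _) (Finset.mem_univ i)
  have h3 := CStarAlgebra.norm_le_norm_of_nonneg_of_le (star_mul_self_nonneg (v i j)) h2
  rw [CStarRing.norm_star_mul_self, norm_one] at h3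
  nlinarith [norm_nonneg (v i j)]

theorem continuous_hom {A B : Type*} [CStarAlgebra A] [CStarAlgebra B] (f : A →⋆ₐ[ℂ] B) :
    Continuous f :=
  AddMonoidHomClass.continuous_of_bound f 1 fun a => by
    simpa only [one_mul] using NonUnitalStarAlgHom.norm_apply_le f a

theorem map_orthogonal {N : ℕ} {B C : Type*} [CStarAlgebra B] [CStarAlgebra C] (f : B →⋆ₐ[ℂ] C)
    {v : Matrix (Fin N) (Fin N) B} (hv : IsOrthogonal v) : IsOrthogonal (v.map f) where
  selfAdjoint i j := by
    rw [Matrix.map_apply, ← map_star, hv.selfAdjoint]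
  transpose_mul := by
    rw [← Matrix.transpose_map, ← Matrix.map_mul, hv.transpose_mul,
      Matrix.map_one _ (map_zero f) (map_one f)]
  mul_transpose := by
    rw [← Matrix.transpose_map, ← Matrix.map_mul, hv.mul_transpose,
      Matrix.map_one _ (map_zero f) (map_one f)]

theorem mul_orthogonal {N : ℕ} {B : Type*} [CStarAlgebra B] {v w : Matrix (Fin N) (Fin N) B}
    (hv : IsOrthogonal v) (hw : IsOrthogonal w) (hc : ∀ i j k l, Commute (v i j) (w k l)) :
    IsOrthogonal (v * w) := by
  have ht : (v * w).transpose = w.transpose * v.transpose := by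
    ext i j
    simp only [Matrix.transpose_apply, Matrix.mul_apply]
    exact Finset.sum_congr rfl fun k _ => (hc _ _ _ _).eq
  refine ⟨fun i j => ?_, ?_, ?_⟩
  · simp only [Matrix.mul_apply, star_sum, star_mul, hv.selfAdjoint, hw.selfAdjoint]
    exact Finset.sum_congr rfl fun k _ => (hc _ _ _ _).eq.symm
  · rw [ht, Matrix.mul_assoc, ← Matrix.mul_assoc v.transpose, hv.transpose_mul, Matrix.one_mul,
      hw.transpose_mul]
  · rw [ht, Matrix.mul_assoc, ← Matrix.mul_assoc w, hw.mul_transpose, Matrix.one_mul,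
      hv.mul_transpose]

theorem inv_orthogonal {N : ℕ} {B : Type*} [CStarAlgebra B] {v : Matrix (Fin N) (Fin N) B}
    (hv : IsOrthogonal v) :
    IsOrthogonal (Matrix.of fun i j => MulOpposite.op (star (v j i))) := by
  refine ⟨fun i j => ?_, ?_, ?_⟩
  · rw [Matrix.of_apply, ← MulOpposite.op_star, hv.selfAdjoint]
    simp [hv.selfAdjoint]
  · ext i j
    have h := congrFun (congrFun hv.mul_transpose j) i
    simp only [Matrix.mul_apply, Matrix.transpose_apply, Matrix.of_apply, hv.selfAdjoint,
      ← MulOpposite.op_mul, ← Finset.op_sum, Matrix.one_apply] at h ⊢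
    rw [h]
    simp only [eq_comm]
    split_ifs <;> simp
  · ext i j
    have h := congrFun (congrFun hv.transpose_mul j) i
    simp only [Matrix.mul_apply, Matrix.transpose_apply, Matrix.of_apply, hv.selfAdjoint,
      ← MulOpposite.op_mul, ← Finset.op_sum, Matrix.one_apply] at h ⊢
    rw [h]
    simp only [eq_comm]
    split_ifs <;> simp

variable {N : ℕ}

/-- The standard coordinate `u_ij`, as the bounded family of its values in all representations. -/
def coordFamily (i j : Fin N) : BddProd fun π : OrthRep N => π.B :=
  BddProd.mk (fun π => π.v i j) 1 fun π => norm_entry_le π.orth i j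

variable (N) in
/-- The universal C⋆-algebra `C(O_N^+) = C⋆((u_ij) | u = ū, uᵗ = u⁻¹)`: the C⋆-algebra generated by
the `u_ij` for the biggest C⋆-norm `‖x‖ = sup ‖π x‖`, with `π` ranging over the representations of
the relations in C⋆-algebras. The latter live in `Type`, which is no restriction, since `N²`
elements generate a separable C⋆-algebra. -/
def Alg : Type 1 := cstarClosure (Set.range fun p : Fin N × Fin N => coordFamily p.1 p.2)

instance : CStarAlgebra (Alg N) :=
  inferInstanceAs (CStarAlgebra
    (cstarClosure (Set.range fun p : Fin N × Fin N => coordFamily p.1 p.2)))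

/-- The matrix of standard coordinates. -/
def coord : Matrix (Fin N) (Fin N) (Alg N) := fun i j =>
  ⟨coordFamily i j, StarSubalgebra.le_topologicalClosure _
    (StarAlgebra.subset_adjoin ℂ _ ⟨(i, j), rfl⟩)⟩

variable (N) in
/-- The inclusion of `C(O_N^+)` in the product of all representations. -/
def incl : Alg N →⋆ₐ[ℂ] BddProd fun π : OrthRep N => π.B :=
  StarSubalgebra.subtype
    (cstarClosure (Set.range fun p : Fin N × Fin N => coordFamily p.1 p.2))

/-- Universality: any solution of the relations gives a morphism from `C(O_N^+)`. -/
def lift (π : OrthRep N) : Alg N →⋆ₐ[ℂ] π.B := (BddProd.eval π).comp (incl N)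

theorem lift_coord (π : OrthRep N) (i j : Fin N) : lift π (coord i j) = π.v i j := rfl

theorem ext {a b : Alg N} (h : ∀ π, lift π a = lift π b) : a = b :=
  Subtype.ext (BddProd.ext h)

theorem lift_one (π : OrthRep N) (i j : Fin N) :
    lift π ((1 : Matrix (Fin N) (Fin N) (Alg N)) i j) =
      (1 : Matrix (Fin N) (Fin N) π.B) i j := by
  simp only [Matrix.one_apply]
  split_ifs <;> simp

theorem coord_orthogonal : IsOrthogonal (coord (N := N)) where
  selfAdjoint i j := ext fun π => by
    rw [map_star, lift_coord, π.orth.selfAdjoint]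
  transpose_mul := Matrix.ext fun i j => ext fun π => by
    rw [lift_one, ← π.orth.transpose_mul]
    simp [Matrix.mul_apply, lift_coord]
  mul_transpose := Matrix.ext fun i j => ext fun π => by
    rw [lift_one, ← π.orth.mul_transpose]
    simp [Matrix.mul_apply, lift_coord]

theorem generate_coord :
    cstarClosure (Set.range fun p : Fin N × Fin N => coord p.1 p.2) = ⊤ := by
  rw [eq_top_iff]
  intro x _
  have key : (incl N ''
      (StarAlgebra.adjoin ℂ (Set.range fun p : Fin N × Fin N => coord p.1 p.2) : Set (Alg N)))
      = (StarAlgebra.adjoin ℂ (Set.range fun p : Fin N × Fin N => coordFamily p.1 p.2) :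
        Set (BddProd fun π : OrthRep N => π.B)) := by
    rw [← StarSubalgebra.coe_map, StarAlgHom.map_adjoin, ← Set.range_comp]
    rfl
  change x ∈ closure _
  have he : Topology.IsEmbedding (incl N) := Topology.IsEmbedding.subtypeVal
  rw [he.closure_eq_preimage_closure_image, key]
  exact x.2

/-- The product `(v w)_ij = ∑_k v_ik w_kj` of two commuting copies of `u`. -/
def mulRep (c : CommutingPair (Alg N) (Alg N)) : OrthRep N where
  B := c.C
  v := coord.map c.f * coord.map c.g
  orth := mul_orthogonal (map_orthogonal c.f coord_orthogonal)
    (map_orthogonal c.g coord_orthogonal) fun _ _ _ _ => c.comm _ _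

/-- The trivial representation `1_N`. -/
def oneRep : OrthRep N where
  B := ℂ
  v := 1
  orth := ⟨fun i j => by simp only [Matrix.one_apply]; split_ifs <;> simp, by simp, by simp⟩

/-- The inverse `(v⁻¹)_ij = v_ji⋆`, in the opposite C⋆-algebra. -/
def invRep (π : OrthRep N) : OrthRep N where
  B := π.Bᵐᵒᵖ
  v := Matrix.of fun i j => MulOpposite.op (star (π.v j i))
  orth := inv_orthogonal π.orth

/-- In terms of values, `(Δ a)(v, w) = a (v w)`. -/
def comulAux : Alg N →⋆ₐ[ℂ] BddProd fun c : CommutingPair (Alg N) (Alg N) => c.C :=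
  BddProd.pi fun c => lift (mulRep c)

variable (N) in
/-- The inclusion of `C(O_N^+) ⊗ C(O_N^+)` in the product of all commuting pairs. -/
def inclTensor : MaxTensor (Alg N) (Alg N) →⋆ₐ[ℂ]
    BddProd fun c : CommutingPair (Alg N) (Alg N) => c.C :=
  StarSubalgebra.subtype
    (cstarClosure (Set.range fun p : Alg N × Alg N => tmulFamily p.1 p.2))

theorem comulAux_coord (i j : Fin N) :
    comulAux (coord i j) = inclTensor N (∑ k, tmul (coord i k) (coord k j)) := by
  refine BddProd.ext fun c => ?_
  rw [map_sum, map_sum]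
  rfl

theorem comulAux_mem (a : Alg N) : comulAux a ∈
    cstarClosure (Set.range fun p : Alg N × Alg N => tmulFamily p.1 p.2) := by
  have hc : Continuous (comulAux (N := N)) := continuous_hom comulAux
  have h : cstarClosure (Set.range fun p : Fin N × Fin N => coord p.1 p.2) ≤
      (cstarClosure (Set.range fun p : Alg N × Alg N => tmulFamily p.1 p.2)).comap comulAux := by
    refine StarSubalgebra.topologicalClosure_minimal ?_
      ((StarSubalgebra.isClosed_topologicalClosure _).preimage hc)
    refine StarAlgebra.adjoin_le ?_
    rintro _ ⟨p, rfl⟩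
    change comulAux (coord p.1 p.2) ∈ cstarClosure _
    rw [comulAux_coord]
    exact Subtype.property _
  rw [generate_coord] at h
  exact h trivial

/-- The comultiplication `Δ`. -/
def comul : Alg N →⋆ₐ[ℂ] MaxTensor (Alg N) (Alg N) :=
  StarAlgHom.codRestrict comulAux _ comulAux_mem

/-- In terms of values, `(S a)(v) = a (v⁻¹)`. -/
def antipodeAux : Alg N →⋆ₐ[ℂ] (BddProd fun π : OrthRep N => π.B)ᵐᵒᵖ :=
  BddProd.piOp fun π => lift (invRep π)

theorem antipodeAux_coord (i j : Fin N) :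
    antipodeAux (coord i j) = MulOpposite.op (incl N (star (coord j i))) := rfl

theorem antipodeAux_mem (a : Alg N) : (antipodeAux a).unop ∈
    cstarClosure (Set.range fun p : Fin N × Fin N => coordFamily p.1 p.2) := by
  have hc : Continuous fun a : Alg N => (antipodeAux a).unop :=
    MulOpposite.continuous_unop.comp (continuous_hom antipodeAux)
  let K : StarSubalgebra ℂ (Alg N) :=
    { carrier := {a | (antipodeAux a).unop ∈
        cstarClosure (Set.range fun p : Fin N × Fin N => coordFamily p.1 p.2)}
      mul_mem' := fun {a b} ha hb => by
        simp only [Set.mem_ofPred_eq, map_mul, MulOpposite.unop_mul] at *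
        exact mul_mem hb ha
      add_mem' := fun {a b} ha hb => by
        simp only [Set.mem_ofPred_eq, map_add, MulOpposite.unop_add] at *
        exact add_mem ha hb
      algebraMap_mem' := fun r => by
        simp only [Set.mem_ofPred_eq, AlgHomClass.commutes]
        exact algebraMap_mem _ r
      star_mem' := fun {a} ha => by
        simp only [Set.mem_ofPred_eq, map_star] at *
        exact star_mem ha }
  have h : cstarClosure (Set.range fun p : Fin N × Fin N => coord p.1 p.2) ≤ K := by
    refine StarSubalgebra.topologicalClosure_minimal ?_
      ((StarSubalgebra.isClosed_topologicalClosure _).preimage hc)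
    refine StarAlgebra.adjoin_le ?_
    rintro _ ⟨p, rfl⟩
    exact (star (coord p.2 p.1)).2
  rw [generate_coord] at h
  exact h trivial

/-- The antipode `S`. -/
def antipode : Alg N →⋆ₐ[ℂ] (Alg N)ᵐᵒᵖ where
  toFun a := MulOpposite.op ⟨(antipodeAux a).unop, antipodeAux_mem a⟩
  map_one' := MulOpposite.unop_injective <| Subtype.ext <|
    congrArg MulOpposite.unop (map_one antipodeAux)
  map_mul' a b := MulOpposite.unop_injective <| Subtype.ext <|
    congrArg MulOpposite.unop (map_mul antipodeAux a b)
  map_zero' := MulOpposite.unop_injective <| Subtype.ext <|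
    congrArg MulOpposite.unop (map_zero antipodeAux)
  map_add' a b := MulOpposite.unop_injective <| Subtype.ext <|
    congrArg MulOpposite.unop (map_add antipodeAux a b)
  commutes' c := MulOpposite.unop_injective <| Subtype.ext <|
    congrArg MulOpposite.unop (AlgHomClass.commutes antipodeAux c)
  map_star' a := MulOpposite.unop_injective <| Subtype.ext <|
    congrArg MulOpposite.unop (map_star antipodeAux a)

end FreeOrthogonal

/-- The quantum group `O_N^+`, as the Woronowicz algebra `C(O_N^+)`. -/
def freeOrthogonal (N : ℕ) : WoronowiczAlgebra N where
  A := FreeOrthogonal.Alg N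
  u := FreeOrthogonal.coord
  star_mul_u := by
    rw [← FreeOrthogonal.coord_orthogonal.transpose_mul]
    congr 1
    exact Matrix.ext fun i j => FreeOrthogonal.coord_orthogonal.selfAdjoint j i
  mul_star_u := by
    rw [← FreeOrthogonal.coord_orthogonal.mul_transpose]
    congr 1
    exact Matrix.ext fun i j => FreeOrthogonal.coord_orthogonal.selfAdjoint j i
  generate := FreeOrthogonal.generate_coord
  comul := FreeOrthogonal.comul
  comul_u i j := Subtype.ext (FreeOrthogonal.comulAux_coord i j)
  counit := FreeOrthogonal.lift FreeOrthogonal.oneRep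
  counit_u _ _ := rfl
  antipode := FreeOrthogonal.antipode
  antipode_u _ _ := rfl

end

/-! ### Dimensions and the creation tower -/

noncomputable section

open scoped Matrix

/-! Everything rests on finite-dimensional Hilbert spaces `H_k`, with `H_0 = ℂ`, `H_1 = ℂ^N` and
`ℂ^N ⊗ H_{k+1} ≃ H_{k+2} ⊕ H_k`, obtained by Wenzl's recursion: the copy of `H_k` is the range of an
explicit multiple of an isometry, and `H_{k+2}` is its orthogonal complement. The structure is
encoded by creation operators `A_i : H_k → H_{k+1}` with a few quadratic relations (`CreationTower`,
`exists_next_creation`).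

The tower is used twice. Over `C(O_N^+)`, compressing `u ⊗ r_k` to `H_{k+1}` defines
corepresentations `r_k`, and the relations give `u ⊗ r_{k+1} ∼ r_{k+2} + r_k` at the level of
entries (`coord_smul_irrep_succ`). Over `ℂ`, the maps `x ↦ A_i x A_jᴴ + c⁻¹ A_iᴴ x A_j`, with `c`
the ratio of consecutive dimensions and without the lowering term in degree 0, act on `⊕_k M_{dim
k}(ℂ)` by symmetric operators which satisfy the orthogonality relations (`CreationTower.regular`).
By universality this is a representation of `C(O_N^+)` on a Hilbert space.

The two constructions match. Sending a family of matrices to the corresponding combination of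
coefficients of the `r_k` turns these operators into left multiplication by `u_ij` (`toAlg_op`).
Applying the resulting element to the vacuum recovers the family (`hom_toAlg_vac`). Hence the
coefficients of the `r_k` form a basis of the smooth algebra, a Peter–Weyl theorem proved without
any prior Haar integration. The same argument on a tensor square shows that the algebraic tensor
square of the smooth algebra embeds in the maximal tensor product (`toTensor_injective`), so
identities for `Δ` can be read on coefficients.

The rest follows from linear independence. The `r_k` are irreducible, and any irreducible
corepresentation has a nonzero coefficient, hence a nonzero intertwiner from some `r_k`; Schur's
lemma concludes. The dimensions are strictly increasing, so conjugation, which preserves dimension,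
fixes every class. The vacuum state is the Haar integration: it is 1 on the unit and kills the
coefficients of `r_k` for `k ≠ 0`, and invariance forces this on any Haar integration (`eq_haar`).
Taking traces in the decomposition of `u ⊗ r_{k+1}`, the character of `r_k` is the Chebyshev
polynomial `S_k` of the main character (`trace_irrep`). These polynomials are orthogonal for the
semicircle law, which yields the law of the main character. Their product formula yields the fusion
rules, since a character that is a sum of distinct irreducible ones determines the corepresentation
(`equivalent_directSum`). -/

/-- A self-adjoint idempotent matrix of trace `m` is `J Jᴴ` for an isometry `J` from `ℂ^m`. -/
theorem Matrix.exists_isometry_of_isIdempotentElem {n : Type*} [Fintype n] [DecidableEq n]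
    {Q : Matrix n n ℂ} (hQ : Q.IsHermitian) (hQ2 : Q * Q = Q) {m : ℕ} (hm : Q.trace = m) :
    ∃ J : Matrix n (Fin m) ℂ, Jᴴ * J = 1 ∧ J * Jᴴ = Q := by
  set U : Matrix n n ℂ := (hQ.eigenvectorUnitary : Matrix n n ℂ) with hU
  have hUU : Uᴴ * U = 1 := Unitary.coe_star_mul_self hQ.eigenvectorUnitary
  set D : Matrix n n ℂ := Matrix.diagonal (fun i => (hQ.eigenvalues i : ℂ)) with hD
  have hspec : Q = U * D * Uᴴ := hQ.spectral_theorem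
  have hDQ : D = Uᴴ * Q * U := by
    rw [hspec, ← Matrix.mul_assoc, ← Matrix.mul_assoc, hUU, Matrix.one_mul, Matrix.mul_assoc, hUU,
      Matrix.mul_one]
  have hUU' : U * Uᴴ = 1 := Unitary.coe_mul_star_self hQ.eigenvectorUnitary
  have hDD : D * D = D := by
    calc D * D = Uᴴ * Q * (U * Uᴴ) * Q * U := by rw [hDQ]; simp only [Matrix.mul_assoc]
      _ = Uᴴ * (Q * Q) * U := by rw [hUU', Matrix.mul_one]; simp only [Matrix.mul_assoc]
      _ = D := by rw [hQ2, ← hDQ]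
  have hev : ∀ i, hQ.eigenvalues i = 0 ∨ hQ.eigenvalues i = 1 := by
    intro i
    have h := congrFun (congrFun hDD i) i
    rw [hD, Matrix.diagonal_mul_diagonal, Matrix.diagonal_apply_eq, Matrix.diagonal_apply_eq] at h
    have h' : hQ.eigenvalues i * hQ.eigenvalues i = hQ.eigenvalues i := by exact_mod_cast h
    by_cases h0 : hQ.eigenvalues i = 0
    · exact Or.inl h0
    · exact Or.inr (mul_left_cancel₀ h0 (by rw [h', mul_one]))
  have hev' : ∀ i, (hQ.eigenvalues i : ℂ) = if hQ.eigenvalues i = 1 then 1 else 0 := by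
    intro i
    rcases hev i with h | h <;> simp [h]
  have hcard : Fintype.card {i // hQ.eigenvalues i = 1} = m := by
    have h : Q.trace = D.trace := by
      rw [hspec, Matrix.mul_assoc, Matrix.trace_mul_comm, Matrix.mul_assoc, hUU, Matrix.mul_one]
    rw [hm, hD, Matrix.trace_diagonal, Finset.sum_congr rfl fun i _ => hev' i,
      Finset.sum_boole] at h
    rw [Fintype.card_subtype]
    exact_mod_cast h.symm
  let e : Fin m ≃ {i // hQ.eigenvalues i = 1} := (Fintype.equivFinOfCardEq hcard).symm
  -- The columns of `J` are the eigenvectors of eigenvalue 1; there are `m` of them because the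
  -- eigenvalues are 0 or 1 and sum to the trace.
  refine ⟨U.submatrix id (fun x => (e x : n)), ?_, ?_⟩
  · ext x y
    have h := congrFun (congrFun hUU (e x)) (e y)
    rw [Matrix.mul_apply] at h ⊢
    refine h.trans ?_
    simp [Matrix.one_apply, Subtype.ext_iff.symm]
  · ext a b
    have hab := congrFun (congrFun hspec a) b
    rw [Matrix.mul_apply] at hab
    rw [hab, Matrix.mul_apply]
    refine (Equiv.sum_comp e (fun i : {i // hQ.eigenvalues i = 1} => U a i * Uᴴ i b)).trans ?_
    simp only [hD, Matrix.mul_diagonal, hev']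
    rw [← Finset.sum_subtype (Finset.univ.filter fun i => hQ.eigenvalues i = 1) (by simp)
      fun i => U a i * Uᴴ i b, Finset.sum_filter]
    refine Finset.sum_congr rfl fun i _ => ?_
    split_ifs <;> simp

namespace FreeOrthogonal

/-- The dimensions of the irreducible corepresentations of `O_N^+`. -/
def dim (N : ℕ) : ℕ → ℕ
  | 0 => 1
  | 1 => N
  | k + 2 => N * dim N (k + 1) - dim N k

theorem dim_zero (N : ℕ) : dim N 0 = 1 := rfl

/-- Positivity and growth go together in one induction, and `2 ≤ N` then shows that the truncated
subtraction in `dim` never truncates. -/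
theorem dim_pos_lt {N : ℕ} (hN : 2 ≤ N) (k : ℕ) : 0 < dim N k ∧ dim N k < dim N (k + 1) := by
  induction k with
  | zero => exact ⟨Nat.one_pos, hN⟩
  | succ k ih =>
    refine ⟨ih.1.trans ih.2, ?_⟩
    change _ < N * dim N (k + 1) - dim N k
    have : 2 * dim N (k + 1) ≤ N * dim N (k + 1) := Nat.mul_le_mul_right _ hN
    omega

theorem dim_pos {N : ℕ} (hN : 2 ≤ N) (k : ℕ) : 0 < dim N k := (dim_pos_lt hN k).1

theorem dim_strictMono {N : ℕ} (hN : 2 ≤ N) : StrictMono (dim N) :=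
  strictMono_nat_of_lt_succ fun k => (dim_pos_lt hN k).2

theorem dim_add_two {N : ℕ} (hN : 2 ≤ N) (k : ℕ) :
    dim N (k + 2) + dim N k = N * dim N (k + 1) := by
  change N * dim N (k + 1) - dim N k + _ = _
  have := (dim_pos_lt hN k).2
  have : 2 * dim N (k + 1) ≤ N * dim N (k + 1) := Nat.mul_le_mul_right _ hN
  omega

/-- The ratio of two consecutive dimensions. -/
def ratio (N k : ℕ) : ℂ := (dim N (k + 1) : ℂ) / dim N k

theorem dim_ne_zero {N : ℕ} (hN : 2 ≤ N) (k : ℕ) : (dim N k : ℂ) ≠ 0 :=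
  Nat.cast_ne_zero.mpr (dim_pos hN k).ne'

theorem ratio_ne_zero {N : ℕ} (hN : 2 ≤ N) (k : ℕ) : ratio N k ≠ 0 :=
  div_ne_zero (dim_ne_zero hN _) (dim_ne_zero hN _)

theorem star_ratio (N k : ℕ) : star (ratio N k) = ratio N k := by
  simp [ratio]

/-- Creation operators `A_i : H_k → H_{k+1}` between Hilbert spaces of dimension `dim N k`, which
implement decompositions `ℂ^N ⊗ H_{k+1} ≃ H_{k+2} ⊕ H_k`. -/
structure CreationTower (N : ℕ) where
  A : ∀ k, Fin N → Matrix (Fin (dim N (k + 1))) (Fin (dim N k)) ℂ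
  sum_mul_star : ∀ k, ∑ i, A k i * (A k i)ᴴ = 1
  sum_star_mul : ∀ k, ∑ i, (A k i)ᴴ * A k i = ratio N k • 1
  star_mul_zero : ∀ i j, (A 0 i)ᴴ * A 0 j = if i = j then 1 else 0
  star_mul_succ : ∀ k i j, (A (k + 1) i)ᴴ * A (k + 1) j =
    (if i = j then 1 else 0) - (ratio N k)⁻¹ • (A k i * (A k j)ᴴ)
  sum_mul : ∀ k, ∑ i, A (k + 1) i * A k i = 0

/-- One step of Wenzl's recursion. The column `φ` of the `a i` satisfies `φᴴ φ = c`, so `c⁻¹ φ φᴴ`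
is a projection of rank `d` in `ℂ^N ⊗ ℂ^e`. Its complement has trace `N e - d = m` and factors as `J
Jᴴ`; the operators `b i` are the blocks of `Jᴴ`. -/
theorem exists_next_creation {N d e m : ℕ} (a : Fin N → Matrix (Fin e) (Fin d) ℂ) (c : ℂ)
    (hc : c ≠ 0) (hcs : star c = c) (h1 : ∑ i, a i * (a i)ᴴ = 1)
    (h4 : ∑ i, (a i)ᴴ * a i = c • 1) (hm : m + d = N * e) :
    ∃ b : Fin N → Matrix (Fin m) (Fin e) ℂ,
      ∑ i, b i * (b i)ᴴ = 1 ∧ ∑ i, (b i)ᴴ * b i = ((N : ℂ) - c⁻¹) • 1 ∧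
      (∀ i j, (b i)ᴴ * b j = (if i = j then 1 else 0) - c⁻¹ • (a i * (a j)ᴴ)) ∧
      ∑ i, b i * a i = 0 := by
  let φ : Matrix (Fin N × Fin e) (Fin d) ℂ := Matrix.of fun p y => a p.1 p.2 y
  have hφ : φᴴ * φ = c • 1 := by
    rw [← h4]
    ext x y
    simp [φ, Matrix.mul_apply, Fintype.sum_prod_type, Matrix.sum_apply]
  have hcs' : star c⁻¹ = c⁻¹ := by rw [star_inv₀, hcs]
  obtain ⟨J, hJ1, hJ2⟩ := Matrix.exists_isometry_of_isIdempotentElem (m := m)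
    (Q := 1 - c⁻¹ • (φ * φᴴ)) (by
      rw [Matrix.IsHermitian, Matrix.conjTranspose_sub, Matrix.conjTranspose_smul, hcs']
      simp) (by
      have : φ * φᴴ * (φ * φᴴ) = c • (φ * φᴴ) := by
        rw [Matrix.mul_assoc, ← Matrix.mul_assoc φᴴ, hφ]
        simp
      simp only [Matrix.sub_mul, Matrix.mul_sub, Matrix.one_mul, Matrix.mul_one, Matrix.smul_mul,
        Matrix.mul_smul, this]
      rw [smul_smul c⁻¹ c, inv_mul_cancel₀ hc, one_smul, sub_self, smul_zero,
        sub_zero]) (by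
      rw [Matrix.trace_sub, Matrix.trace_smul, Matrix.trace_mul_comm, hφ, Matrix.trace_smul,
        Matrix.trace_one, Matrix.trace_one, smul_smul, inv_mul_cancel₀ hc]
      simp only [Fintype.card_prod, Fintype.card_fin, one_smul]
      rw [← hm]
      push_cast
      ring)
  have hb (i j : Fin N) : (Matrix.of fun y x => star (J (i, x) y) : Matrix (Fin m) (Fin e) ℂ)ᴴ *
      (Matrix.of fun y x => star (J (j, x) y) : Matrix (Fin m) (Fin e) ℂ) =
      (if i = j then 1 else 0) - c⁻¹ • (a i * (a j)ᴴ) := by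
    ext x y
    have h := congrFun (congrFun hJ2 (i, x)) (j, y)
    simp only [Matrix.mul_apply, Matrix.conjTranspose_apply, Matrix.of_apply, star_star,
      Matrix.sub_apply, Matrix.smul_apply, φ] at h ⊢
    rw [h]
    by_cases hij : i = j <;> simp [hij, Matrix.one_apply]
  refine ⟨fun i => Matrix.of fun y x => star (J (i, x) y), ?_, ?_, hb, ?_⟩
  · rw [← hJ1]
    ext x y
    simp [Matrix.mul_apply, Fintype.sum_prod_type, Matrix.sum_apply]
  · rw [Finset.sum_congr rfl fun i _ => hb i i, Finset.sum_sub_distrib, ← Finset.smul_sum, h1]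
    simp [sub_smul, ← Nat.cast_smul_eq_nsmul ℂ]
  -- The range of `J` is orthogonal to that of `φ`; written in blocks, this is the vanishing of `∑ b
  -- i * a i`.
  · have h : Jᴴ * φ = 0 := by
      have : J * Jᴴ * φ = 0 := by
        rw [hJ2, Matrix.sub_mul, Matrix.smul_mul, Matrix.mul_assoc, hφ]
        simp [smul_smul, inv_mul_cancel₀ hc]
      rw [← Matrix.one_mul Jᴴ, ← hJ1, Matrix.mul_assoc Jᴴ, Matrix.mul_assoc Jᴴ, this,
        Matrix.mul_zero]
    rw [← h]
    ext x y
    simp [φ, Matrix.mul_apply, Fintype.sum_prod_type, Matrix.sum_apply]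

theorem exists_creationTower {N : ℕ} (hN : 2 ≤ N) : Nonempty (CreationTower N) := by
  let St (k : ℕ) : Type := {a : Fin N → Matrix (Fin (dim N (k + 1))) (Fin (dim N k)) ℂ //
    ∑ i, a i * (a i)ᴴ = 1 ∧ ∑ i, (a i)ᴴ * a i = ratio N k • 1}
  have step (k : ℕ) (s : St k) : ∃ t : St (k + 1),
      (∀ i j, (t.1 i)ᴴ * t.1 j =
        (if i = j then 1 else 0) - (ratio N k)⁻¹ • (s.1 i * (s.1 j)ᴴ)) ∧
      ∑ i, t.1 i * s.1 i = 0 := by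
    obtain ⟨b, hb1, hb2, hb3, hb4⟩ := exists_next_creation s.1 (ratio N k) (ratio_ne_zero hN k)
      (star_ratio N k) s.2.1 s.2.2 (dim_add_two hN k)
    refine ⟨⟨b, hb1, ?_⟩, hb3, hb4⟩
    rw [hb2]
    -- The constant `N - c⁻¹` produced by the recursion is the next ratio of dimensions, by the
    -- recursion for `dim`.
    congr 1
    have h := dim_add_two hN k
    have h' : (dim N (k + 2) : ℂ) + dim N k = N * dim N (k + 1) := by exact_mod_cast h
    have := dim_ne_zero hN k
    have := dim_ne_zero hN (k + 1)
    rw [ratio, ratio]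
    field_simp
    linear_combination -h'
  choose f hf1 hf2 using step
  -- The tower starts with `A_i : ℂ → ℂ^N`, `1 ↦ e_i`.
  let a0 : Fin N → Matrix (Fin N) (Fin 1) ℂ := fun i => Matrix.of fun x _ => if x = i then 1 else 0
  have hz (i j : Fin N) : (a0 i)ᴴ * a0 j = if i = j then 1 else 0 := by
    ext x y
    rw [Subsingleton.elim x y]
    by_cases h : i = j <;> simp [a0, Matrix.mul_apply, h, eq_comm]
  have ha1 : ∑ i, a0 i * (a0 i)ᴴ = 1 := by
    ext x y
    simp [a0, Matrix.mul_apply, Matrix.sum_apply, Matrix.one_apply, eq_comm]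
  have ha4 : ∑ i, (a0 i)ᴴ * a0 i = ((N : ℂ) / (1 : ℕ)) • (1 : Matrix (Fin 1) (Fin 1) ℂ) := by
    rw [Finset.sum_congr rfl fun i _ => hz i i]
    simp [← Nat.cast_smul_eq_nsmul ℂ]
  let s0 : St 0 := ⟨a0, ha1, ha4⟩
  let s : ∀ k, St k := fun k => Nat.rec s0 f k
  exact ⟨fun k => (s k).1, fun k => (s k).2.1, fun k => (s k).2.2, hz, fun k => hf1 k (s k),
    fun k => hf2 k (s k)⟩

end FreeOrthogonal
end

noncomputable section

open scoped Matrix TensorProduct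
open UniformSpace

namespace FreeOrthogonal

variable {N : ℕ}

/-! ### Orthogonal matrices of symmetric operators -/

theorem mem_of_isClosed {K : StarSubalgebra ℂ (Alg N)} (hK : IsClosed (K : Set (Alg N)))
    (h : ∀ i j, coord i j ∈ K) (a : Alg N) : a ∈ K := by
  have h' : cstarClosure (Set.range fun p : Fin N × Fin N => coord p.1 p.2) ≤ K := by
    refine StarSubalgebra.topologicalClosure_minimal (StarAlgebra.adjoin_le ?_) hK
    rintro _ ⟨p, rfl⟩
    exact h p.1 p.2
  rw [generate_coord] at h'
  exact h' trivial

/-- Commutants of self-adjoint sets are closed `⋆`-subalgebras, so commutation spreads from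
generators to everything, one of the two morphisms at a time. -/
theorem commute_of_commute_coord {C : Type*} [CStarAlgebra C] (f g : Alg N →⋆ₐ[ℂ] C)
    (h : ∀ i j k l, Commute (f (coord i j)) (g (coord k l))) (a b : Alg N) :
    Commute (f a) (g b) := by
  have hclosed (s : Set C) : IsClosed (StarSubalgebra.centralizer ℂ s : Set C) := by
    rw [StarSubalgebra.coe_centralizer]
    exact Set.isClosed_centralizer _
  have h1 (k l : Fin N) (a : Alg N) : Commute (f a) (g (coord k l)) := by
    have := mem_of_isClosed
      (K := (StarSubalgebra.centralizer ℂ {g (coord k l)}).comap f)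
      ((hclosed _).preimage (continuous_hom f)) (fun i j => by
        rw [StarSubalgebra.mem_comap, StarSubalgebra.mem_centralizer_iff]
        rintro _ rfl
        rw [← map_star, coord_orthogonal.selfAdjoint]
        exact ⟨(h i j k l).symm, (h i j k l).symm⟩) a
    rw [StarSubalgebra.mem_comap, StarSubalgebra.mem_centralizer_iff] at this
    exact (this _ rfl).1.symm
  have := mem_of_isClosed
    (K := (StarSubalgebra.centralizer ℂ (Set.range f)).comap g)
    ((hclosed _).preimage (continuous_hom g)) (fun i j => by
      rw [StarSubalgebra.mem_comap, StarSubalgebra.mem_centralizer_iff]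
      rintro _ ⟨a, rfl⟩
      rw [← map_star]
      exact ⟨h1 i j a, h1 i j (star a)⟩) b
  rw [StarSubalgebra.mem_comap, StarSubalgebra.mem_centralizer_iff] at this
  exact (this _ ⟨a, rfl⟩).1

/-- An orthogonal matrix of symmetric operators on a pre-Hilbert space. -/
structure OrthogonalSystem (N : ℕ) (P : Type) [NormedAddCommGroup P] [InnerProductSpace ℂ P] where
  op : Fin N → Fin N → P →ₗ[ℂ] P
  symmetric : ∀ i j x y, inner ℂ (op i j x) y = inner ℂ x (op i j y)
  transpose_mul : ∀ i j x, ∑ k, op k i (op k j x) = if i = j then x else 0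
  mul_transpose : ∀ i j x, ∑ k, op i k (op j k x) = if i = j then x else 0

namespace OrthogonalSystem

variable {P : Type} [NormedAddCommGroup P] [InnerProductSpace ℂ P] (S : OrthogonalSystem N P)

/-- The relation `uᵗu = 1` and symmetry give `∑_k ‖u_kj x‖² = ‖x‖²`. Thus purely algebraic data on a
pre-Hilbert space extend to the completion. -/
theorem norm_op_le (i j : Fin N) (x : P) : ‖S.op i j x‖ ≤ 1 * ‖x‖ := by
  have h : ∑ k, ‖S.op k j x‖ ^ 2 = ‖x‖ ^ 2 := by
    have h1 : inner ℂ x (∑ k, S.op k j (S.op k j x)) = inner ℂ x x := by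
      rw [S.transpose_mul, if_pos rfl]
    rw [inner_sum] at h1
    have h2 (k : Fin N) : inner ℂ x (S.op k j (S.op k j x)) = ((‖S.op k j x‖ ^ 2 : ℝ) : ℂ) := by
      rw [← S.symmetric, inner_self_eq_norm_sq_to_K]
      norm_cast
    rw [Finset.sum_congr rfl fun k _ => h2 k, inner_self_eq_norm_sq_to_K] at h1
    have h3 : ((∑ k, ‖S.op k j x‖ ^ 2 : ℝ) : ℂ) = ((‖x‖ ^ 2 : ℝ) : ℂ) := by
      push_cast at h1 ⊢
      exact h1
    exact Complex.ofReal_injective h3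
  have h2 : ‖S.op i j x‖ ^ 2 ≤ ‖x‖ ^ 2 := by
    rw [← h]
    exact Finset.single_le_sum (f := fun k => ‖S.op k j x‖ ^ 2) (fun k _ => sq_nonneg _)
      (Finset.mem_univ i)
  rw [one_mul]
  exact (sq_le_sq₀ (norm_nonneg _) (norm_nonneg _)).mp h2

/-- The extension of the operators to the Hilbert space completion. -/
def opL (i j : Fin N) : Completion P →L[ℂ] Completion P :=
  ((S.op i j).mkContinuous 1 (S.norm_op_le i j)).completion

theorem opL_coe (i j : Fin N) (x : P) : S.opL i j (x : Completion P) = (S.op i j x : P) := by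
  rw [opL, ContinuousLinearMap.completion_apply_coe]
  rfl

theorem star_opL (i j : Fin N) : star (S.opL i j) = S.opL i j := by
  rw [ContinuousLinearMap.star_eq_adjoint, eq_comm, ContinuousLinearMap.eq_adjoint_iff]
  intro x y
  induction x, y using Completion.induction_on₂ with
  | hp => exact isClosed_eq (by fun_prop) (by fun_prop)
  | ih x y => rw [opL_coe, opL_coe, Completion.inner_coe, Completion.inner_coe, S.symmetric]

theorem clm_ext {T T' : Completion P →L[ℂ] Completion P} (h : ∀ x : P, T x = T' x) : T = T' :=
  ContinuousLinearMap.ext fun x => congrFun (Completion.ext T.continuous T'.continuous h) x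

theorem isOrthogonal_opL : IsOrthogonal (B := Completion P →L[ℂ] Completion P)
    (Matrix.of S.opL) where
  selfAdjoint := S.star_opL
  transpose_mul := by
    ext1 i j
    refine clm_ext fun x => ?_
    have h := congrArg (fun z : P => (z : Completion P)) (S.transpose_mul i j x)
    simp only [Matrix.mul_apply, Matrix.transpose_apply, Matrix.of_apply, Matrix.one_apply,
      _root_.sum_apply, mul_apply_eq_comp, opL_coe]
    refine Eq.trans (map_sum (Completion.toComplL (𝕜 := ℂ) (E := P)) _ _).symm (h.trans ?_)
    split_ifs <;> simp
  mul_transpose := by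
    ext1 i j
    refine clm_ext fun x => ?_
    have h := congrArg (fun z : P => (z : Completion P)) (S.mul_transpose i j x)
    simp only [Matrix.mul_apply, Matrix.transpose_apply, Matrix.of_apply, Matrix.one_apply,
      _root_.sum_apply, mul_apply_eq_comp, opL_coe]
    refine Eq.trans (map_sum (Completion.toComplL (𝕜 := ℂ) (E := P)) _ _).symm (h.trans ?_)
    split_ifs <;> simp

variable {P' : Type} [NormedAddCommGroup P'] [InnerProductSpace ℂ P']

theorem symmetric_of_tmul {f : P ⊗[ℂ] P' →ₗ[ℂ] P ⊗[ℂ] P'}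
    (h : ∀ x y x' y', inner ℂ (f (x ⊗ₜ y)) (x' ⊗ₜ y') = inner ℂ (x ⊗ₜ[ℂ] y) (f (x' ⊗ₜ[ℂ] y')))
    (z w : P ⊗[ℂ] P') : inner ℂ (f z) w = inner ℂ z (f w) := by
  induction z with
  | zero => simp
  | add z z' hz hz' => simp only [map_add, inner_add_left, hz, hz']
  | tmul x y =>
    induction w with
    | zero => simp
    | add w w' hw hw' => simp only [map_add, inner_add_right, hw, hw']
    | tmul x' y' => exact h x y x' y'

instance [Nontrivial P] [Nontrivial P'] : Nontrivial (P ⊗[ℂ] P') := by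
  obtain ⟨x, hx⟩ := exists_ne (0 : P)
  obtain ⟨y, hy⟩ := exists_ne (0 : P')
  refine ⟨x ⊗ₜ y, 0, fun h => ?_⟩
  have := congrArg norm h
  rw [TensorProduct.norm_tmul, norm_zero, mul_eq_zero, norm_eq_zero, norm_eq_zero] at this
  tauto

theorem sum_rTensor {κ : Type*} [Fintype κ] (f g : κ → P →ₗ[ℂ] P) (z : P ⊗[ℂ] P')
    (c : Prop) [Decidable c] (h : ∀ x, ∑ k, f k (g k x) = if c then x else 0) :
    ∑ k, (f k).rTensor P' ((g k).rTensor P' z) = if c then z else 0 := by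
  induction z with
  | zero => simp
  | add z w hz hw =>
    simp only [map_add, Finset.sum_add_distrib, hz, hw]
    split_ifs <;> simp
  | tmul x y =>
    simp only [LinearMap.rTensor_tmul, ← TensorProduct.sum_tmul, h]
    split_ifs <;> simp

theorem sum_lTensor {κ : Type*} [Fintype κ] (f g : κ → P →ₗ[ℂ] P) (z : P' ⊗[ℂ] P)
    (c : Prop) [Decidable c] (h : ∀ x, ∑ k, f k (g k x) = if c then x else 0) :
    ∑ k, (f k).lTensor P' ((g k).lTensor P' z) = if c then z else 0 := by
  induction z with
  | zero => simp
  | add z w hz hw =>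
    simp only [map_add, Finset.sum_add_distrib, hz, hw]
    split_ifs <;> simp
  | tmul x y =>
    simp only [LinearMap.lTensor_tmul, ← TensorProduct.tmul_sum, h]
    split_ifs <;> simp

variable (P') in
/-- The amplification acting on the left leg. -/
def left : OrthogonalSystem N (P ⊗[ℂ] P') where
  op i j := (S.op i j).rTensor P'
  symmetric i j := symmetric_of_tmul fun x y x' y' => by
    simp only [LinearMap.rTensor_tmul, TensorProduct.inner_tmul, S.symmetric]
  transpose_mul i j z := sum_rTensor _ _ z _ (S.transpose_mul i j)
  mul_transpose i j z := sum_rTensor _ _ z _ (S.mul_transpose i j)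

variable (P') in
/-- The amplification acting on the right leg. -/
def right : OrthogonalSystem N (P' ⊗[ℂ] P) where
  op i j := (S.op i j).lTensor P'
  symmetric i j := symmetric_of_tmul fun x y x' y' => by
    simp only [LinearMap.lTensor_tmul, TensorProduct.inner_tmul, S.symmetric]
  transpose_mul i j z := sum_lTensor _ _ z _ (S.transpose_mul i j)
  mul_transpose i j z := sum_lTensor _ _ z _ (S.mul_transpose i j)

variable [Nontrivial P]

instance : Nontrivial (Completion P) :=
  (Completion.coe_injective P).nontrivial

/-- The associated representation on the completion. -/
def toOrthRep : OrthRep N where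
  B := Completion P →L[ℂ] Completion P
  v := Matrix.of S.opL
  orth := S.isOrthogonal_opL

/-- The associated representation of `C(O_N^+)`. -/
def hom : Alg N →⋆ₐ[ℂ] (Completion P →L[ℂ] Completion P) := FreeOrthogonal.lift S.toOrthRep

theorem hom_coord_coe (i j : Fin N) (x : P) : S.hom (coord i j) x = (S.op i j x : P) :=
  S.opL_coe i j x

end OrthogonalSystem

end FreeOrthogonal
end

/-! ### Smooth elements acting on pre-Hilbert spaces, and on tensor products -/

noncomputable section

open scoped Matrix TensorProduct
open UniformSpace

namespace FreeOrthogonal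

variable {N : ℕ}

/-- The generators are self-adjoint, so the `⋆`-algebra they generate is the plain algebra they
generate, and no case for `star` is needed. -/
theorem smooth_induction {p : Alg N → Prop} (algebraMap : ∀ c : ℂ, p (algebraMap ℂ (Alg N) c))
    (coord : ∀ i j, p (coord i j))
    (add : ∀ a b, p a → p b → p (a + b))
    (mul : ∀ a b, p a → p b → p (a * b)) {a : Alg N} (ha : a ∈ (freeOrthogonal N).smooth) :
    p a := by
  have hs : Set.range (fun q : Fin N × Fin N => FreeOrthogonal.coord q.1 q.2) ∪
      star (Set.range fun q : Fin N × Fin N => FreeOrthogonal.coord q.1 q.2) =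
      Set.range fun q : Fin N × Fin N => FreeOrthogonal.coord q.1 q.2 := by
    refine Set.union_eq_left.mpr ?_
    rintro x ⟨q, hq⟩
    refine ⟨q, ?_⟩
    rw [← star_star x, ← hq, coord_orthogonal.selfAdjoint]
  change a ∈ StarAlgebra.adjoin ℂ (Set.range fun q : Fin N × Fin N =>
    FreeOrthogonal.coord q.1 q.2) at ha
  rw [← StarSubalgebra.mem_toSubalgebra, StarAlgebra.adjoin_toSubalgebra, hs] at ha
  induction ha using Algebra.adjoin_induction with
  | mem x hx =>
    obtain ⟨q, rfl⟩ := hx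
    exact coord q.1 q.2
  | algebraMap c => exact algebraMap c
  | add x y _ _ hx hy => exact add x y hx hy
  | mul x y _ _ hx hy => exact mul x y hx hy

theorem coord_mem_smooth (i j : Fin N) : coord i j ∈ (freeOrthogonal N).smooth :=
  StarAlgebra.subset_adjoin ℂ _ ⟨(i, j), rfl⟩

namespace OrthogonalSystem

section

variable {P P' : Type} [NormedAddCommGroup P] [InnerProductSpace ℂ P]
  [NormedAddCommGroup P'] [InnerProductSpace ℂ P']

theorem op_comm (S : OrthogonalSystem N P) (S' : OrthogonalSystem N P') (i j k l : Fin N)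
    (z : P ⊗[ℂ] P') : (S.left P').op i j ((S'.right P).op k l z) =
      (S'.right P).op k l ((S.left P').op i j z) := by
  induction z with
  | zero => simp only [map_zero]
  | add z w hz hw => simp only [map_add, hz, hw]
  | tmul x y => rfl

end

variable {P P' : Type} [NormedAddCommGroup P] [InnerProductSpace ℂ P] [Nontrivial P]
  [NormedAddCommGroup P'] [InnerProductSpace ℂ P'] [Nontrivial P']

/-- Smooth elements preserve the pre-Hilbert space inside its completion. Keeping track of the
vector `z` there allows `f` to be any algebraic intertwiner, with no boundedness. -/
theorem exists_hom_apply_coe (S : OrthogonalSystem N P) (S' : OrthogonalSystem N P')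
    (f : P →ₗ[ℂ] P') (hf : ∀ i j x, f (S.op i j x) = S'.op i j (f x)) {a : Alg N}
    (ha : a ∈ (freeOrthogonal N).smooth) (x : P) :
    ∃ z : P, S.hom a x = z ∧ S'.hom a (f x : P') = (f z : P') := by
  refine smooth_induction (p := fun a => ∀ x : P,
      ∃ z : P, S.hom a x = z ∧ S'.hom a (f x : P') = (f z : P'))
    (fun c x => ⟨c • x, ?_, ?_⟩) (fun i j x => ⟨S.op i j x, S.hom_coord_coe i j x, ?_⟩) ?_ ?_ ha x
  · rw [AlgHomClass.commutes, Algebra.algebraMap_eq_smul_one, Completion.coe_smul]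
    rfl
  · rw [AlgHomClass.commutes, Algebra.algebraMap_eq_smul_one, map_smul, Completion.coe_smul]
    rfl
  · rw [hom_coord_coe, hf]
  · intro a b h1 h2 x
    obtain ⟨y, hy, hy'⟩ := h1 x
    obtain ⟨z, hz, hz'⟩ := h2 x
    refine ⟨y + z, ?_, ?_⟩
    · rw [map_add, _root_.add_apply, hy, hz, Completion.coe_add]
    · rw [map_add, _root_.add_apply, hy', hz', map_add, Completion.coe_add]
  · intro a b h1 h2 x
    obtain ⟨z, hz, hz'⟩ := h2 x
    obtain ⟨y, hy, hy'⟩ := h1 z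
    exact ⟨y, by rw [map_mul, mul_apply_eq_comp, hz, hy],
      by rw [map_mul, mul_apply_eq_comp, hz', hy']⟩

theorem hom_apply_of_intertwines (S : OrthogonalSystem N P) (S' : OrthogonalSystem N P')
    (f : P →ₗ[ℂ] P') (hf : ∀ i j x, f (S.op i j x) = S'.op i j (f x)) {a : Alg N}
    (ha : a ∈ (freeOrthogonal N).smooth) {x z : P} (h : S.hom a x = z) :
    S'.hom a (f x : P') = (f z : P') := by
  obtain ⟨y, h1, h2⟩ := exists_hom_apply_coe S S' f hf ha x
  rw [h] at h1
  rw [h2, Completion.coe_injective P h1]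

/-- The commuting pair acting on the two legs of a tensor product. -/
def tensorPair (S : OrthogonalSystem N P) (S' : OrthogonalSystem N P') :
    CommutingPair (Alg N) (Alg N) where
  C := Completion (P ⊗[ℂ] P') →L[ℂ] Completion (P ⊗[ℂ] P')
  f := (S.left P').hom
  g := (S'.right P).hom
  comm := commute_of_commute_coord _ _ fun i j k l => clm_ext fun z => by
    rw [mul_apply_eq_comp, mul_apply_eq_comp, hom_coord_coe, hom_coord_coe, hom_coord_coe,
      hom_coord_coe, op_comm]

/-- The action of the maximal tensor product on the completed tensor product. -/
def tensorHom (S : OrthogonalSystem N P) (S' : OrthogonalSystem N P') :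
    MaxTensor (Alg N) (Alg N) →⋆ₐ[ℂ]
      (Completion (P ⊗[ℂ] P') →L[ℂ] Completion (P ⊗[ℂ] P')) :=
  MaxTensor.lift (S.tensorPair S')

/-- The maps `y ↦ x ⊗ y` and `x ↦ x ⊗ y'` intertwine each factor with its amplification, so the two
legs can be computed separately. -/
theorem tensorHom_tmul (S : OrthogonalSystem N P) (S' : OrthogonalSystem N P') {a b : Alg N}
    (ha : a ∈ (freeOrthogonal N).smooth) (hb : b ∈ (freeOrthogonal N).smooth) {x x' : P}
    {y y' : P'} (hx : S.hom a x = x') (hy : S'.hom b y = y') :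
    S.tensorHom S' (tmul a b) (x ⊗ₜ[ℂ] y : P ⊗[ℂ] P') = (x' ⊗ₜ[ℂ] y' : P ⊗[ℂ] P') := by
  have h1 := hom_apply_of_intertwines S' (S'.right P) (TensorProduct.mk ℂ P P' x)
    (fun _ _ _ => rfl) hb hy
  have h2 := hom_apply_of_intertwines S (S.left P') ((TensorProduct.mk ℂ P P').flip y')
    (fun _ _ _ => rfl) ha hx
  exact (congrArg ((S.left P').hom a) h1).trans h2

end OrthogonalSystem

/-! ### The regular representation -/

/-- The finitely supported sections `(x_k)` with `x_k ∈ M_{dim k}(ℂ)`, that is, the coefficients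
of the smooth elements on the coefficients of the irreducible corepresentations. -/
def Reg (N : ℕ) : Type := Π₀ k, Matrix (Fin (dim N k)) (Fin (dim N k)) ℂ

namespace Reg

instance : AddCommGroup (Reg N) :=
  inferInstanceAs (AddCommGroup (Π₀ k, Matrix (Fin (dim N k)) (Fin (dim N k)) ℂ))

instance : Module ℂ (Reg N) :=
  inferInstanceAs (Module ℂ (Π₀ k, Matrix (Fin (dim N k)) (Fin (dim N k)) ℂ))

/-- The section supported at `k`. -/
def single (k : ℕ) : Matrix (Fin (dim N k)) (Fin (dim N k)) ℂ →ₗ[ℂ] Reg N :=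
  DFinsupp.lsingle (M := fun k => Matrix (Fin (dim N k)) (Fin (dim N k)) ℂ) k

/-- The value at `k`. -/
def coeff (k : ℕ) : Reg N →ₗ[ℂ] Matrix (Fin (dim N k)) (Fin (dim N k)) ℂ :=
  DFinsupp.lapply (M := fun k => Matrix (Fin (dim N k)) (Fin (dim N k)) ℂ) k

/-- The linear map with given restrictions to the sections supported at each `k`. -/
def lsum {V : Type*} [AddCommGroup V] [Module ℂ V]
    (f : ∀ k, Matrix (Fin (dim N k)) (Fin (dim N k)) ℂ →ₗ[ℂ] V) : Reg N →ₗ[ℂ] V :=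
  DFinsupp.lsum ℂ (M := fun k => Matrix (Fin (dim N k)) (Fin (dim N k)) ℂ) f

theorem lsum_single {V : Type*} [AddCommGroup V] [Module ℂ V]
    (f : ∀ k, Matrix (Fin (dim N k)) (Fin (dim N k)) ℂ →ₗ[ℂ] V) (k : ℕ)
    (m : Matrix (Fin (dim N k)) (Fin (dim N k)) ℂ) : lsum f (single k m) = f k m :=
  DFinsupp.lsum_single ℂ f k m

theorem coeff_single_same (k : ℕ) (m : Matrix (Fin (dim N k)) (Fin (dim N k)) ℂ) :
    coeff k (single k m) = m := DFinsupp.single_eq_same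

theorem coeff_single_ne {k l : ℕ} (h : k ≠ l) (m : Matrix (Fin (dim N k)) (Fin (dim N k)) ℂ) :
    coeff l (single k m) = 0 := DFinsupp.single_eq_of_ne h.symm

theorem ext {x y : Reg N} (h : ∀ k, coeff k x = coeff k y) : x = y := DFinsupp.ext h

@[elab_as_elim]
theorem induction_single {p : Reg N → Prop} (x : Reg N) (zero : p 0)
    (add : ∀ x y, p x → p y → p (x + y)) (single : ∀ k m, p (single k m)) : p x := by
  classical
  exact DFinsupp.induction x zero fun k m x _ _ hx => add _ _ (single k m) hx

theorem exists_support (x : Reg N) : ∃ s : Finset ℕ, ∀ k ∉ s, coeff k x = 0 := by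
  classical
  exact ⟨DFinsupp.support (show Π₀ k, Matrix (Fin (dim N k)) (Fin (dim N k)) ℂ from x),
    fun k hk => DFinsupp.notMem_support_iff.mp hk⟩

/-- The support of a section. -/
def supp (x : Reg N) : Finset ℕ := x.exists_support.choose

theorem coeff_of_notMem_supp {x : Reg N} {k : ℕ} (h : k ∉ supp x) : coeff k x = 0 :=
  x.exists_support.choose_spec k h

/-- The scalar product `∑_k (dim k)⁻¹ Tr(x_k⋆ y_k)`. -/
def form (x y : Reg N) : ℂ :=
  ∑ k ∈ supp x, (dim N k : ℂ)⁻¹ * ((coeff k x)ᴴ * coeff k y).trace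

/-- The set `supp x` is an arbitrary choice, possibly larger than the true support; this frees the
form from that choice. -/
theorem form_eq_sum (x y : Reg N) {s : Finset ℕ} (hs : ∀ k ∉ s, coeff k x = 0 ∨ coeff k y = 0) :
    form x y = ∑ k ∈ s, (dim N k : ℂ)⁻¹ * ((coeff k x)ᴴ * coeff k y).trace := by
  classical
  have h1 : form x y = ∑ k ∈ supp x ∪ s, (dim N k : ℂ)⁻¹ * ((coeff k x)ᴴ * coeff k y).trace :=
    Finset.sum_subset Finset.subset_union_left fun k _ hk => by
      rw [coeff_of_notMem_supp hk]
      simp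
  rw [h1]
  refine (Finset.sum_subset Finset.subset_union_right fun k _ hk => ?_).symm
  rcases hs k hk with h | h <;> simp [h]

theorem form_conj (x y : Reg N) : star (form x y) = form y x := by
  rw [form, form_eq_sum y x (s := supp x) fun k hk => Or.inr (coeff_of_notMem_supp hk), star_sum]
  refine Finset.sum_congr rfl fun k _ => ?_
  rw [star_mul', ← Matrix.trace_conjTranspose]
  simp

theorem form_add_right (x y z : Reg N) : form x (y + z) = form x y + form x z := by
  simp only [form, map_add, Matrix.trace_add, mul_add, Finset.sum_add_distrib]

theorem form_smul_right (c : ℂ) (x y : Reg N) : form x (c • y) = c * form x y := by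
  simp only [form, map_smul, Matrix.mul_smul, Matrix.trace_smul, smul_eq_mul, Finset.mul_sum]
  exact Finset.sum_congr rfl fun k _ => by ring

theorem form_single_right (x : Reg N) (k : ℕ) (m : Matrix (Fin (dim N k)) (Fin (dim N k)) ℂ) :
    form x (single k m) = (dim N k : ℂ)⁻¹ * ((coeff k x)ᴴ * m).trace := by
  rw [form_eq_sum x _ (s := {k}) fun l hl => Or.inr (coeff_single_ne (by simpa [eq_comm] using hl) m),
    Finset.sum_singleton, coeff_single_same]

open scoped ComplexOrder in
theorem form_self_term_nonneg (x : Reg N) (k : ℕ) :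
    0 ≤ (dim N k : ℂ)⁻¹ * ((coeff k x)ᴴ * coeff k x).trace :=
  mul_nonneg (by rw [← Complex.ofReal_natCast, ← Complex.ofReal_inv]
                 exact Complex.zero_le_real.mpr (by positivity))
    (Matrix.posSemidef_conjTranspose_mul_self _).trace_nonneg

end Reg

namespace Reg

variable [hN : Fact (2 ≤ N)]

open scoped ComplexOrder in
/-- The scalar product of the regular representation. -/
@[reducible] def core : InnerProductSpace.Core ℂ (Reg N) where
  inner := form
  conj_inner_symm x y := form_conj y x
  re_inner_nonneg x := (Complex.le_def.mp (Finset.sum_nonneg fun k _ => form_self_term_nonneg x k)).1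
  add_left x y z := by
    rw [← form_conj, form_add_right, star_add, form_conj, form_conj]
  smul_left x y c := by
    rw [← form_conj, form_smul_right, star_mul', form_conj]
    rfl
  definite x hx := by
    refine ext fun k => ?_
    by_cases hk : k ∈ supp x
    · have h := (Finset.sum_eq_zero_iff_of_nonneg fun k _ => form_self_term_nonneg x k).mp hx k hk
      rw [mul_eq_zero, inv_eq_zero] at h
      rw [map_zero]
      exact Matrix.trace_conjTranspose_mul_self_eq_zero_iff.mp
        (h.resolve_left (dim_ne_zero hN.out k))
    · rw [coeff_of_notMem_supp hk, map_zero]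

instance : NormedAddCommGroup (Reg N) := core.toNormedAddCommGroup

instance : InnerProductSpace ℂ (Reg N) := InnerProductSpace.ofCore core.toCore

theorem inner_single_right (x : Reg N) (k : ℕ) (m : Matrix (Fin (dim N k)) (Fin (dim N k)) ℂ) :
    inner ℂ x (single k m) = (dim N k : ℂ)⁻¹ * ((coeff k x)ᴴ * m).trace :=
  form_single_right x k m

end Reg

namespace CreationTower

variable (τ : CreationTower N)

/-- The component `x ↦ A_i x A_j⋆` of degree `1` of the action of `u_ij`. -/
def up (k : ℕ) (i j : Fin N) : Matrix (Fin (dim N k)) (Fin (dim N k)) ℂ →ₗ[ℂ]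
    Matrix (Fin (dim N (k + 1))) (Fin (dim N (k + 1))) ℂ where
  toFun m := τ.A k i * m * (τ.A k j)ᴴ
  map_add' m m' := by rw [Matrix.mul_add, Matrix.add_mul]
  map_smul' c m := by simp

/-- The component of degree `-1` of the action of `u_ij`. -/
def down (k : ℕ) (i j : Fin N) : Matrix (Fin (dim N (k + 1))) (Fin (dim N (k + 1))) ℂ →ₗ[ℂ]
    Matrix (Fin (dim N k)) (Fin (dim N k)) ℂ where
  toFun m := (ratio N k)⁻¹ • ((τ.A k i)ᴴ * m * τ.A k j)
  map_add' m m' := by rw [Matrix.mul_add, Matrix.add_mul, smul_add]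
  map_smul' c m := by
    rw [Matrix.mul_smul, Matrix.smul_mul, smul_comm, RingHom.id_apply]

/-- The action of `u_ij` on the regular representation. -/
def op (i j : Fin N) : Reg N →ₗ[ℂ] Reg N :=
  Reg.lsum fun k => Reg.single (k + 1) ∘ₗ τ.up k i j +
    match k with
    | 0 => 0
    | k + 1 => Reg.single k ∘ₗ τ.down k i j

theorem op_single_zero (i j : Fin N) (m : Matrix (Fin (dim N 0)) (Fin (dim N 0)) ℂ) :
    τ.op i j (Reg.single 0 m) = Reg.single 1 (τ.up 0 i j m) := by
  rw [op, Reg.lsum_single]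
  simp

theorem op_single_succ (i j : Fin N) (k : ℕ)
    (m : Matrix (Fin (dim N (k + 1))) (Fin (dim N (k + 1))) ℂ) :
    τ.op i j (Reg.single (k + 1) m) =
      Reg.single (k + 2) (τ.up (k + 1) i j m) + Reg.single k (τ.down k i j m) := by
  rw [op, Reg.lsum_single]
  rfl

theorem coeff_zero_op (i j : Fin N) (x : Reg N) :
    Reg.coeff 0 (τ.op i j x) = τ.down 0 i j (Reg.coeff 1 x) := by
  induction x using Reg.induction_single with
  | zero => simp
  | add x y hx hy => simp only [map_add, hx, hy]
  | single k m =>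
    rcases k with _ | _ | k
    · rw [op_single_zero, Reg.coeff_single_ne (by omega), Reg.coeff_single_ne (by omega), map_zero]
    · rw [op_single_succ, map_add, Reg.coeff_single_ne (by omega), Reg.coeff_single_same,
        Reg.coeff_single_same, zero_add]
    · rw [op_single_succ, map_add, Reg.coeff_single_ne (by omega), Reg.coeff_single_ne (by omega),
        Reg.coeff_single_ne (by omega), map_zero, zero_add]

theorem coeff_succ_op (i j : Fin N) (l : ℕ) (x : Reg N) :
    Reg.coeff (l + 1) (τ.op i j x) =
      τ.up l i j (Reg.coeff l x) + τ.down (l + 1) i j (Reg.coeff (l + 2) x) := by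
  induction x using Reg.induction_single with
  | zero => simp
  | add x y hx hy =>
    simp only [map_add, hx, hy]
    abel
  | single k m =>
    by_cases h1 : k = l
    · subst h1
      rw [Reg.coeff_single_same, Reg.coeff_single_ne (l := k + 2) (by omega), map_zero, add_zero]
      cases k with
      | zero => rw [op_single_zero, Reg.coeff_single_same]
      | succ k =>
        rw [op_single_succ, map_add, Reg.coeff_single_same, Reg.coeff_single_ne (by omega),
          add_zero]
    · rw [Reg.coeff_single_ne h1, map_zero, zero_add]
      by_cases h2 : k = l + 2
      · subst h2
        rw [op_single_succ, map_add, Reg.coeff_single_ne (by omega), Reg.coeff_single_same,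
          Reg.coeff_single_same, zero_add]
      · rw [Reg.coeff_single_ne h2, map_zero]
        cases k with
        | zero => rw [op_single_zero, Reg.coeff_single_ne (by omega)]
        | succ k =>
          rw [op_single_succ, map_add, Reg.coeff_single_ne (by omega),
            Reg.coeff_single_ne (by omega), add_zero]

/-- The weights `(dim k)⁻¹` in the scalar product are chosen for this: the quotient of two
consecutive weights is the constant `(ratio N k)⁻¹` in `down`, which makes `down` the adjoint of
`up`. -/
theorem trace_up_mul [hN : Fact (2 ≤ N)] (k : ℕ) (i j : Fin N)
    (x : Matrix (Fin (dim N k)) (Fin (dim N k)) ℂ)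
    (y : Matrix (Fin (dim N (k + 1))) (Fin (dim N (k + 1))) ℂ) :
    (dim N (k + 1) : ℂ)⁻¹ * ((τ.up k i j x)ᴴ * y).trace =
      (dim N k : ℂ)⁻¹ * (xᴴ * τ.down k i j y).trace := by
  have h : (dim N (k + 1) : ℂ)⁻¹ = (dim N k : ℂ)⁻¹ * (ratio N k)⁻¹ := by
    have := dim_ne_zero hN.out k
    rw [ratio]
    field_simp
  have h2 : ((τ.up k i j x)ᴴ * y).trace = (xᴴ * ((τ.A k i)ᴴ * y * τ.A k j)).trace := by
    simp only [up, LinearMap.coe_mk, AddHom.coe_mk, Matrix.conjTranspose_mul,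
      Matrix.conjTranspose_conjTranspose, Matrix.mul_assoc]
    rw [Matrix.trace_mul_comm]
    simp only [Matrix.mul_assoc]
  rw [h2, h, down, LinearMap.coe_mk, AddHom.coe_mk, Matrix.mul_smul, Matrix.trace_smul,
    smul_eq_mul, mul_assoc]

theorem trace_down_mul [Fact (2 ≤ N)] (k : ℕ) (i j : Fin N)
    (x : Matrix (Fin (dim N (k + 1))) (Fin (dim N (k + 1))) ℂ)
    (y : Matrix (Fin (dim N k)) (Fin (dim N k)) ℂ) :
    (dim N k : ℂ)⁻¹ * ((τ.down k i j x)ᴴ * y).trace =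
      (dim N (k + 1) : ℂ)⁻¹ * (xᴴ * τ.up k i j y).trace := by
  have h := congrArg star (τ.trace_up_mul k i j y x)
  rw [star_mul', star_mul', ← Matrix.trace_conjTranspose, ← Matrix.trace_conjTranspose] at h
  simpa using h.symm

theorem inner_op [Fact (2 ≤ N)] (i j : Fin N) (x y : Reg N) :
    inner ℂ (τ.op i j x) y = inner ℂ x (τ.op i j y) := by
  induction y using Reg.induction_single with
  | zero => simp
  | add y z hy hz => simp only [map_add, inner_add_right, hy, hz]
  | single k m =>
    cases k with
    | zero =>
      rw [op_single_zero, Reg.inner_single_right, Reg.inner_single_right, coeff_zero_op,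
        trace_down_mul]
    | succ k =>
      rw [op_single_succ, inner_add_right, Reg.inner_single_right, Reg.inner_single_right,
        Reg.inner_single_right, coeff_succ_op, Matrix.conjTranspose_add, Matrix.add_mul,
        Matrix.trace_add, mul_add, trace_down_mul, trace_up_mul, add_comm]

/-- Contracting either index puts `∑ A_k A_k = 0`, or its adjoint, on one side of `m`. The two
statements serve the relations `uuᵗ = 1` and `uᵗu = 1`. -/
theorem sum_up_up (n : ℕ) (i j : Fin N) (m : Matrix (Fin (dim N n)) (Fin (dim N n)) ℂ) :
    ∑ k, τ.up (n + 1) i k (τ.up n j k m) = 0 ∧ ∑ k, τ.up (n + 1) k i (τ.up n k j m) = 0 := by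
  constructor
  · calc ∑ k, τ.up (n + 1) i k (τ.up n j k m)
        = ∑ k, (τ.A (n + 1) i * τ.A n j * m) * (τ.A (n + 1) k * τ.A n k)ᴴ :=
          Finset.sum_congr rfl fun k _ => by
            simp only [up, LinearMap.coe_mk, AddHom.coe_mk, Matrix.conjTranspose_mul,
              Matrix.mul_assoc]
      _ = 0 := by
        rw [← Matrix.mul_sum, ← Matrix.conjTranspose_sum, τ.sum_mul, Matrix.conjTranspose_zero,
          Matrix.mul_zero]
  · calc ∑ k, τ.up (n + 1) k i (τ.up n k j m)
        = ∑ k, (τ.A (n + 1) k * τ.A n k) * (m * (τ.A n j)ᴴ * (τ.A (n + 1) i)ᴴ) :=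
          Finset.sum_congr rfl fun k _ => by
            simp only [up, LinearMap.coe_mk, AddHom.coe_mk, Matrix.mul_assoc]
      _ = 0 := by rw [← Matrix.sum_mul, τ.sum_mul, Matrix.zero_mul]

theorem sum_down_down (n : ℕ) (i j : Fin N)
    (m : Matrix (Fin (dim N (n + 2))) (Fin (dim N (n + 2))) ℂ) :
    ∑ k, τ.down n i k (τ.down (n + 1) j k m) = 0 ∧
      ∑ k, τ.down n k i (τ.down (n + 1) k j m) = 0 := by
  constructor
  · calc ∑ k, τ.down n i k (τ.down (n + 1) j k m)
        = ∑ k, ((ratio N n)⁻¹ * (ratio N (n + 1))⁻¹) •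
            ((τ.A n i)ᴴ * (τ.A (n + 1) j)ᴴ * m) * (τ.A (n + 1) k * τ.A n k) :=
          Finset.sum_congr rfl fun k _ => by
            simp only [down, LinearMap.coe_mk, AddHom.coe_mk, Matrix.mul_assoc, Matrix.mul_smul,
              Matrix.smul_mul, smul_smul]
      _ = 0 := by rw [← Matrix.mul_sum, τ.sum_mul, Matrix.mul_zero]
  · calc ∑ k, τ.down n k i (τ.down (n + 1) k j m)
        = ∑ k, (τ.A (n + 1) k * τ.A n k)ᴴ * (((ratio N n)⁻¹ * (ratio N (n + 1))⁻¹) •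
            (m * (τ.A (n + 1) j) * (τ.A n i))) :=
          Finset.sum_congr rfl fun k _ => by
            simp only [down, LinearMap.coe_mk, AddHom.coe_mk, Matrix.mul_assoc, Matrix.mul_smul,
              Matrix.smul_mul, smul_smul, Matrix.conjTranspose_mul]
      _ = 0 := by
        rw [← Matrix.sum_mul, ← Matrix.conjTranspose_sum, τ.sum_mul, Matrix.conjTranspose_zero,
          Matrix.zero_mul]

/-- The contraction produces `∑ A_kᴴ A_k`, the scalar `ratio N n`, which cancels the constant in
`down`. -/
theorem sum_down_up [hN : Fact (2 ≤ N)] (n : ℕ) (i j : Fin N)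
    (m : Matrix (Fin (dim N n)) (Fin (dim N n)) ℂ) :
    ∑ k, τ.down n i k (τ.up n j k m) = (τ.A n i)ᴴ * τ.A n j * m ∧
      ∑ k, τ.down n k i (τ.up n k j m) = m * ((τ.A n j)ᴴ * τ.A n i) := by
  have hr := ratio_ne_zero hN.out n
  constructor
  · calc ∑ k, τ.down n i k (τ.up n j k m)
        = ∑ k, (ratio N n)⁻¹ • ((τ.A n i)ᴴ * τ.A n j * m) * ((τ.A n k)ᴴ * τ.A n k) :=
          Finset.sum_congr rfl fun k _ => by
            simp only [up, down, LinearMap.coe_mk, AddHom.coe_mk, Matrix.mul_assoc,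
              Matrix.smul_mul]
      _ = _ := by
        rw [← Matrix.mul_sum, τ.sum_star_mul, Matrix.mul_smul, Matrix.mul_one, smul_smul,
          mul_inv_cancel₀ hr, one_smul]
  · calc ∑ k, τ.down n k i (τ.up n k j m)
        = ∑ k, ((τ.A n k)ᴴ * τ.A n k) * ((ratio N n)⁻¹ • (m * ((τ.A n j)ᴴ * τ.A n i))) :=
          Finset.sum_congr rfl fun k _ => by
            simp only [up, down, LinearMap.coe_mk, AddHom.coe_mk, Matrix.mul_assoc,
              Matrix.mul_smul]
      _ = _ := by
        rw [← Matrix.sum_mul, τ.sum_star_mul, Matrix.smul_mul, Matrix.one_mul, smul_smul,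
          mul_inv_cancel₀ hr, one_smul]

theorem sum_up_down (n : ℕ) (i j : Fin N)
    (m : Matrix (Fin (dim N (n + 1))) (Fin (dim N (n + 1))) ℂ) :
    ∑ k, τ.up n i k (τ.down n j k m) = (ratio N n)⁻¹ • (τ.A n i * (τ.A n j)ᴴ) * m ∧
      ∑ k, τ.up n k i (τ.down n k j m) = m * (ratio N n)⁻¹ • (τ.A n j * (τ.A n i)ᴴ) := by
  constructor
  · calc ∑ k, τ.up n i k (τ.down n j k m)
        = ∑ k, (ratio N n)⁻¹ • (τ.A n i * (τ.A n j)ᴴ * m) * (τ.A n k * (τ.A n k)ᴴ) :=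
          Finset.sum_congr rfl fun k _ => by
            simp only [up, down, LinearMap.coe_mk, AddHom.coe_mk, Matrix.mul_assoc,
              Matrix.smul_mul, Matrix.mul_smul]
      _ = _ := by rw [← Matrix.mul_sum, τ.sum_mul_star, Matrix.mul_one, Matrix.smul_mul]
  · calc ∑ k, τ.up n k i (τ.down n k j m)
        = ∑ k, (τ.A n k * (τ.A n k)ᴴ) * ((ratio N n)⁻¹ • (m * (τ.A n j * (τ.A n i)ᴴ))) :=
          Finset.sum_congr rfl fun k _ => by
            simp only [up, down, LinearMap.coe_mk, AddHom.coe_mk, Matrix.mul_assoc,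
              Matrix.mul_smul, Matrix.smul_mul]
      _ = _ := by rw [← Matrix.sum_mul, τ.sum_mul_star, Matrix.one_mul, Matrix.mul_smul]

/-- The components of degree `±2` vanish. That of degree 0 is left multiplication by `A_iᴴ A_j + c⁻¹
A_i A_jᴴ`, which is `δ_ij` by the Wenzl relation; on sections supported at 0 only the first term is
present, and the base relation of the tower applies. -/
theorem op_mul_transpose [Fact (2 ≤ N)] (i j : Fin N) (x : Reg N) :
    ∑ k, τ.op i k (τ.op j k x) = if i = j then x else 0 := by
  induction x using Reg.induction_single with
  | zero => simp
  | add x y hx hy =>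
    simp only [map_add, Finset.sum_add_distrib, hx, hy]
    split_ifs <;> simp
  | single n m =>
    rcases n with _ | _ | n
    · simp only [op_single_zero, op_single_succ, Finset.sum_add_distrib, ← map_sum,
        (τ.sum_up_up 0 i j m).1, (τ.sum_down_up 0 i j m).1, τ.star_mul_zero]
      split_ifs <;> simp
    · simp only [op_single_zero, op_single_succ, Finset.sum_add_distrib, ← map_sum, map_add,
        (τ.sum_up_up 1 i j m).1, (τ.sum_down_up 1 i j m).1, (τ.sum_up_down 0 i j m).1,
        τ.star_mul_succ]
      rw [map_zero, zero_add, ← map_add, ← Matrix.add_mul, sub_add_cancel]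
      split_ifs <;> simp
    · simp only [op_single_succ, Finset.sum_add_distrib, ← map_sum, map_add,
        (τ.sum_up_up (n + 2) i j m).1, (τ.sum_down_up (n + 2) i j m).1,
        (τ.sum_up_down (n + 1) i j m).1, (τ.sum_down_down n i j m).1, τ.star_mul_succ]
      rw [map_zero, map_zero, zero_add, add_zero, ← map_add, ← Matrix.add_mul, sub_add_cancel]
      split_ifs <;> simp

theorem op_transpose_mul [Fact (2 ≤ N)] (i j : Fin N) (x : Reg N) :
    ∑ k, τ.op k i (τ.op k j x) = if i = j then x else 0 := by
  -- On this side the degree 0 component is right multiplication by `A_jᴴ A_i + c⁻¹ A_j A_iᴴ`, with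
  -- the indices exchanged.
  simp only [eq_comm (a := i) (b := j)]
  induction x using Reg.induction_single with
  | zero => simp
  | add x y hx hy =>
    simp only [map_add, Finset.sum_add_distrib, hx, hy]
    split_ifs <;> simp
  | single n m =>
    rcases n with _ | _ | n
    · simp only [op_single_zero, op_single_succ, Finset.sum_add_distrib, ← map_sum,
        (τ.sum_up_up 0 i j m).2, (τ.sum_down_up 0 i j m).2, τ.star_mul_zero]
      split_ifs <;> simp
    · simp only [op_single_zero, op_single_succ, Finset.sum_add_distrib, ← map_sum, map_add,
        (τ.sum_up_up 1 i j m).2, (τ.sum_down_up 1 i j m).2, (τ.sum_up_down 0 i j m).2,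
        τ.star_mul_succ]
      rw [map_zero, zero_add, ← map_add, ← Matrix.mul_add, sub_add_cancel]
      split_ifs <;> simp
    · simp only [op_single_succ, Finset.sum_add_distrib, ← map_sum, map_add,
        (τ.sum_up_up (n + 2) i j m).2, (τ.sum_down_up (n + 2) i j m).2,
        (τ.sum_up_down (n + 1) i j m).2, (τ.sum_down_down n i j m).2, τ.star_mul_succ]
      rw [map_zero, map_zero, zero_add, add_zero, ← map_add, ← Matrix.mul_add, sub_add_cancel]
      split_ifs <;> simp

/-- The regular representation of `O_N^+`. -/
def regular [Fact (2 ≤ N)] : OrthogonalSystem N (Reg N) where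
  op := τ.op
  symmetric := τ.inner_op
  transpose_mul := τ.op_transpose_mul
  mul_transpose := τ.op_mul_transpose

end CreationTower

end FreeOrthogonal
end

noncomputable section

open scoped Matrix TensorProduct

/-! ### Elementary tensors -/

namespace MaxTensor

variable {A B : Type*} [CStarAlgebra A] [CStarAlgebra B]

theorem ext {x y : MaxTensor A B} (h : ∀ c : CommutingPair A B, lift c x = lift c y) : x = y :=
  Subtype.ext (BddProd.ext h)

theorem tmul_mul_tmul (a a' : A) (b b' : B) :
    tmul a b * tmul a' b' = tmul (a * a') (b * b') := ext fun c => by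
  rw [map_mul, lift_tmul, lift_tmul, lift_tmul, map_mul, map_mul]
  exact (c.comm a' b).symm.mul_mul_mul_comm _ _

/-- The elementary tensors, as a bilinear map. -/
def tmulₗ : A →ₗ[ℂ] B →ₗ[ℂ] MaxTensor A B :=
  LinearMap.mk₂ ℂ tmul
    (fun a a' b => ext fun c => by simp only [map_add, lift_tmul, add_mul])
    (fun r a b => ext fun c => by simp only [map_smul, lift_tmul, smul_mul_assoc])
    (fun a b b' => ext fun c => by simp only [map_add, lift_tmul, mul_add])
    (fun r a b => ext fun c => by simp only [map_smul, lift_tmul, mul_smul_comm])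

variable (A B) in
/-- The embedding `a ↦ a ⊗ 1`. -/
def inl : A →⋆ₐ[ℂ] MaxTensor A B where
  toFun a := tmul a 1
  map_one' := ext fun c => by simp [lift_tmul]
  map_mul' a a' := ext fun c => by simp [lift_tmul]
  map_zero' := ext fun c => by simp [lift_tmul]
  map_add' a a' := ext fun c => by simp [lift_tmul]
  commutes' r := ext fun c => by simp only [lift_tmul, AlgHomClass.commutes, map_one, mul_one]
  map_star' a := ext fun c => by simp [lift_tmul, map_star]

variable (A B) in
/-- The embedding `b ↦ 1 ⊗ b`. -/
def inr : B →⋆ₐ[ℂ] MaxTensor A B where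
  toFun b := tmul 1 b
  map_one' := ext fun c => by simp [lift_tmul]
  map_mul' a a' := ext fun c => by simp [lift_tmul]
  map_zero' := ext fun c => by simp [lift_tmul]
  map_add' a a' := ext fun c => by simp [lift_tmul]
  commutes' r := ext fun c => by simp only [lift_tmul, AlgHomClass.commutes, map_one, one_mul]
  map_star' a := ext fun c => by simp [lift_tmul, map_star]

theorem inl_mul_inr (a : A) (b : B) : inl A B a * inr A B b = tmul a b :=
  (tmul_mul_tmul _ _ _ _).trans (by rw [mul_one, one_mul])

end MaxTensor

/-! ### Scalar matrices -/

theorem Matrix.map_algebraMap_mul {ι κ μ A : Type*} [Fintype κ] [Ring A] [Algebra ℂ A]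
    (S : Matrix ι κ ℂ) (T : Matrix κ μ ℂ) :
    (S * T).map (algebraMap ℂ A) = S.map (algebraMap ℂ A) * T.map (algebraMap ℂ A) :=
  Matrix.map_mul

theorem Matrix.map_algebraMap_one {ι A : Type*} [DecidableEq ι] [Ring A] [Algebra ℂ A] :
    (1 : Matrix ι ι ℂ).map (algebraMap ℂ A) = 1 :=
  Matrix.map_one _ (map_zero _) (map_one _)

theorem Matrix.conjTranspose_map_algebraMap {ι κ A : Type*} [CStarAlgebra A]
    (T : Matrix ι κ ℂ) : (T.map (algebraMap ℂ A))ᴴ = Tᴴ.map (algebraMap ℂ A) := by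
  ext i j
  simp only [Matrix.conjTranspose_apply, Matrix.map_apply]
  exact (algebraMap_star_comm _).symm

theorem Matrix.map_algebraMap_mul_smul {ι κ μ A : Type*} [Fintype κ] [Ring A] [Algebra ℂ A]
    (S : Matrix ι κ ℂ) (a : A) (M : Matrix κ μ A) :
    S.map (algebraMap ℂ A) * (a • M) = a • (S.map (algebraMap ℂ A) * M) := by
  ext i j
  simp only [Matrix.mul_apply, Matrix.smul_apply, Matrix.map_apply, smul_eq_mul, Finset.mul_sum]
  exact Finset.sum_congr rfl fun k _ => by rw [← mul_assoc, Algebra.commutes, mul_assoc]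

theorem Matrix.map_algebraMap_smul {ι κ A : Type*} [Ring A] [Algebra ℂ A] (c : ℂ)
    (S : Matrix ι κ ℂ) : (c • S).map (algebraMap ℂ A) = c • S.map (algebraMap ℂ A) := by
  ext i j
  simp [Algebra.smul_def]

theorem Matrix.map_algebraMap_map {ι κ A B : Type*} [CStarAlgebra A] [CStarAlgebra B]
    (f : A →⋆ₐ[ℂ] B) (S : Matrix ι κ ℂ) :
    (S.map (algebraMap ℂ A)).map f = S.map (algebraMap ℂ B) := by
  ext i j
  simp [AlgHomClass.commutes]

/-! ### Intertwiners, Schur's lemma, and operations on corepresentations -/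

namespace WoronowiczAlgebra

variable {N : ℕ} {G : WoronowiczAlgebra N}
variable {ι κ μ : Type*} [Fintype ι] [Fintype κ] [Fintype μ]

theorem IsIntertwiner.conjTranspose [DecidableEq ι] [DecidableEq κ] {v : Matrix ι ι G.A}
    {w : Matrix κ κ G.A} {T : Matrix κ ι ℂ} (hT : IsIntertwiner v w T) (hv : v * vᴴ = 1)
    (hw : wᴴ * w = 1) : IsIntertwiner w v Tᴴ := by
  have h := congrArg Matrix.conjTranspose hT
  rw [Matrix.conjTranspose_mul, Matrix.conjTranspose_mul,
    Matrix.conjTranspose_map_algebraMap] at h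
  rw [IsIntertwiner]
  calc Tᴴ.map (algebraMap ℂ G.A) * w
      = v * (vᴴ * Tᴴ.map (algebraMap ℂ G.A)) * w := by
        rw [← Matrix.mul_assoc v, hv, Matrix.one_mul]
    _ = v * Tᴴ.map (algebraMap ℂ G.A) := by
        rw [h, Matrix.mul_assoc, Matrix.mul_assoc, hw, Matrix.mul_one]

theorem IsIntertwiner.comp {v : Matrix ι ι G.A} {w : Matrix κ κ G.A} {x : Matrix μ μ G.A}
    {T : Matrix κ ι ℂ} {S : Matrix μ κ ℂ} (hS : IsIntertwiner w x S) (hT : IsIntertwiner v w T) :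
    IsIntertwiner v x (S * T) := by
  rw [IsIntertwiner, Matrix.map_algebraMap_mul, Matrix.mul_assoc, hT, ← Matrix.mul_assoc, hS,
    Matrix.mul_assoc]

theorem conj_conj {ι : Type*} (v : Matrix ι ι G.A) :
    WoronowiczAlgebra.conj (WoronowiczAlgebra.conj v) = v := by
  ext i j
  simp [WoronowiczAlgebra.conj]

theorem IsIntertwiner.conj {v : Matrix ι ι G.A} {w : Matrix κ κ G.A} {T : Matrix κ ι ℂ}
    (hT : IsIntertwiner v w T) :
    IsIntertwiner (WoronowiczAlgebra.conj v) (WoronowiczAlgebra.conj w) (T.map star) := by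
  rw [IsIntertwiner]
  ext i j
  have h := congrArg star (congrFun (congrFun hT i) j)
  simp only [Matrix.mul_apply, Matrix.map_apply, star_sum, star_mul, WoronowiczAlgebra.conj,
    ← algebraMap_star_comm] at h ⊢
  simpa only [Algebra.commutes] using h

variable [DecidableEq ι] [DecidableEq κ] [DecidableEq μ]

theorem Equivalent.trans {v : Matrix ι ι G.A} {w : Matrix κ κ G.A} {x : Matrix μ μ G.A}
    (h : Equivalent v w) (h' : Equivalent w x) : Equivalent v x := by
  obtain ⟨T, T', h1, h2, h3⟩ := h
  obtain ⟨S, S', h1', h2', h3'⟩ := h'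
  refine ⟨S * T, T' * S', ?_, ?_, h3'.comp h3⟩
  · rw [Matrix.mul_assoc, ← Matrix.mul_assoc T, h1, Matrix.one_mul, h1']
  · rw [Matrix.mul_assoc, ← Matrix.mul_assoc S', h2', Matrix.one_mul, h2]

theorem Equivalent.symm {v : Matrix ι ι G.A} {w : Matrix κ κ G.A} (h : Equivalent v w) :
    Equivalent w v := by
  obtain ⟨T, T', h1, h2, h3⟩ := h
  refine ⟨T', T, h2, h1, ?_⟩
  have h1' := congrArg (fun X => X.map (algebraMap ℂ G.A)) h1
  have h2' := congrArg (fun X => X.map (algebraMap ℂ G.A)) h2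
  simp only [Matrix.map_algebraMap_mul, Matrix.map_algebraMap_one] at h1' h2'
  calc T'.map (algebraMap ℂ G.A) * w
      = T'.map (algebraMap ℂ G.A) * (w * T.map (algebraMap ℂ G.A)) * T'.map (algebraMap ℂ G.A) := by
        rw [Matrix.mul_assoc, Matrix.mul_assoc, h1', Matrix.mul_one]
    _ = v * T'.map (algebraMap ℂ G.A) := by
        rw [← h3, ← Matrix.mul_assoc, h2', Matrix.one_mul]

open scoped ComplexOrder in
/-- Schur's lemma. -/
theorem IsIrreducible.equivalent {v : Matrix ι ι G.A} {w : Matrix κ κ G.A}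
    (hv : IsIrreducible v) (hw : IsIrreducible w) {T : Matrix κ ι ℂ} (hT : IsIntertwiner v w T)
    (hT0 : T ≠ 0) : Equivalent v w := by
  have hT' := hT.conjTranspose hv.1.mul_star_self hw.1.star_mul_self
  obtain ⟨c, hc⟩ := hv.2.2 _ (hT'.comp hT)
  obtain ⟨d, hd⟩ := hw.2.2 _ (hT.comp hT')
  -- Bracketing `T Tᴴ T` in two ways identifies the two scalars, so `T` is a multiple of a unitary.
  have hcd : c • T = d • T := by
    calc c • T = T * (Tᴴ * T) := by rw [hc, Matrix.mul_smul, Matrix.mul_one]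
      _ = d • T := by rw [← Matrix.mul_assoc, hd, Matrix.smul_mul, Matrix.one_mul]
  have hcd' : c = d := smul_left_injective ℂ hT0 hcd
  subst hcd'
  have hc0 : c ≠ 0 := by
    rintro rfl
    rw [zero_smul] at hc
    exact hT0 (Matrix.conjTranspose_mul_self_eq_zero.mp hc)
  refine ⟨T, c⁻¹ • Tᴴ, ?_, ?_, hT⟩
  · rw [Matrix.mul_smul, hd, smul_smul, inv_mul_cancel₀ hc0, one_smul]
  · rw [Matrix.smul_mul, hc, smul_smul, inv_mul_cancel₀ hc0, one_smul]

theorem IsCorep.map_comul {v : Matrix ι ι G.A} (hv : G.IsCorep v) :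
    v.map G.comul = v.map (MaxTensor.inl G.A G.A) * v.map (MaxTensor.inr G.A G.A) := by
  ext i j
  simp only [Matrix.map_apply, Matrix.mul_apply, hv.comul_eq, MaxTensor.inl_mul_inr]

theorem IsCorep.tensor {v : Matrix ι ι G.A} {w : Matrix κ κ G.A} (hv : G.IsCorep v)
    (hw : G.IsCorep w) : G.IsCorep (WoronowiczAlgebra.tensor v w) where
  mem_smooth p q := mul_mem (hv.mem_smooth _ _) (hw.mem_smooth _ _)
  star_mul_self := by
    ext p q
    have h1 (i j : ι) := congrFun (congrFun hv.star_mul_self i) j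
    have h2 := congrFun (congrFun hw.star_mul_self p.2) q.2
    simp only [Matrix.mul_apply, Matrix.conjTranspose_apply, WoronowiczAlgebra.tensor,
      Matrix.of_apply, Fintype.sum_prod_type, star_mul] at h1 h2 ⊢
    rw [Finset.sum_comm]
    have h3 (a : κ) : ∑ i, star (w a p.2) * star (v i p.1) * (v i q.1 * w a q.2) =
        star (w a p.2) * (1 : Matrix ι ι G.A) p.1 q.1 * w a q.2 := by
      rw [← h1, Finset.mul_sum, Finset.sum_mul]
      simp only [mul_assoc]
    rw [Finset.sum_congr rfl fun a _ => h3 a]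
    by_cases h : p.1 = q.1
    · simp only [Matrix.one_apply, h, if_true, mul_one, Prod.ext_iff, true_and] at h2 ⊢
      exact h2
    · simp [h, Prod.ext_iff]
  mul_star_self := by
    ext p q
    have h1 := congrFun (congrFun hv.mul_star_self p.1) q.1
    have h2 (i j : κ) := congrFun (congrFun hw.mul_star_self i) j
    simp only [Matrix.mul_apply, Matrix.conjTranspose_apply, WoronowiczAlgebra.tensor,
      Matrix.of_apply, Fintype.sum_prod_type, star_mul] at h1 h2 ⊢
    have h3 (i : ι) : ∑ a, v p.1 i * w p.2 a * (star (w q.2 a) * star (v q.1 i)) =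
        v p.1 i * (1 : Matrix κ κ G.A) p.2 q.2 * star (v q.1 i) := by
      rw [← h2, Finset.mul_sum, Finset.sum_mul]
      simp only [mul_assoc]
    rw [Finset.sum_congr rfl fun a _ => h3 a]
    by_cases h : p.2 = q.2
    · simp only [Matrix.one_apply, h, if_true, mul_one, Prod.ext_iff, and_true] at h1 ⊢
      exact h1
    · simp [h, Prod.ext_iff]
  comul_eq p q := by
    simp only [WoronowiczAlgebra.tensor, Matrix.of_apply, map_mul, hv.comul_eq, hw.comul_eq,
      Finset.sum_mul_sum, Fintype.sum_prod_type, MaxTensor.tmul_mul_tmul]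
  counit_eq p q := by
    simp only [WoronowiczAlgebra.tensor, Matrix.of_apply, map_mul, hv.counit_eq, hw.counit_eq,
      Prod.ext_iff]
    split_ifs <;> simp_all
  antipode_eq p q := by
    simp only [WoronowiczAlgebra.tensor, Matrix.of_apply, map_mul, hv.antipode_eq, hw.antipode_eq,
      star_mul, MulOpposite.op_mul]

/-- The restriction of a corepresentation to an invariant subspace. -/
theorem IsCorep.compress {v : Matrix ι ι G.A} {w : Matrix κ κ G.A} (hv : G.IsCorep v)
    {J : Matrix ι κ ℂ} (hJ : Jᴴ * J = 1) (h1 : IsIntertwiner w v J) (h2 : IsIntertwiner v w Jᴴ) :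
    G.IsCorep w := by
  rw [IsIntertwiner] at h1 h2
  have hJ' : Jᴴ.map (algebraMap ℂ G.A) * J.map (algebraMap ℂ G.A) = 1 := by
    rw [← Matrix.map_algebraMap_mul, hJ, Matrix.map_algebraMap_one]
  have hw : w = Jᴴ.map (algebraMap ℂ G.A) * v * J.map (algebraMap ℂ G.A) := by
    rw [Matrix.mul_assoc, ← h1, ← Matrix.mul_assoc, hJ', Matrix.one_mul]
  have hwi (c d : κ) : w c d = ∑ j, ∑ i, (star (J i c) * J j d) • v i j := by
    rw [congrFun (congrFun hw c) d, Matrix.mul_apply]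
    refine Finset.sum_congr rfl fun j _ => ?_
    rw [Matrix.mul_apply, Finset.sum_mul]
    refine Finset.sum_congr rfl fun i _ => ?_
    rw [Matrix.map_apply, Matrix.map_apply, ← Algebra.commutes, ← Algebra.smul_def,
      ← Algebra.smul_def, smul_smul, Matrix.conjTranspose_apply, mul_comm]
  have hw' : wᴴ = Jᴴ.map (algebraMap ℂ G.A) * vᴴ * J.map (algebraMap ℂ G.A) := by
    rw [hw, Matrix.conjTranspose_mul, Matrix.conjTranspose_mul,
      Matrix.conjTranspose_map_algebraMap, Matrix.conjTranspose_map_algebraMap,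
      Matrix.conjTranspose_conjTranspose, Matrix.mul_assoc]
  refine ⟨fun c d => ?_, ?_, ?_, fun c d => ?_, fun c d => ?_, fun c d => ?_⟩
  · rw [hwi]
    exact sum_mem fun j _ => sum_mem fun i _ => SMulMemClass.smul_mem _ (hv.mem_smooth i j)
  · rw [hw', Matrix.mul_assoc, h1, Matrix.mul_assoc, ← Matrix.mul_assoc vᴴ, hv.star_mul_self,
      Matrix.one_mul, hJ']
  · rw [hw', ← Matrix.mul_assoc, ← Matrix.mul_assoc, ← h2, Matrix.mul_assoc _ v,
      hv.mul_star_self, Matrix.mul_one, hJ']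
  -- Morphisms fix scalar matrices, so `J` and `Jᴴ` can be moved through `v ⊗ 1` and `1 ⊗ v` until
  -- they meet as `JᴴJ = 1`.
  · have hΔ : w.map G.comul =
        w.map (MaxTensor.inl G.A G.A) * w.map (MaxTensor.inr G.A G.A) := by
      have e1 := congrArg (fun X => X.map (MaxTensor.inl G.A G.A)) h2
      have e2 := congrArg (fun X => X.map (MaxTensor.inr G.A G.A)) h1
      have e3 := congrArg (fun X => X.map G.comul) hw
      simp only [Matrix.map_mul, Matrix.map_algebraMap_map] at e1 e2 e3
      rw [e3, hv.map_comul, ← Matrix.mul_assoc, e1, Matrix.mul_assoc, ← e2, Matrix.mul_assoc,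
        ← Matrix.mul_assoc (Jᴴ.map _), ← Matrix.map_algebraMap_mul, hJ,
        Matrix.map_algebraMap_one, Matrix.one_mul]
    have := congrFun (congrFun hΔ c) d
    simpa only [Matrix.map_apply, Matrix.mul_apply, MaxTensor.inl_mul_inr] using this
  · have := congrFun (congrFun hJ c) d
    simp only [Matrix.mul_apply, Matrix.conjTranspose_apply, Matrix.one_apply] at this
    rw [hwi, map_sum, ← this]
    simp [map_sum, hv.counit_eq]
  · simp only [hwi, map_sum, star_sum, Finset.op_sum]
    rw [Finset.sum_comm]
    refine Finset.sum_congr rfl fun i _ => Finset.sum_congr rfl fun j _ => ?_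
    rw [map_smul, hv.antipode_eq, star_smul, ← MulOpposite.op_smul]
    simp [mul_comm]

/-- Unitarity of the conjugate is not formal over a noncommutative algebra. It comes from the
antipode, which reverses products and so carries `v vᴴ = 1` to `v̄ᴴ v̄ = 1`, and likewise for the
other relation. -/
theorem IsCorep.conj {v : Matrix ι ι G.A} (hv : G.IsCorep v) :
    G.IsCorep (WoronowiczAlgebra.conj v) where
  mem_smooth i j := star_mem (hv.mem_smooth i j)
  star_mul_self := by
    ext i j
    have h := congrArg (fun x => (G.antipode x).unop) (congrFun (congrFun hv.mul_star_self j) i)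
    simp only [Matrix.mul_apply, Matrix.conjTranspose_apply, map_sum, map_mul, map_star,
      hv.antipode_eq, Finset.unop_sum, MulOpposite.unop_mul, MulOpposite.unop_star,
      MulOpposite.unop_op, star_star] at h
    simp only [Matrix.mul_apply, Matrix.conjTranspose_apply, WoronowiczAlgebra.conj,
      Matrix.map_apply, star_star]
    rw [h]
    simp only [Matrix.one_apply, eq_comm (a := i)]
    split_ifs <;> simp
  mul_star_self := by
    ext i j
    have h := congrArg (fun x => (G.antipode x).unop) (congrFun (congrFun hv.star_mul_self j) i)
    simp only [Matrix.mul_apply, Matrix.conjTranspose_apply, map_sum, map_mul, map_star,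
      hv.antipode_eq, Finset.unop_sum, MulOpposite.unop_mul, MulOpposite.unop_star,
      MulOpposite.unop_op, star_star] at h
    simp only [Matrix.mul_apply, Matrix.conjTranspose_apply, WoronowiczAlgebra.conj,
      Matrix.map_apply, star_star]
    rw [h]
    simp only [Matrix.one_apply, eq_comm (a := i)]
    split_ifs <;> simp
  comul_eq i j := by
    simp only [WoronowiczAlgebra.conj, Matrix.map_apply, map_star, hv.comul_eq, star_sum]
    refine Finset.sum_congr rfl fun k _ => MaxTensor.ext fun c => ?_
    rw [map_star, MaxTensor.lift_tmul, MaxTensor.lift_tmul, star_mul, ← map_star, ← map_star,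
      (c.comm _ _).eq]
  counit_eq i j := by
    simp only [WoronowiczAlgebra.conj, Matrix.map_apply, map_star, hv.counit_eq]
    split_ifs <;> simp
  antipode_eq i j := by
    simp only [WoronowiczAlgebra.conj, Matrix.map_apply, map_star, hv.antipode_eq, star_star,
      ← MulOpposite.op_star]

theorem IsIrreducible.conj {v : Matrix ι ι G.A} (hv : IsIrreducible v) :
    IsIrreducible (WoronowiczAlgebra.conj v) := by
  refine ⟨hv.1.conj, hv.2.1, fun T hT => ?_⟩
  have h := hT.conj
  rw [conj_conj] at h
  obtain ⟨c, hc⟩ := hv.2.2 _ h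
  refine ⟨star c, ?_⟩
  ext i j
  have h' := congrArg star (congrFun (congrFun hc i) j)
  simp only [Matrix.map_apply, star_star] at h'
  rw [h', Matrix.smul_apply, Matrix.smul_apply, Matrix.one_apply]
  split_ifs <;> simp

end WoronowiczAlgebra
end

/-! ### The corepresentations `r_k` and the decomposition of `u ⊗ r_k` -/

noncomputable section

open scoped Matrix TensorProduct

theorem Matrix.map_sum_of_addMonoidHom {ι κ μ R S : Type*} [AddCommMonoid R] [AddCommMonoid S]
    (f : R →+ S) (s : Finset μ) (M : μ → Matrix ι κ R) :
    (∑ k ∈ s, M k).map f = ∑ k ∈ s, (M k).map f := by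
  ext i j
  simp [Matrix.sum_apply]

theorem Matrix.ite_one_zero_mul {ι κ R : Type*} [Fintype ι] [DecidableEq ι] [Semiring R] (p : Prop)
    [Decidable p] (M : Matrix ι κ R) :
    (if p then 1 else 0 : Matrix ι ι R) * M = if p then M else 0 := by
  split_ifs <;> simp

theorem Matrix.mul_ite_one_zero {ι κ R : Type*} [Fintype ι] [DecidableEq ι] [Semiring R] (p : Prop)
    [Decidable p] (M : Matrix κ ι R) :
    M * (if p then 1 else 0 : Matrix ι ι R) = if p then M else 0 := by
  split_ifs <;> simp

namespace FreeOrthogonal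

variable {N : ℕ}

namespace CreationTower

variable (τ : CreationTower N)

/-- The entrywise complex conjugate tower. -/
def conj : CreationTower N :=
  have hs {ι κ μ : Type} [Fintype κ] (S : Matrix ι κ ℂ) (T : Matrix κ μ ℂ) :
      S.map (starRingEnd ℂ) * T.map (starRingEnd ℂ) = (S * T).map (starRingEnd ℂ) :=
    Matrix.map_mul.symm
  have ht {ι κ : Type} (S : Matrix ι κ ℂ) :
      (S.map (starRingEnd ℂ))ᴴ = Sᴴ.map (starRingEnd ℂ) := rfl
  have hsum {ι κ : Type} (M : Fin N → Matrix ι κ ℂ) :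
      ∑ k, (M k).map (starRingEnd ℂ) = (∑ k, M k).map (starRingEnd ℂ) :=
    (Matrix.map_sum_of_addMonoidHom (starRingEnd ℂ : ℂ →+ ℂ) Finset.univ M).symm
  have hsmul {ι κ : Type} (c : ℂ) (M : Matrix ι κ ℂ) (hc : star c = c) :
      (c • M).map (starRingEnd ℂ) = c • M.map (starRingEnd ℂ) := by
    ext i j
    rw [Matrix.map_apply, Matrix.smul_apply, smul_eq_mul, map_mul]
    exact congrArg (· * _) hc
  have hone {ι : Type} [DecidableEq ι] :
      (1 : Matrix ι ι ℂ).map (starRingEnd ℂ) = 1 := Matrix.map_one _ (map_zero _) (map_one _)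
  { A := fun k i => (τ.A k i).map (starRingEnd ℂ)
    sum_mul_star := fun k => by
      simp only [ht, hs, hsum, τ.sum_mul_star, hone]
    sum_star_mul := fun k => by
      simp only [ht, hs, hsum, τ.sum_star_mul, hsmul _ _ (star_ratio N k), hone]
    star_mul_zero := fun i j => by
      simp only [ht, hs, τ.star_mul_zero]
      split_ifs
      · exact hone
      · exact Matrix.map_zero _ (map_zero _)
    star_mul_succ := fun k i j => by
      simp only [ht, hs, τ.star_mul_succ]
      rw [Matrix.map_sub _ (map_sub _), hsmul _ _ (by rw [star_inv₀, star_ratio])]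
      congr 1
      split_ifs
      · exact hone
      · exact Matrix.map_zero _ (map_zero _)
    sum_mul := fun k => by
      simp only [hs, hsum, τ.sum_mul]
      exact Matrix.map_zero _ (map_zero _) }

/-- The creation operators, as matrices over `C(O_N^+)`. -/
def cre (k : ℕ) (i : Fin N) : Matrix (Fin (dim N (k + 1))) (Fin (dim N k)) (Alg N) :=
  (τ.A k i).map (algebraMap ℂ (Alg N))

/-- The annihilation operators, as matrices over `C(O_N^+)`. -/
def ann (k : ℕ) (i : Fin N) : Matrix (Fin (dim N k)) (Fin (dim N (k + 1))) (Alg N) :=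
  (τ.A k i)ᴴ.map (algebraMap ℂ (Alg N))

theorem cre_mul_smul {μ : Type*} (k : ℕ) (i : Fin N) (a : Alg N)
    (M : Matrix (Fin (dim N k)) μ (Alg N)) : τ.cre k i * (a • M) = a • (τ.cre k i * M) :=
  Matrix.map_algebraMap_mul_smul _ _ _

theorem ann_mul_smul {μ : Type*} (k : ℕ) (i : Fin N) (a : Alg N)
    (M : Matrix (Fin (dim N (k + 1))) μ (Alg N)) : τ.ann k i * (a • M) = a • (τ.ann k i * M) :=
  Matrix.map_algebraMap_mul_smul _ _ _

theorem map_algebraMap_ite {n : ℕ} (p : Prop) [Decidable p] :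
    (if p then 1 else 0 : Matrix (Fin n) (Fin n) ℂ).map (algebraMap ℂ (Alg N)) =
      if p then 1 else 0 := by
  split_ifs
  · exact Matrix.map_algebraMap_one
  · exact Matrix.map_zero _ (map_zero _)

theorem ann_mul_cre_zero (i j : Fin N) :
    τ.ann 0 i * τ.cre 0 j = if i = j then 1 else 0 := by
  rw [ann, cre, ← Matrix.map_algebraMap_mul, τ.star_mul_zero, map_algebraMap_ite]

theorem ann_mul_cre_succ (k : ℕ) (i j : Fin N) :
    τ.ann (k + 1) i * τ.cre (k + 1) j =
      (if i = j then 1 else 0) - (ratio N k)⁻¹ • (τ.cre k i * τ.ann k j) := by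
  rw [ann, cre, ← Matrix.map_algebraMap_mul, τ.star_mul_succ, Matrix.map_sub _ (map_sub _),
    map_algebraMap_ite, Matrix.map_algebraMap_smul, Matrix.map_algebraMap_mul]
  rfl

theorem sum_cre_mul_cre (k : ℕ) : ∑ i, τ.cre (k + 1) i * τ.cre k i = 0 := by
  simp only [cre, ← Matrix.map_algebraMap_mul]
  refine (Matrix.map_sum_of_addMonoidHom (algebraMap ℂ (Alg N) : ℂ →+ Alg N) _ _).symm.trans ?_
  rw [τ.sum_mul]
  exact Matrix.map_zero _ (map_zero _)

theorem sum_ann_mul_ann (k : ℕ) : ∑ i, τ.ann k i * τ.ann (k + 1) i = 0 := by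
  simp only [ann, ← Matrix.map_algebraMap_mul, ← Matrix.conjTranspose_mul]
  refine (Matrix.map_sum_of_addMonoidHom (algebraMap ℂ (Alg N) : ℂ →+ Alg N) _ _).symm.trans ?_
  rw [← Matrix.conjTranspose_sum, τ.sum_mul, Matrix.conjTranspose_zero]
  exact Matrix.map_zero _ (map_zero _)

/-- The irreducible corepresentations of `O_N^+`. -/
def irrep : ∀ k, Matrix (Fin (dim N k)) (Fin (dim N k)) (Alg N)
  | 0 => 1
  | k + 1 => ∑ i, ∑ j, coord i j • (τ.cre k i * irrep k * τ.ann k j)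

theorem irrep_succ (k : ℕ) :
    τ.irrep (k + 1) = ∑ i, ∑ j, coord i j • (τ.cre k i * τ.irrep k * τ.ann k j) := rfl

theorem sum_coord_mul_transpose {M : Type*} [AddCommGroup M] [Module (Alg N) M] (i : Fin N)
    (x : Fin N → M) : ∑ j, coord i j • ∑ l, coord l j • x l = x i := by
  simp only [Finset.smul_sum, smul_smul]
  rw [Finset.sum_comm]
  simp only [← Finset.sum_smul]
  have h (l : Fin N) : ∑ j, coord i j * coord l j = (1 : Matrix (Fin N) (Fin N) (Alg N)) i l :=
    congrFun (congrFun (coord_orthogonal (N := N)).mul_transpose i) l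
  simp [h, Matrix.one_apply]

theorem sum_coord_transpose_mul {M : Type*} [AddCommGroup M] [Module (Alg N) M] (j : Fin N)
    (x : Fin N → M) : ∑ i, coord i j • ∑ l, coord i l • x l = x j := by
  simp only [Finset.smul_sum, smul_smul]
  rw [Finset.sum_comm]
  simp only [← Finset.sum_smul]
  have h (l : Fin N) : ∑ i, coord i j * coord i l = (1 : Matrix (Fin N) (Fin N) (Alg N)) j l :=
    congrFun (congrFun (coord_orthogonal (N := N)).transpose_mul j) l
  simp [h, Matrix.one_apply]

/-- These are the two intertwining relations between `r_{k+1}` and `u ⊗ r_k` along `H_{k+1} ⊂ ℂ^N ⊗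
H_k`. Expanding `r_{k+2}` and applying the Wenzl relation leaves the wanted term and a correction.
The induction hypothesis, inverted by orthogonality of `u`, moves `r_{k+1}` out of the way, and the
correction then contains `∑ A_iᴴ A_iᴴ = 0`, respectively `∑ A_i A_i = 0`. -/
theorem ann_irrep_and_irrep_cre (k : ℕ) :
    (∀ i, τ.ann k i * τ.irrep (k + 1) = ∑ j, coord i j • (τ.irrep k * τ.ann k j)) ∧
      ∀ j, τ.irrep (k + 1) * τ.cre k j = ∑ i, coord i j • (τ.cre k i * τ.irrep k) := by
  induction k with
  | zero =>
    constructor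
    · intro l
      rw [irrep_succ, Matrix.mul_sum, Finset.sum_eq_single l]
      · simp only [Matrix.mul_sum, ann_mul_smul, ← Matrix.mul_assoc, ann_mul_cre_zero, if_true,
          Matrix.one_mul]
      · intro i _ hi
        simp only [Matrix.mul_sum, ann_mul_smul, ← Matrix.mul_assoc, ann_mul_cre_zero,
          if_neg hi.symm, Matrix.zero_mul, smul_zero, Finset.sum_const_zero]
      · simp
    · intro l
      rw [irrep_succ, Matrix.sum_mul]
      refine Finset.sum_congr rfl fun i _ => ?_
      rw [Matrix.sum_mul, Finset.sum_eq_single l]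
      · simp only [Matrix.smul_mul, Matrix.mul_assoc, ann_mul_cre_zero, if_true, Matrix.mul_one]
      · intro j _ hj
        simp only [Matrix.smul_mul, Matrix.mul_assoc, ann_mul_cre_zero, if_neg hj, Matrix.mul_zero,
          smul_zero]
      · simp
  | succ k ih =>
    have e1 (i : Fin N) : ∑ j, coord i j • (τ.irrep (k + 1) * τ.cre k j) =
        τ.cre k i * τ.irrep k := by
      simp only [ih.2]
      exact sum_coord_mul_transpose i fun l => τ.cre k l * τ.irrep k
    have e2 (j : Fin N) : ∑ i, coord i j • (τ.ann k i * τ.irrep (k + 1)) =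
        τ.irrep k * τ.ann k j := by
      simp only [ih.1]
      exact sum_coord_transpose_mul j fun l => τ.irrep k * τ.ann k l
    constructor
    · intro l
      have h1 : ∑ i, ∑ j, coord i j •
          (τ.cre k l * τ.ann k i * τ.irrep (k + 1) * τ.ann (k + 1) j) = 0 := by
        rw [Finset.sum_comm]
        calc ∑ j, ∑ i, coord i j • (τ.cre k l * τ.ann k i * τ.irrep (k + 1) * τ.ann (k + 1) j)
            = ∑ j, τ.cre k l * (∑ i, coord i j • (τ.ann k i * τ.irrep (k + 1))) *
                τ.ann (k + 1) j := by
              simp only [Matrix.mul_sum, Matrix.sum_mul, cre_mul_smul, Matrix.smul_mul,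
                Matrix.mul_assoc]
          _ = 0 := by
              simp only [e2, Matrix.mul_assoc]
              rw [← Matrix.mul_sum, ← Matrix.mul_sum, τ.sum_ann_mul_ann, Matrix.mul_zero,
                Matrix.mul_zero]
      rw [irrep_succ τ (k + 1)]
      simp only [Matrix.mul_sum, ann_mul_smul, ← Matrix.mul_assoc, ann_mul_cre_succ,
        Matrix.sub_mul, Matrix.smul_mul, smul_sub, Finset.sum_sub_distrib, smul_comm _ (ratio N k)⁻¹]
      simp only [← Finset.smul_sum, h1, smul_zero, sub_zero, Matrix.ite_one_zero_mul]
      rw [Finset.sum_eq_single l]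
      · simp
      · intro i _ hi
        simp [hi.symm]
      · simp
    · intro l
      have h1 : ∑ i, ∑ j, coord i j •
          (τ.cre (k + 1) i * τ.irrep (k + 1) * (τ.cre k j * τ.ann k l)) = 0 := by
        calc ∑ i, ∑ j, coord i j •
              (τ.cre (k + 1) i * τ.irrep (k + 1) * (τ.cre k j * τ.ann k l))
            = ∑ i, τ.cre (k + 1) i * (∑ j, coord i j • (τ.irrep (k + 1) * τ.cre k j)) *
                τ.ann k l := by
              simp only [Matrix.mul_sum, Matrix.sum_mul, cre_mul_smul, Matrix.smul_mul,
                Matrix.mul_assoc]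
          _ = 0 := by
              simp only [e1, ← Matrix.mul_assoc]
              rw [← Matrix.sum_mul, ← Matrix.sum_mul, τ.sum_cre_mul_cre, Matrix.zero_mul,
                Matrix.zero_mul]
      rw [irrep_succ τ (k + 1)]
      simp only [Matrix.sum_mul, Matrix.smul_mul, Matrix.mul_assoc _ (τ.ann (k + 1) _),
        ann_mul_cre_succ, Matrix.mul_sub, Matrix.mul_smul, smul_sub, Finset.sum_sub_distrib,
        smul_comm _ (ratio N k)⁻¹]
      simp only [← Finset.smul_sum, h1, smul_zero, sub_zero, Matrix.mul_ite_one_zero]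
      simp

theorem ann_mul_irrep (k : ℕ) (i : Fin N) :
    τ.ann k i * τ.irrep (k + 1) = ∑ j, coord i j • (τ.irrep k * τ.ann k j) :=
  (τ.ann_irrep_and_irrep_cre k).1 i

theorem irrep_mul_cre (k : ℕ) (j : Fin N) :
    τ.irrep (k + 1) * τ.cre k j = ∑ i, coord i j • (τ.cre k i * τ.irrep k) :=
  (τ.ann_irrep_and_irrep_cre k).2 j

theorem coord_smul_irrep_zero (i j : Fin N) :
    coord i j • τ.irrep 0 = τ.ann 0 i * τ.irrep 1 * τ.cre 0 j := by
  rw [ann_mul_irrep, Matrix.sum_mul]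
  simp only [Matrix.smul_mul, Matrix.mul_assoc, ann_mul_cre_zero, Matrix.mul_ite_one_zero]
  simp

/-- This is `u ⊗ r_{k+1} ∼ r_{k+2} + r_k` at the level of entries. Paired with matrices it becomes
the regular representation; its trace is the Chebyshev recursion. -/
theorem coord_smul_irrep_succ (k : ℕ) (i j : Fin N) :
    coord i j • τ.irrep (k + 1) = τ.ann (k + 1) i * τ.irrep (k + 2) * τ.cre (k + 1) j +
      (ratio N k)⁻¹ • (τ.cre k i * τ.irrep k * τ.ann k j) := by
  have h1 : ∑ l, coord i l • (τ.irrep (k + 1) * (τ.cre k l * τ.ann k j)) =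
      τ.cre k i * τ.irrep k * τ.ann k j := by
    rw [← sum_coord_mul_transpose i fun l => τ.cre k l * τ.irrep k, Matrix.sum_mul]
    simp only [← irrep_mul_cre, Matrix.smul_mul, Matrix.mul_assoc]
  rw [ann_mul_irrep, Matrix.sum_mul]
  simp only [Matrix.smul_mul, Matrix.mul_assoc, ann_mul_cre_succ, Matrix.mul_sub, Matrix.mul_smul,
    smul_sub, Finset.sum_sub_distrib, smul_comm _ (ratio N k)⁻¹] at h1 ⊢
  simp only [← Finset.smul_sum, h1, Matrix.mul_ite_one_zero]
  simp

open WoronowiczAlgebra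

/-- The isometry `H_{k+1} → ℂ^N ⊗ H_k`. -/
def isometry (k : ℕ) : Matrix (Fin N × Fin (dim N k)) (Fin (dim N (k + 1))) ℂ :=
  Matrix.of fun p c => star (τ.A k p.1 c p.2)

theorem isometry_star_mul (k : ℕ) : (τ.isometry k)ᴴ * τ.isometry k = 1 := by
  rw [← τ.sum_mul_star k]
  ext x y
  simp [isometry, Matrix.mul_apply, Fintype.sum_prod_type, Matrix.sum_apply]

theorem isCorep_coord : (freeOrthogonal N).IsCorep coord where
  mem_smooth := coord_mem_smooth
  star_mul_self := (freeOrthogonal N).star_mul_u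
  mul_star_self := (freeOrthogonal N).mul_star_u
  comul_eq := (freeOrthogonal N).comul_u
  counit_eq := (freeOrthogonal N).counit_u
  antipode_eq := (freeOrthogonal N).antipode_u

theorem isCorep_one (G : WoronowiczAlgebra N) {ι : Type*} [Fintype ι] [DecidableEq ι] :
    G.IsCorep (1 : Matrix ι ι G.A) where
  mem_smooth i j := by
    rw [Matrix.one_apply]
    split_ifs
    · exact one_mem _
    · exact zero_mem _
  star_mul_self := by simp
  mul_star_self := by simp
  comul_eq i j := by
    have h := congrFun (congrFun (Matrix.one_mul (1 : Matrix ι ι (MaxTensor G.A G.A))) i) j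
    simp only [Matrix.mul_apply, Matrix.one_apply] at h ⊢
    rw [apply_ite G.comul, map_one, map_zero, ← h]
    refine Finset.sum_congr rfl fun k _ => ?_
    rw [← MaxTensor.inl_mul_inr, apply_ite (MaxTensor.inl G.A G.A),
      apply_ite (MaxTensor.inr G.A G.A), map_one, map_zero, map_one, map_zero]
  counit_eq i j := by
    rw [Matrix.one_apply]
    split_ifs <;> simp
  antipode_eq i j := by
    simp only [Matrix.one_apply, eq_comm (a := i)]
    split_ifs <;> simp

theorem isCorep_irrep (k : ℕ) : (freeOrthogonal N).IsCorep (τ.irrep k) := by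
  induction k with
  | zero => exact isCorep_one _
  | succ k ih =>
    -- The two conditions left are the relations `ann_mul_irrep` and `irrep_mul_cre`, read entry by
    -- entry.
    refine (isCorep_coord.tensor ih).compress (τ.isometry_star_mul k) ?_ ?_
    · refine Matrix.ext fun p d => ?_
      have h := congrFun (congrFun (τ.ann_mul_irrep k p.1) p.2) d
      have h' : ∑ c, algebraMap ℂ (Alg N) (star (τ.A k p.1 c p.2)) * τ.irrep (k + 1) c d =
          ∑ q : Fin N × Fin (dim N k), coord p.1 q.1 * τ.irrep k p.2 q.2 *
            algebraMap ℂ (Alg N) (star (τ.A k q.1 d q.2)) := by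
        simp only [Matrix.mul_apply, Matrix.sum_apply, Matrix.smul_apply, ann, Matrix.map_apply,
          Matrix.conjTranspose_apply, smul_eq_mul, Finset.mul_sum] at h
        rw [h, Fintype.sum_prod_type]
        simp only [mul_assoc]
      exact h'
    · refine Matrix.ext fun c p => ?_
      have h := congrFun (congrFun (τ.irrep_mul_cre k p.1) c) p.2
      have h' : ∑ q : Fin N × Fin (dim N k), algebraMap ℂ (Alg N) (star (star (τ.A k q.1 c q.2))) *
          (coord q.1 p.1 * τ.irrep k q.2 p.2) =
          ∑ d, τ.irrep (k + 1) c d * algebraMap ℂ (Alg N) (star (star (τ.A k p.1 d p.2))) := by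
        simp only [Matrix.mul_apply, Matrix.sum_apply, Matrix.smul_apply, cre, Matrix.map_apply,
          smul_eq_mul, Finset.mul_sum] at h
        simp only [star_star]
        rw [h, Fintype.sum_prod_type]
        refine Finset.sum_congr rfl fun i _ => Finset.sum_congr rfl fun a _ => ?_
        rw [← mul_assoc, Algebra.commutes, mul_assoc]
      exact h'

end CreationTower

end FreeOrthogonal
end

/-! ### Peter–Weyl: coefficients of the `r_k` against the regular representation -/

noncomputable section

open scoped Matrix TensorProduct
open UniformSpace

namespace FreeOrthogonal

variable {N : ℕ}

/-- The pairing `m ↦ ∑_ab m_ab M_ab`. -/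
def pairing {n : ℕ} (M : Matrix (Fin n) (Fin n) (Alg N)) :
    Matrix (Fin n) (Fin n) ℂ →ₗ[ℂ] Alg N where
  toFun m := ∑ a, ∑ b, m a b • M a b
  map_add' m m' := by
    simp only [Matrix.add_apply, add_smul, Finset.sum_add_distrib]
  map_smul' c m := by
    simp only [Matrix.smul_apply, Finset.smul_sum, smul_smul, smul_eq_mul, RingHom.id_apply]

theorem pairing_apply {n : ℕ} (M : Matrix (Fin n) (Fin n) (Alg N))
    (m : Matrix (Fin n) (Fin n) ℂ) : pairing M m = ∑ a, ∑ b, m a b • M a b := rfl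

theorem pairing_add {n : ℕ} (M M' : Matrix (Fin n) (Fin n) (Alg N))
    (m : Matrix (Fin n) (Fin n) ℂ) : pairing (M + M') m = pairing M m + pairing M' m := by
  simp only [pairing_apply, Matrix.add_apply, smul_add, Finset.sum_add_distrib]

theorem pairing_smul {n : ℕ} (c : ℂ) (M : Matrix (Fin n) (Fin n) (Alg N))
    (m : Matrix (Fin n) (Fin n) ℂ) : pairing (c • M) m = c • pairing M m := by
  simp only [pairing_apply, Matrix.smul_apply, smul_comm _ c, Finset.smul_sum]

theorem pairing_mul_smul {n : ℕ} (a : Alg N) (M : Matrix (Fin n) (Fin n) (Alg N))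
    (m : Matrix (Fin n) (Fin n) ℂ) : pairing (a • M) m = a * pairing M m := by
  simp only [pairing_apply, Matrix.smul_apply, Finset.mul_sum, smul_eq_mul, mul_smul_comm]

theorem pairing_mul_mul {n n' : ℕ} (X : Matrix (Fin n') (Fin n) ℂ) (Y : Matrix (Fin n) (Fin n') ℂ)
    (M : Matrix (Fin n') (Fin n') (Alg N)) (m : Matrix (Fin n) (Fin n) ℂ) :
    pairing M (X * m * Y) =
      pairing (Xᵀ.map (algebraMap ℂ (Alg N)) * M * Yᵀ.map (algebraMap ℂ (Alg N))) m := by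
  have h (a b : Fin n) : (Xᵀ.map (algebraMap ℂ (Alg N)) * M * Yᵀ.map (algebraMap ℂ (Alg N))) a b =
      ∑ d, ∑ c, (X c a * Y b d) • M c d := by
    rw [Matrix.mul_apply]
    refine Finset.sum_congr rfl fun d _ => ?_
    rw [Matrix.mul_apply, Finset.sum_mul]
    refine Finset.sum_congr rfl fun c _ => ?_
    rw [Matrix.map_apply, Matrix.map_apply, ← Algebra.commutes, ← Algebra.smul_def,
      ← Algebra.smul_def, smul_smul, Matrix.transpose_apply, Matrix.transpose_apply, mul_comm]
  simp only [pairing_apply, h, Matrix.mul_apply, Finset.sum_mul, Finset.sum_smul, Finset.smul_sum,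
    smul_smul]
  rw [Finset.sum_comm]
  refine (Finset.sum_congr rfl fun d _ => Finset.sum_comm.trans
    (Finset.sum_congr rfl fun b _ => Finset.sum_comm)).trans ?_
  rw [Finset.sum_comm]
  refine (Finset.sum_congr rfl fun b _ => Finset.sum_comm).trans ?_
  rw [Finset.sum_comm]
  refine Finset.sum_congr rfl fun a _ => Finset.sum_congr rfl fun b _ =>
    Finset.sum_congr rfl fun d _ => Finset.sum_congr rfl fun c _ => ?_
  congr 1
  ring

namespace CreationTower

variable (τ : CreationTower N)

/-- The smooth element with given coefficients. -/
def toAlg : Reg N →ₗ[ℂ] Alg N := Reg.lsum fun k => pairing (τ.conj.irrep k)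

theorem toAlg_single (k : ℕ) (m : Matrix (Fin (dim N k)) (Fin (dim N k)) ℂ) :
    τ.toAlg (Reg.single k m) = ∑ a, ∑ b, m a b • τ.conj.irrep k a b :=
  Reg.lsum_single _ _ _

/-- Moving `A` across the pairing transposes it, and transposes of `A` are adjoints of its complex
conjugate. This is why the coefficients are taken from the conjugate tower. -/
theorem pairing_up (k : ℕ) (i j : Fin N)
    (M : Matrix (Fin (dim N (k + 1))) (Fin (dim N (k + 1))) (Alg N))
    (m : Matrix (Fin (dim N k)) (Fin (dim N k)) ℂ) :
    pairing M (τ.up k i j m) = pairing (τ.conj.ann k i * M * τ.conj.cre k j) m := by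
  refine (pairing_mul_mul (τ.A k i) (τ.A k j)ᴴ M m).trans ?_
  congr 4
  ext a b
  simp [ann, conj]

theorem pairing_down (k : ℕ) (i j : Fin N) (M : Matrix (Fin (dim N k)) (Fin (dim N k)) (Alg N))
    (m : Matrix (Fin (dim N (k + 1))) (Fin (dim N (k + 1))) ℂ) :
    pairing M (τ.down k i j m) =
      pairing ((ratio N k)⁻¹ • (τ.conj.cre k i * M * τ.conj.ann k j)) m := by
  rw [pairing_smul]
  refine (map_smul _ _ _).trans (congrArg _ ((pairing_mul_mul (τ.A k i)ᴴ (τ.A k j) M m).trans ?_))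
  congr 3
  ext a b
  simp [ann, conj]

theorem toAlg_op (i j : Fin N) (x : Reg N) : τ.toAlg (τ.op i j x) = coord i j * τ.toAlg x := by
  induction x using Reg.induction_single with
  | zero => simp
  | add x y hx hy => simp only [map_add, mul_add, hx, hy]
  | single k m =>
    rw [toAlg, Reg.lsum_single, ← pairing_mul_smul]
    cases k with
    | zero =>
      rw [op_single_zero, Reg.lsum_single, pairing_up, coord_smul_irrep_zero]
    | succ k =>
      rw [op_single_succ, map_add, Reg.lsum_single, Reg.lsum_single, pairing_up, pairing_down,
        coord_smul_irrep_succ, pairing_add]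

/-- The coefficients of the unit. -/
def _root_.FreeOrthogonal.Reg.vac : Reg N := Reg.single 0 1

theorem toAlg_vac : τ.toAlg Reg.vac = 1 := by
  rw [Reg.vac, toAlg_single]
  change ∑ a : Fin 1, ∑ b : Fin 1, (1 : Matrix (Fin 1) (Fin 1) ℂ) a b •
    (1 : Matrix (Fin 1) (Fin 1) (Alg N)) a b = 1
  simp

/-- Inserting `∑ A_i A_iᴴ = 1` on both sides shows that the raising maps `up` jointly cover the next
degree. -/
theorem eq_sum_up (k : ℕ) (m : Matrix (Fin (dim N (k + 1))) (Fin (dim N (k + 1))) ℂ) :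
    m = ∑ i, ∑ j, τ.up k i j ((τ.A k i)ᴴ * m * τ.A k j) := by
  calc m = (∑ i, τ.A k i * (τ.A k i)ᴴ) * m * ∑ j, τ.A k j * (τ.A k j)ᴴ := by
        rw [τ.sum_mul_star, Matrix.one_mul, Matrix.mul_one]
    _ = _ := by
        rw [Matrix.sum_mul, Matrix.sum_mul]
        simp only [Matrix.mul_sum, up, LinearMap.coe_mk, AddHom.coe_mk, Matrix.mul_assoc]

/-- Degree `k + 2` is reached by applying `op` in degree `k + 1` and subtracting the part that falls
into degree `k`; hence the induction carries two consecutive degrees. -/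
theorem vac_cyclic [Fact (2 ≤ N)] {W : Submodule ℂ (Reg N)} (h1 : Reg.vac ∈ W)
    (h2 : ∀ i j, ∀ x ∈ W, τ.op i j x ∈ W) (x : Reg N) : x ∈ W := by
  have key (k : ℕ) : (∀ m, Reg.single k m ∈ W) ∧ ∀ m, Reg.single (k + 1) m ∈ W := by
    induction k with
    | zero =>
      have h0 (m : Matrix (Fin (dim N 0)) (Fin (dim N 0)) ℂ) : Reg.single 0 m ∈ W := by
        have hm : m = m (0 : Fin 1) (0 : Fin 1) • 1 := by
          refine Matrix.ext fun (a : Fin 1) (b : Fin 1) => ?_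
          rw [Subsingleton.elim a 0, Subsingleton.elim b 0]
          exact (mul_one _).symm
        rw [hm, map_smul]
        exact W.smul_mem _ h1
      refine ⟨h0, fun m => ?_⟩
      rw [τ.eq_sum_up 0 m, map_sum]
      refine W.sum_mem fun i _ => ?_
      rw [map_sum]
      refine W.sum_mem fun j _ => ?_
      rw [← op_single_zero]
      exact h2 _ _ _ (h0 _)
    | succ k ih =>
      refine ⟨ih.2, fun m => ?_⟩
      rw [τ.eq_sum_up (k + 1) m, map_sum]
      refine W.sum_mem fun i _ => ?_
      rw [map_sum]
      refine W.sum_mem fun j _ => ?_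
      rw [← add_sub_cancel_right (Reg.single (k + 2) _) (Reg.single k (τ.down k i j
        ((τ.A (k + 1) i)ᴴ * m * τ.A (k + 1) j))), ← op_single_succ]
      exact W.sub_mem (h2 _ _ _ (ih.2 _)) (ih.1 _)
  induction x using Reg.induction_single with
  | zero => exact W.zero_mem
  | add x y hx hy => exact W.add_mem hx hy
  | single k m => exact (key k).1 m

theorem toAlg_mem_smooth (x : Reg N) : τ.toAlg x ∈ (freeOrthogonal N).smooth := by
  induction x using Reg.induction_single with
  | zero => rw [map_zero]; exact zero_mem _
  | add x y hx hy => rw [map_add]; exact add_mem hx hy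
  | single k m =>
    rw [toAlg_single]
    exact sum_mem fun a _ => sum_mem fun b _ =>
      (freeOrthogonal N).smooth.smul_mem ((τ.conj.isCorep_irrep k).mem_smooth a b) _

/-- The range of `toAlg` contains 1 and is stable under left multiplication by the generators. -/
theorem exists_toAlg_eq {a : Alg N} (ha : a ∈ (freeOrthogonal N).smooth) :
    ∃ x, τ.toAlg x = a := by
  have h : ∀ x, ∃ y, τ.toAlg y = a * τ.toAlg x := by
    refine smooth_induction (p := fun a => ∀ x, ∃ y, τ.toAlg y = a * τ.toAlg x)
      (fun c x => ⟨c • x, ?_⟩) (fun i j x => ⟨_, τ.toAlg_op i j x⟩) ?_ ?_ ha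
    · rw [map_smul, Algebra.smul_def]
    · intro a b ha hb x
      obtain ⟨y, hy⟩ := ha x
      obtain ⟨z, hz⟩ := hb x
      exact ⟨y + z, by rw [map_add, hy, hz, add_mul]⟩
    · intro a b ha hb x
      obtain ⟨z, hz⟩ := hb x
      obtain ⟨y, hy⟩ := ha z
      exact ⟨y, by rw [hy, hz, mul_assoc]⟩
  obtain ⟨y, hy⟩ := h Reg.vac
  exact ⟨y, by rw [hy, toAlg_vac, mul_one]⟩

/-- The element of the algebraic tensor square with given coefficients. -/
def toTensor : Reg N ⊗[ℂ] Reg N →ₗ[ℂ] MaxTensor (Alg N) (Alg N) :=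
  TensorProduct.lift (MaxTensor.tmulₗ.compl₁₂ τ.toAlg τ.toAlg)

theorem toTensor_tmul (x y : Reg N) : τ.toTensor (x ⊗ₜ y) = tmul (τ.toAlg x) (τ.toAlg y) := rfl

variable [hN : Fact (2 ≤ N)]

instance : Nontrivial (Reg N) := by
  refine ⟨Reg.vac, 0, fun h => ?_⟩
  have h' := congrArg (Reg.coeff 0) h
  rw [Reg.vac, Reg.coeff_single_same, map_zero] at h'
  exact one_ne_zero (α := ℂ) (congrFun (congrFun h' (0 : Fin 1)) (0 : Fin 1))

/-- Both sides agree at the vacuum and transform in the same way under every `op i j`, so cyclicity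
of the vacuum gives equality. The orbit map of the vacuum thus inverts `toAlg`, which yields the
linear independence of all coefficients. -/
theorem hom_toAlg_vac (x : Reg N) :
    τ.regular.hom (τ.toAlg x) (Reg.vac : Reg N) = (x : Completion (Reg N)) := by
  let W : Submodule ℂ (Reg N) :=
    { carrier := {x | τ.regular.hom (τ.toAlg x) (Reg.vac : Reg N) = (x : Completion (Reg N))}
      add_mem' := fun {x y} hx hy => by
        simp only [Set.mem_ofPred_eq] at hx hy ⊢
        rw [map_add, map_add, _root_.add_apply, hx, hy, Completion.coe_add]
      zero_mem' := by
        simp only [Set.mem_ofPred_eq]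
        rw [map_zero, map_zero, Completion.coe_zero]
        rfl
      smul_mem' := fun c x hx => by
        simp only [Set.mem_ofPred_eq] at hx ⊢
        rw [map_smul, map_smul, _root_.smul_apply, hx, Completion.coe_smul] }
  refine τ.vac_cyclic (W := W) ?_ ?_ x
  · change τ.regular.hom (τ.toAlg Reg.vac) _ = _
    rw [toAlg_vac, map_one]
    rfl
  · intro i j x hx
    change τ.regular.hom (τ.toAlg x) (Reg.vac : Reg N) = (x : Completion (Reg N)) at hx
    change τ.regular.hom (τ.toAlg (τ.op i j x)) _ = _
    rw [toAlg_op, map_mul, mul_apply_eq_comp, hx, OrthogonalSystem.hom_coord_coe]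
    rfl

theorem toAlg_injective : Function.Injective τ.toAlg := fun x y h =>
  Completion.coe_injective _ (by rw [← hom_toAlg_vac τ x, h, hom_toAlg_vac])

/-- The comultiplication takes values in a C⋆-completion. Acting on the vector `vac ⊗ vac` recovers
algebraic tensors from their images there. -/
theorem tensorHom_toTensor_vac (z : Reg N ⊗[ℂ] Reg N) :
    τ.regular.tensorHom τ.regular (τ.toTensor z) (Reg.vac ⊗ₜ[ℂ] Reg.vac : Reg N ⊗[ℂ] Reg N) =
      (z : Completion (Reg N ⊗[ℂ] Reg N)) := by
  induction z with
  | zero =>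
    rw [map_zero, map_zero, Completion.coe_zero]
    rfl
  | add z w hz hw =>
    rw [map_add, map_add, _root_.add_apply, hz, hw, Completion.coe_add]
  | tmul x y =>
    exact OrthogonalSystem.tensorHom_tmul _ _ (τ.toAlg_mem_smooth x) (τ.toAlg_mem_smooth y)
      (τ.hom_toAlg_vac x) (τ.hom_toAlg_vac y)

theorem toTensor_injective : Function.Injective τ.toTensor := fun x y h =>
  Completion.coe_injective _ (by
    rw [← tensorHom_toTensor_vac τ x, h, tensorHom_toTensor_vac])

end CreationTower

end FreeOrthogonal
end

/-! ### Coefficients under comultiplication, and classification of irreducibles -/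

noncomputable section

open scoped Matrix TensorProduct
open UniformSpace

theorem WoronowiczAlgebra.Equivalent.card_eq {N : ℕ} {G : WoronowiczAlgebra N} {ι κ : Type*}
    [Fintype ι] [DecidableEq ι] [Fintype κ] [DecidableEq κ] {v : Matrix ι ι G.A}
    {w : Matrix κ κ G.A} (h : Equivalent v w) : Fintype.card ι = Fintype.card κ := by
  obtain ⟨T, T', h1, h2, -⟩ := h
  have h3 := Matrix.trace_mul_comm T T'
  rw [h1, h2, Matrix.trace_one, Matrix.trace_one] at h3
  exact_mod_cast h3.symm

namespace FreeOrthogonal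

open WoronowiczAlgebra

variable {N : ℕ}

theorem eq_of_eq_on_smooth {X : Type*} [TopologicalSpace X] [T2Space X] {f g : Alg N → X}
    (hf : Continuous f) (hg : Continuous g) (h : ∀ a ∈ (freeOrthogonal N).smooth, f a = g a) :
    f = g := by
  refine Continuous.ext_on (s := {a : Alg N | a ∈ (freeOrthogonal N).smooth}) ?_ hf hg h
  intro a
  have ha : a ∈ cstarClosure (Set.range fun p : Fin N × Fin N => coord p.1 p.2) := by
    rw [generate_coord]
    trivial
  exact ha

namespace Reg

/-- The matrix units. -/
def elem (k : ℕ) (a b : Fin (dim N k)) : Reg N := single k (Matrix.single a b 1)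

/-- The entries of the values. -/
def entry (k : ℕ) (a b : Fin (dim N k)) : Reg N →ₗ[ℂ] ℂ :=
  Matrix.entryLinearMap ℂ ℂ a b ∘ₗ coeff k

theorem entry_apply (k : ℕ) (a b : Fin (dim N k)) (x : Reg N) : entry k a b x = coeff k x a b := rfl

variable (N) in
/-- The integration functional, in terms of coefficients. -/
def integral : Reg N →ₗ[ℂ] ℂ := Matrix.traceLinearMap (Fin (dim N 0)) ℂ ℂ ∘ₗ coeff 0

theorem integral_apply (x : Reg N) : integral N x = (coeff 0 x).trace := rfl

/-- The comultiplication, in terms of coefficients. -/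
def cop : Reg N →ₗ[ℂ] Reg N ⊗[ℂ] Reg N :=
  lsum fun k =>
    { toFun := fun m => ∑ a, ∑ b, m a b • ∑ e, elem k a e ⊗ₜ[ℂ] elem k e b
      map_add' := fun m m' => by
        simp only [Matrix.add_apply, add_smul, Finset.sum_add_distrib]
      map_smul' := fun c m => by
        simp only [Matrix.smul_apply, smul_assoc, Finset.smul_sum, RingHom.id_apply] }

theorem cop_single (k : ℕ) (m : Matrix (Fin (dim N k)) (Fin (dim N k)) ℂ) :
    cop (single k m) = ∑ a, ∑ b, m a b • ∑ e, elem k a e ⊗ₜ[ℂ] elem k e b :=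
  lsum_single _ _ _

end Reg

namespace CreationTower

variable (τ : CreationTower N)

theorem toAlg_elem (k : ℕ) (a b : Fin (dim N k)) :
    τ.toAlg (Reg.elem k a b) = τ.conj.irrep k a b := by
  rw [Reg.elem, toAlg_single, Finset.sum_eq_single a, Finset.sum_eq_single b]
  · simp
  · intro b' _ hb
    simp [hb.symm]
  · simp
  · intro a' _ ha
    refine Finset.sum_eq_zero fun b' _ => ?_
    simp [ha.symm]
  · simp

theorem comul_toAlg (x : Reg N) :
    FreeOrthogonal.comul (τ.toAlg x) = τ.toTensor (Reg.cop x) := by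
  induction x using Reg.induction_single with
  | zero => simp only [map_zero]
  | add x y hx hy => simp only [map_add, hx, hy]
  | single k m =>
    rw [toAlg_single, Reg.cop_single]
    simp only [map_sum, map_smul, toTensor_tmul, toAlg_elem]
    refine Finset.sum_congr rfl fun a _ => Finset.sum_congr rfl fun b _ => ?_
    exact congrArg _ ((τ.conj.isCorep_irrep k).comul_eq a b)

/-- The slice map `x ⊗ y ↦ f(x) y`. -/
def sliceLeft (f : Reg N →ₗ[ℂ] ℂ) : Reg N ⊗[ℂ] Reg N →ₗ[ℂ] Alg N :=
  TensorProduct.lift ((LinearMap.lsmul ℂ (Alg N)).compl₁₂ f τ.toAlg)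

/-- The slice map `x ⊗ y ↦ f(y) x`. -/
def sliceRight (f : Reg N →ₗ[ℂ] ℂ) : Reg N ⊗[ℂ] Reg N →ₗ[ℂ] Alg N :=
  TensorProduct.lift ((LinearMap.lsmul ℂ (Alg N)).flip.compl₁₂ τ.toAlg f)

theorem sliceLeft_tmul (f : Reg N →ₗ[ℂ] ℂ) (x y : Reg N) :
    τ.sliceLeft f (x ⊗ₜ y) = f x • τ.toAlg y := rfl

theorem sliceRight_tmul (f : Reg N →ₗ[ℂ] ℂ) (x y : Reg N) :
    τ.sliceRight f (x ⊗ₜ y) = f y • τ.toAlg x := rfl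

theorem sliceRight_entry_cop (k : ℕ) (e b : Fin (dim N k)) (x : Reg N) :
    τ.sliceRight (Reg.entry k e b) (Reg.cop x) =
      ∑ a, Reg.coeff k x a b • τ.conj.irrep k a e := by
  induction x using Reg.induction_single with
  | zero => simp
  | add x y hx hy => simp only [map_add, hx, hy, Matrix.add_apply, add_smul, Finset.sum_add_distrib]
  | single l m =>
    simp only [Reg.cop_single, map_sum, map_smul, sliceRight_tmul, toAlg_elem, Reg.entry_apply]
    by_cases h : l = k
    · subst h
      simp only [Reg.elem, Reg.coeff_single_same]
      refine Finset.sum_congr rfl fun a _ => ?_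
      rw [Finset.sum_eq_single b, Finset.sum_eq_single e]
      · simp
      · intro f _ hf
        simp [hf]
      · simp
      · intro b' _ hb
        simp [hb]
      · simp
    · simp [Reg.elem, Reg.coeff_single_ne h]

theorem irrep_zero_apply (a b : Fin (dim N 0)) : τ.conj.irrep 0 a b = if a = b then 1 else 0 :=
  Matrix.one_apply

/-- Since `cop` preserves the degree on both legs, integrating one leg kills everything but degree
0, where `r_0 = 1`. This is the invariance of the Haar integration on coefficients. -/
theorem sliceLeft_integral_cop (x : Reg N) :
    τ.sliceLeft (Reg.integral N) (Reg.cop x) = Reg.integral N x • 1 := by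
  induction x using Reg.induction_single with
  | zero => simp
  | add x y hx hy => simp only [map_add, hx, hy, add_smul]
  | single l m =>
    simp only [Reg.cop_single, map_sum, map_smul, sliceLeft_tmul, toAlg_elem, Reg.integral_apply]
    by_cases h : l = 0
    · subst h
      simp only [Reg.elem, Reg.coeff_single_same, irrep_zero_apply]
      rw [Matrix.trace, Finset.sum_smul]
      refine Finset.sum_congr rfl fun a _ => ?_
      rw [Finset.sum_eq_single a, Finset.sum_eq_single a]
      · simp
      · intro f _ hf
        simp [hf]
      · simp
      · intro b _ hb
        rw [Finset.sum_eq_zero, smul_zero]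
        intro e _
        by_cases he : e = b
        · subst he
          simp [hb.symm]
        · simp [he]
      · simp
    · simp [Reg.elem, Reg.coeff_single_ne h]

theorem sliceRight_integral_cop (x : Reg N) :
    τ.sliceRight (Reg.integral N) (Reg.cop x) = Reg.integral N x • 1 := by
  induction x using Reg.induction_single with
  | zero => simp
  | add x y hx hy => simp only [map_add, hx, hy, add_smul]
  | single l m =>
    simp only [Reg.cop_single, map_sum, map_smul, sliceRight_tmul, toAlg_elem, Reg.integral_apply]
    by_cases h : l = 0
    · subst h
      simp only [Reg.elem, Reg.coeff_single_same, irrep_zero_apply]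
      rw [Matrix.trace, Finset.sum_smul]
      refine Finset.sum_congr rfl fun a _ => ?_
      rw [Finset.sum_eq_single a, Finset.sum_eq_single a]
      · simp
      · intro f _ hf
        simp [hf.symm]
      · simp
      · intro b _ hb
        rw [Finset.sum_eq_zero, smul_zero]
        intro e _
        by_cases he : a = e
        · subst he
          simp [hb.symm]
        · simp [he]
      · simp
    · simp [Reg.elem, Reg.coeff_single_ne h]

variable [hN : Fact (2 ≤ N)]

theorem cop_eq_of_comul_eq {x : Reg N} {ι : Type*} [Fintype ι] {p q : ι → Reg N}
    (h : FreeOrthogonal.comul (τ.toAlg x) = ∑ i, tmul (τ.toAlg (p i)) (τ.toAlg (q i))) :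
    Reg.cop x = ∑ i, p i ⊗ₜ[ℂ] q i :=
  τ.toTensor_injective (by
    rw [← comul_toAlg, h, map_sum]
    rfl)

theorem nontrivial_alg (τ : CreationTower N) : Nontrivial (Alg N) := by
  refine ⟨1, 0, fun h => ?_⟩
  rw [← τ.toAlg_vac, ← map_zero τ.toAlg] at h
  have h' := congrArg (Reg.coeff 0) (τ.toAlg_injective h)
  rw [Reg.vac, Reg.coeff_single_same, map_zero] at h'
  exact one_ne_zero (α := ℂ) (congrFun (congrFun h' (0 : Fin 1)) (0 : Fin 1))

/-- The coefficients of a corepresentation give intertwiners from the irreducible ones. -/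
theorem isIntertwiner_coeff {ι : Type*} [Fintype ι] [DecidableEq ι] {v : Matrix ι ι (Alg N)}
    (hv : (freeOrthogonal N).IsCorep v) {p : ι → ι → Reg N} (hp : ∀ i j, τ.toAlg (p i j) = v i j)
    (k : ℕ) (b : Fin (dim N k)) (j : ι) :
    IsIntertwiner (G := freeOrthogonal N) (τ.conj.irrep k) v
      (Matrix.of fun i e => Reg.coeff k (p i j) e b) := by
  refine Matrix.ext fun i e => ?_
  -- `Δ(v_ij)` is computed from the coefficients of `v_ij` and as `∑ v_im ⊗ v_mj`. Slicing the right
  -- leg by the coefficient functional at `(e, b)` compares the two.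
  have h := τ.cop_eq_of_comul_eq (x := p i j) (p := fun m => p i m) (q := fun m => p m j) (by
    simp only [hp]
    exact hv.comul_eq i j)
  have h' := congrArg (τ.sliceRight (Reg.entry k e b)) h
  rw [sliceRight_entry_cop, map_sum] at h'
  simp only [sliceRight_tmul, hp, Reg.entry_apply] at h'
  have h1 : ∑ a, algebraMap ℂ (Alg N) (Reg.coeff k (p i j) a b) * τ.conj.irrep k a e =
      ∑ m, v i m * algebraMap ℂ (Alg N) (Reg.coeff k (p m j) e b) := by
    simp only [← Algebra.commutes, ← Algebra.smul_def]
    exact h'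
  exact h1

/-- One entry of `T r_k = r_l T`, read on coefficients thanks to injectivity of `toAlg`. For `k ≠ l`
the two sides live in different degrees, so `T = 0`; for `k = l` comparing entries makes `T` scalar.
-/
theorem single_eq_single_of_isIntertwiner {k l : ℕ} {T : Matrix (Fin (dim N l)) (Fin (dim N k)) ℂ}
    (hT : IsIntertwiner (G := freeOrthogonal N) (τ.conj.irrep k) (τ.conj.irrep l) T)
    (a : Fin (dim N l)) (b : Fin (dim N k)) :
    Reg.single k (Matrix.of fun c b' => if b' = b then T a c else 0) =
      Reg.single l (Matrix.of fun a' d => if a' = a then T d b else 0) := by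
  refine τ.toAlg_injective ?_
  have h : ∑ c, algebraMap ℂ (Alg N) (T a c) * τ.conj.irrep k c b =
      ∑ d, τ.conj.irrep l a d * algebraMap ℂ (Alg N) (T d b) := congrFun (congrFun hT a) b
  simp only [← Algebra.commutes, ← Algebra.smul_def] at h
  rw [toAlg_single, toAlg_single]
  simpa [ite_smul] using h

theorem eq_zero_of_isIntertwiner {k l : ℕ} (hkl : k ≠ l)
    {T : Matrix (Fin (dim N l)) (Fin (dim N k)) ℂ}
    (hT : IsIntertwiner (G := freeOrthogonal N) (τ.conj.irrep k) (τ.conj.irrep l) T) : T = 0 := by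
  ext a b
  have h := congrArg (fun x => Reg.coeff k x b b) (τ.single_eq_single_of_isIntertwiner hT a b)
  simp only [Reg.coeff_single_same, Reg.coeff_single_ne hkl.symm] at h
  simpa using h

theorem isIrreducible_irrep (k : ℕ) :
    IsIrreducible (G := freeOrthogonal N) (τ.conj.irrep k) := by
  have hd := dim_pos hN.out k
  refine ⟨τ.conj.isCorep_irrep k, ⟨⟨0, hd⟩⟩, fun T hT => ⟨T ⟨0, hd⟩ ⟨0, hd⟩, ?_⟩⟩
  ext a c
  have h := congrArg (fun x => Reg.coeff k x c ⟨0, hd⟩)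
    (τ.single_eq_single_of_isIntertwiner hT a ⟨0, hd⟩)
  simp only [Reg.coeff_single_same] at h
  simpa [Matrix.one_apply, eq_comm] using h

theorem eq_of_equivalent_irrep {k l : ℕ}
    (h : Equivalent (G := freeOrthogonal N) (τ.conj.irrep k) (τ.conj.irrep l)) : k = l := by
  have := h.card_eq
  rw [Fintype.card_fin, Fintype.card_fin] at this
  exact (dim_strictMono hN.out).injective this

/-- By unitarity some entry of `v` is nonzero, so it has a nonzero coefficient on some `r_k`; this
coefficient is an entry of an intertwiner, to which Schur's lemma applies. -/
theorem exists_equivalent_irrep {n : ℕ} {v : Matrix (Fin n) (Fin n) (Alg N)}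
    (hv : IsIrreducible (G := freeOrthogonal N) v) :
    ∃ k, Equivalent (G := freeOrthogonal N) v (τ.conj.irrep k) := by
  have := τ.nontrivial_alg
  choose p hp using fun i j => τ.exists_toAlg_eq (hv.1.mem_smooth i j)
  obtain ⟨i⟩ := hv.2.1
  have hne : ∃ m, v m i ≠ 0 := by
    by_contra! h0
    have h : ∑ m, star (v m i) * v m i = (1 : Matrix (Fin n) (Fin n) (Alg N)) i i :=
      congrFun (congrFun hv.1.star_mul_self i) i
    simp [h0] at h
  obtain ⟨m, hm⟩ := hne
  have hk : ∃ k, Reg.coeff k (p m i) ≠ 0 := by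
    by_contra! h0
    refine hm ((hp m i).symm.trans ?_)
    rw [show p m i = 0 from Reg.ext fun k => by rw [h0, map_zero], map_zero]
  obtain ⟨k, hk⟩ := hk
  have hab : ∃ e b, Reg.coeff k (p m i) e b ≠ 0 := by
    by_contra! h0
    exact hk (Matrix.ext h0)
  obtain ⟨e, b, hab⟩ := hab
  refine ⟨k, Equivalent.symm ((τ.isIrreducible_irrep k).equivalent hv
    (τ.isIntertwiner_coeff hv.1 hp k b i) fun h0 => hab ?_)⟩
  exact congrFun (congrFun h0 m) e

/-- The conjugate is irreducible of the same dimension, and distinct `r_l` have distinct dimensions.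
-/
theorem equivalent_conj_irrep (k : ℕ) : Equivalent (G := freeOrthogonal N) (τ.conj.irrep k)
    (WoronowiczAlgebra.conj (G := freeOrthogonal N) (τ.conj.irrep k)) := by
  obtain ⟨l, hl⟩ := τ.exists_equivalent_irrep (τ.isIrreducible_irrep k).conj
  have := hl.card_eq
  rw [Fintype.card_fin, Fintype.card_fin] at this
  obtain rfl := (dim_strictMono hN.out).injective this
  exact hl.symm

theorem equivalent_conj (τ : CreationTower N) {n : ℕ} {v : Matrix (Fin n) (Fin n) (Alg N)}
    (hv : IsIrreducible (G := freeOrthogonal N) v) :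
    Equivalent v (WoronowiczAlgebra.conj (G := freeOrthogonal N) v) := by
  obtain ⟨k, hk⟩ := τ.exists_equivalent_irrep hv
  obtain ⟨l, hl⟩ := τ.exists_equivalent_irrep hv.conj
  have h1 := hk.card_eq
  have h2 := hl.card_eq
  rw [Fintype.card_fin, Fintype.card_fin] at h1 h2
  obtain rfl := (dim_strictMono hN.out).injective (h1.symm.trans h2)
  exact hk.trans hl.symm

/-- Because `r_k` is equivalent to its conjugate, the span of its coefficients is stable under the
involution. This is what the trace property of the Haar integration needs. -/
theorem exists_star_toAlg_single (k : ℕ) (m : Matrix (Fin (dim N k)) (Fin (dim N k)) ℂ) :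
    ∃ m', star (τ.toAlg (Reg.single k m)) = τ.toAlg (Reg.single k m') := by
  obtain ⟨T, T', h1, -, h3⟩ := τ.equivalent_conj_irrep k
  have h (a b : Fin (dim N k)) : star (τ.conj.irrep k a b) =
      τ.toAlg (Reg.single k (Matrix.of fun c d => T a c * T' d b)) := by
    have h4 : (τ.conj.irrep k).map star = T.map (algebraMap ℂ (Alg N)) * τ.conj.irrep k *
        T'.map (algebraMap ℂ (Alg N)) := by
      have h5 : T.map (algebraMap ℂ (Alg N)) * τ.conj.irrep k =
        (τ.conj.irrep k).map star * T.map (algebraMap ℂ (Alg N)) := h3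
      rw [h5, Matrix.mul_assoc, ← Matrix.map_algebraMap_mul, h1, Matrix.map_algebraMap_one,
        Matrix.mul_one]
    rw [← Matrix.map_apply (f := star), h4, toAlg_single, Finset.sum_comm, Matrix.mul_apply]
    refine Finset.sum_congr rfl fun d _ => ?_
    rw [Matrix.mul_apply, Finset.sum_mul]
    refine Finset.sum_congr rfl fun c _ => ?_
    rw [Matrix.map_apply, Matrix.map_apply, ← Algebra.commutes, ← Algebra.smul_def,
      ← Algebra.smul_def, smul_smul, Matrix.of_apply, mul_comm]
  refine ⟨∑ a, ∑ b, star (m a b) • Matrix.of fun c d => T a c * T' d b, ?_⟩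
  rw [toAlg_single]
  simp only [star_sum, star_smul, h, map_sum, map_smul]

end CreationTower

end FreeOrthogonal
end

/-! ### The Haar integration -/

noncomputable section

open scoped Matrix TensorProduct
open UniformSpace

open scoped ComplexOrder in
/-- Positive linear forms on C⋆-algebras are continuous. -/
theorem LinearMap.continuous_of_star_mul_self_nonneg {A : Type*} [CStarAlgebra A] (h : A →ₗ[ℂ] ℂ)
    (hh : ∀ a, 0 ≤ h (star a * a)) : Continuous h := by
  let _ := CStarAlgebra.spectralOrder A
  have _ := CStarAlgebra.spectralOrderedRing A
  let f : A →ₚ[ℂ] ℂ := PositiveLinearMap.mk₀ h fun a ha => by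
    obtain ⟨b, rfl⟩ := CStarAlgebra.nonneg_iff_eq_star_mul_self.mp ha
    exact hh b
  exact map_continuous f

namespace FreeOrthogonal

open WoronowiczAlgebra

variable {N : ℕ}

theorem mul_mem_smooth {a b : Alg N} (ha : a ∈ (freeOrthogonal N).smooth)
    (hb : b ∈ (freeOrthogonal N).smooth) : a * b ∈ (freeOrthogonal N).smooth :=
  mul_mem (S := StarSubalgebra ℂ (freeOrthogonal N).A) ha hb

namespace CreationTower

variable (τ : CreationTower N)

theorem toAlg_single_one (m : Matrix (Fin (dim N 1)) (Fin (dim N 1)) ℂ) :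
    ∃ c : Fin N → Fin N → ℂ, τ.toAlg (Reg.single 1 m) = ∑ i, ∑ j, c i j • coord i j := by
  have h (X : Matrix (Fin (dim N 0)) (Fin (dim N 0)) ℂ) :
      Reg.single 0 X = X (0 : Fin 1) (0 : Fin 1) • Reg.vac := by
    rw [Reg.vac, ← map_smul]
    congr 1
    refine Matrix.ext fun (a : Fin 1) (b : Fin 1) => ?_
    rw [Subsingleton.elim a 0, Subsingleton.elim b 0]
    exact (mul_one _).symm
  refine ⟨fun i j => ((τ.A 0 i)ᴴ * m * τ.A 0 j) (0 : Fin 1) (0 : Fin 1), ?_⟩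
  conv_lhs => rw [τ.eq_sum_up 0 m]
  simp only [map_sum]
  refine Finset.sum_congr rfl fun i _ => Finset.sum_congr rfl fun j _ => ?_
  rw [← op_single_zero, h, map_smul, map_smul, toAlg_op, toAlg_vac, mul_one]

variable [hN : Fact (2 ≤ N)]

/-- The Haar integration, as the vacuum state of the regular representation. -/
def haar : Alg N →ₗ[ℂ] ℂ where
  toFun a := inner ℂ ((Reg.vac : Reg N) : Completion (Reg N)) (τ.regular.hom a (Reg.vac : Reg N))
  map_add' a b := by rw [map_add, _root_.add_apply, inner_add_right]
  map_smul' c a := by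
    rw [map_smul, _root_.smul_apply, inner_smul_right, RingHom.id_apply, smul_eq_mul]

theorem haar_apply (a : Alg N) : τ.haar a =
    inner ℂ ((Reg.vac : Reg N) : Completion (Reg N)) (τ.regular.hom a (Reg.vac : Reg N)) := rfl

theorem continuous_haar : Continuous τ.haar := by
  have h : Continuous τ.regular.hom := continuous_hom _
  have h' : Continuous fun a => τ.regular.hom a (Reg.vac : Reg N) := by fun_prop
  exact (continuous_const (y := ((Reg.vac : Reg N) : Completion (Reg N)))).inner (𝕜 := ℂ) h'

theorem haar_toAlg (x : Reg N) : τ.haar (τ.toAlg x) = Reg.integral N x := by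
  rw [haar_apply, hom_toAlg_vac, Completion.inner_coe, ← inner_conj_symm, Reg.vac,
    Reg.inner_single_right, Matrix.mul_one, Matrix.trace_conjTranspose, map_mul]
  simp [dim_zero, Reg.integral_apply]

theorem haar_star (a : Alg N) : τ.haar (star a) = star (τ.haar a) := by
  rw [haar_apply, haar_apply, map_star, ContinuousLinearMap.star_eq_adjoint,
    ContinuousLinearMap.adjoint_inner_right]
  exact (inner_conj_symm _ _).symm

open scoped ComplexOrder in
theorem haar_nonneg (a : Alg N) : 0 ≤ τ.haar (star a * a) := by
  rw [haar_apply, map_mul, map_star, mul_apply_eq_comp, ContinuousLinearMap.star_eq_adjoint,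
    ContinuousLinearMap.adjoint_inner_right, inner_self_eq_norm_sq_to_K]
  have h := Complex.zero_le_real.mpr
    (sq_nonneg ‖τ.regular.hom a ((Reg.vac : Reg N) : Completion (Reg N))‖)
  rw [Complex.ofReal_pow] at h
  exact h

theorem haar_one : τ.haar 1 = 1 := by
  rw [← τ.toAlg_vac, haar_toAlg, Reg.integral_apply, Reg.vac, Reg.coeff_single_same,
    Matrix.trace_one, Fintype.card_fin]
  exact Nat.cast_one

theorem haar_coord_mul_coord (i j k l : Fin N) :
    τ.haar (coord i j * coord k l) =
      if i = k ∧ j = l then (ratio N 0)⁻¹ else 0 := by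
  rw [← mul_one (coord k l), ← τ.toAlg_vac, ← toAlg_op, ← toAlg_op, haar_toAlg,
    Reg.integral_apply, coeff_zero_op, Reg.vac, op_single_zero, Reg.coeff_single_same]
  have h : τ.down 0 i j (τ.up 0 k l 1) =
      (ratio N 0)⁻¹ • (((τ.A 0 i)ᴴ * τ.A 0 k) * ((τ.A 0 l)ᴴ * τ.A 0 j)) := by
    simp only [up, down, LinearMap.coe_mk, AddHom.coe_mk, Matrix.one_mul, Matrix.mul_assoc]
  rw [h, τ.star_mul_zero, τ.star_mul_zero, Matrix.trace_smul]
  by_cases h1 : i = k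
  · by_cases h2 : j = l
    · rw [if_pos h1, if_pos h2.symm, if_pos ⟨h1, h2⟩, Matrix.mul_one, Matrix.trace_one,
        Fintype.card_fin, dim_zero, Nat.cast_one, smul_eq_mul, mul_one]
    · have h3 : ¬(i = k ∧ j = l) := fun h => h2 h.2
      rw [if_neg h3, if_neg (show ¬l = j from Ne.symm h2), Matrix.mul_zero, Matrix.trace_zero,
        smul_zero]
  · have h3 : ¬(i = k ∧ j = l) := fun h => h1 h.1
    rw [if_neg h3, if_neg h1, Matrix.zero_mul, Matrix.trace_zero, smul_zero]

theorem haar_coord_mul_single (i j : Fin N) {k : ℕ} (hk : k ≠ 1)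
    (m : Matrix (Fin (dim N k)) (Fin (dim N k)) ℂ) :
    τ.haar (coord i j * τ.toAlg (Reg.single k m)) = 0 := by
  rw [← toAlg_op, haar_toAlg, Reg.integral_apply, coeff_zero_op, Reg.coeff_single_ne hk, map_zero,
    Matrix.trace_zero]

/-- In degree 1 the explicit formula is symmetric under exchange of the two factors. In any other
degree both sides vanish, the left one after taking adjoints, which preserve the degree. -/
theorem haar_coord_comm (i j : Fin N) {a : Alg N} (ha : a ∈ (freeOrthogonal N).smooth) :
    τ.haar (a * coord i j) = τ.haar (coord i j * a) := by
  obtain ⟨x, rfl⟩ := τ.exists_toAlg_eq ha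
  induction x using Reg.induction_single with
  | zero => simp
  | add x y hx hy =>
    rw [map_add, add_mul, mul_add, map_add, map_add, hx (τ.toAlg_mem_smooth x),
      hy (τ.toAlg_mem_smooth y)]
  | single k m =>
    by_cases hk : k = 1
    · subst hk
      obtain ⟨c, hc⟩ := τ.toAlg_single_one m
      rw [hc]
      simp only [Finset.sum_mul, Finset.mul_sum, map_sum, smul_mul_assoc, mul_smul_comm, map_smul,
        haar_coord_mul_coord, eq_comm]
    · obtain ⟨m', hm'⟩ := τ.exists_star_toAlg_single k m
      rw [haar_coord_mul_single τ i j hk, ← star_star (τ.toAlg (Reg.single k m) * coord i j),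
        haar_star, star_mul, coord_orthogonal.selfAdjoint, hm', haar_coord_mul_single τ i j hk,
        star_zero]

/-- The elements that commute with all smooth elements under the integral are stable under products,
which extends the case of generators to smooth elements. Continuity then removes smoothness of one
argument after the other. -/
theorem haar_comm (a b : Alg N) : τ.haar (a * b) = τ.haar (b * a) := by
  have h1 (b : Alg N) (hb : b ∈ (freeOrthogonal N).smooth) :
      b ∈ (freeOrthogonal N).smooth ∧
        ∀ a : Alg N, a ∈ (freeOrthogonal N).smooth → τ.haar (a * b) = τ.haar (b * a) := by
    refine smooth_induction (p := fun b => b ∈ (freeOrthogonal N).smooth ∧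
        ∀ a : Alg N, a ∈ (freeOrthogonal N).smooth → τ.haar (a * b) = τ.haar (b * a))
      (fun c => ⟨algebraMap_mem (freeOrthogonal N).smooth c, fun a _ => ?_⟩)
      (fun i j => ⟨coord_mem_smooth i j, fun a ha => τ.haar_coord_comm i j ha⟩) ?_ ?_ hb
    · rw [Algebra.commutes]
    · rintro b c ⟨hb, hb'⟩ ⟨hc, hc'⟩
      refine ⟨add_mem (S := StarSubalgebra ℂ (freeOrthogonal N).A) hb hc, fun a ha => ?_⟩
      rw [mul_add, add_mul, map_add, map_add, hb' a ha, hc' a ha]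
    · rintro b c ⟨hb, hb'⟩ ⟨hc, hc'⟩
      refine ⟨mul_mem_smooth hb hc, fun a ha => ?_⟩
      rw [← mul_assoc, hc' _ (mul_mem_smooth ha hb),
        ← mul_assoc, hb' _ (mul_mem_smooth hc ha), mul_assoc]
  have h2 (b : Alg N) (hb : b ∈ (freeOrthogonal N).smooth) (a : Alg N) :
      τ.haar (a * b) = τ.haar (b * a) :=
    congrFun (eq_of_eq_on_smooth (τ.continuous_haar.comp (continuous_mul_const b))
      (τ.continuous_haar.comp (continuous_const_mul b)) (h1 b hb).2) a
  exact congrFun (eq_of_eq_on_smooth (τ.continuous_haar.comp (continuous_const_mul a))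
      (τ.continuous_haar.comp (continuous_mul_const a)) fun b hb => h2 b hb a) b

theorem isHaar_haar : (freeOrthogonal N).IsHaar τ.haar where
  nonneg := τ.haar_nonneg
  map_one := τ.haar_one
  tracial := τ.haar_comm
  left_invariant a ha m x y hx hy h := by
    obtain ⟨z, rfl⟩ := τ.exists_toAlg_eq ha
    choose p hp using fun i => τ.exists_toAlg_eq (hx i)
    choose q hq using fun i => τ.exists_toAlg_eq (hy i)
    obtain rfl : (fun i => τ.toAlg (p i)) = x := funext hp
    obtain rfl : (fun i => τ.toAlg (q i)) = y := funext hq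
    have h' := congrArg (τ.sliceLeft (Reg.integral N)) (τ.cop_eq_of_comul_eq h)
    rw [sliceLeft_integral_cop, map_sum] at h'
    have h2 : ∑ i, τ.haar (τ.toAlg (p i)) • τ.toAlg (q i) = τ.haar (τ.toAlg z) • (1 : Alg N) := by
      simp only [haar_toAlg]
      exact h'.symm
    exact h2
  right_invariant a ha m x y hx hy h := by
    obtain ⟨z, rfl⟩ := τ.exists_toAlg_eq ha
    choose p hp using fun i => τ.exists_toAlg_eq (hx i)
    choose q hq using fun i => τ.exists_toAlg_eq (hy i)
    obtain rfl : (fun i => τ.toAlg (p i)) = x := funext hp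
    obtain rfl : (fun i => τ.toAlg (q i)) = y := funext hq
    have h' := congrArg (τ.sliceRight (Reg.integral N)) (τ.cop_eq_of_comul_eq h)
    rw [sliceRight_integral_cop, map_sum] at h'
    have h2 : ∑ i, τ.haar (τ.toAlg (q i)) • τ.toAlg (p i) = τ.haar (τ.toAlg z) • (1 : Alg N) := by
      simp only [haar_toAlg]
      exact h'.symm
    exact h2

/-- Invariance equates a combination of coefficients of `r_k` with a multiple of 1, a coefficient of
`r_0`; independence kills both. -/
theorem isHaar_apply_irrep {h : Alg N →ₗ[ℂ] ℂ} (hh : (freeOrthogonal N).IsHaar h) {k : ℕ}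
    (hk : k ≠ 0) (a b : Fin (dim N k)) : h (τ.conj.irrep k a b) = 0 := by
  have hv := τ.conj.isCorep_irrep k
  have h1 : ∑ e, h (τ.conj.irrep k a e) • τ.conj.irrep k e b =
      h (τ.conj.irrep k a b) • (1 : Alg N) :=
    hh.left_invariant _ (hv.mem_smooth a b) _ _ _ (fun e => hv.mem_smooth a e)
      (fun e => hv.mem_smooth e b) (hv.comul_eq a b)
  have h2 : Reg.single k (Matrix.of fun e b' => if b' = b then h (τ.conj.irrep k a e) else 0) =
      Reg.single 0 (h (τ.conj.irrep k a b) • (1 : Matrix (Fin (dim N 0)) (Fin (dim N 0)) ℂ)) := by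
    refine τ.toAlg_injective ?_
    rw [map_smul, map_smul]
    change _ = h (τ.conj.irrep k a b) • τ.toAlg Reg.vac
    rw [toAlg_vac, ← h1, toAlg_single]
    simp [ite_smul]
  have h3 := congrArg (fun x => Reg.coeff k x b b) h2
  simp only [Reg.coeff_single_same, Reg.coeff_single_ne hk.symm] at h3
  simpa using h3

/-- Invariance is only assumed on smooth elements; positivity gives continuity, hence uniqueness on
the whole algebra. -/
theorem eq_haar {h : Alg N →ₗ[ℂ] ℂ} (hh : (freeOrthogonal N).IsHaar h) : h = τ.haar := by
  have hc : Continuous h := h.continuous_of_star_mul_self_nonneg hh.nonneg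
  refine DFunLike.coe_injective (eq_of_eq_on_smooth hc τ.continuous_haar fun a ha => ?_)
  obtain ⟨x, rfl⟩ := τ.exists_toAlg_eq ha
  induction x using Reg.induction_single with
  | zero => simp
  | add x y hx hy =>
    rw [map_add, map_add, map_add, hx (τ.toAlg_mem_smooth x), hy (τ.toAlg_mem_smooth y)]
  | single k m =>
    rw [toAlg_single]
    simp only [map_sum, map_smul]
    refine Finset.sum_congr rfl fun a _ => Finset.sum_congr rfl fun b _ => ?_
    by_cases hk : k = 0
    · subst hk
      rw [irrep_zero_apply]
      split_ifs
      · rw [show h 1 = 1 from hh.map_one, haar_one]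
      · rw [map_zero, map_zero]
    · rw [τ.isHaar_apply_irrep hh hk, τ.isHaar_apply_irrep τ.isHaar_haar hk]

theorem existsUnique_isHaar (τ : CreationTower N) :
    ∃! h : Alg N →ₗ[ℂ] ℂ, (freeOrthogonal N).IsHaar h :=
  ⟨τ.haar, τ.isHaar_haar, fun _ hh => τ.eq_haar hh⟩

end CreationTower

end FreeOrthogonal
end

noncomputable section

/-! ### Chebyshev polynomials and the semicircle law -/

namespace Polynomial.Chebyshev

variable {R : Type*} [CommRing R]

/-- Induction on `k` through `X S_m = S_{m+1} + S_{m-1}`. Allowing `l` to be any integer avoids a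
comparison of `k` with `l`, which is made only in `S_mul_S_nat`. -/
theorem S_mul_S (k : ℕ) (l : ℤ) :
    S R k * S R l = ∑ j ∈ Finset.range (k + 1), S R (l - k + 2 * j) := by
  induction k using Nat.twoStepInduction with
  | zero => simp
  | one =>
    rw [Finset.sum_range_succ, Finset.sum_range_one]
    have h := S_add_one R l
    push_cast
    rw [S_one, add_zero, show l - 1 + 2 = l + 1 by ring, h]
    ring
  | more k h1 h2 =>
    have hX (m : ℤ) : X * S R m = S R (m + 1) + S R (m - 1) := by
      rw [S_add_one]
      ring
    have h3 : S R ((k + 2 : ℕ) : ℤ) = X * S R ((k + 1 : ℕ) : ℤ) - S R (k : ℤ) := by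
      push_cast
      exact S_add_two R k
    rw [h3, sub_mul, mul_assoc, h1, h2, Finset.mul_sum]
    simp only [hX, Finset.sum_add_distrib]
    rw [Finset.sum_range_succ (n := k + 1), Finset.sum_range_succ (n := k + 2)]
    have e1 : ∀ j : ℕ, l - ((k + 1 : ℕ) : ℤ) + 2 * j + 1 = l - k + 2 * j := fun j => by
      push_cast
      ring
    have e2 : ∀ j : ℕ, l - ((k + 1 : ℕ) : ℤ) + 2 * j - 1 = l - ((k + 2 : ℕ) : ℤ) + 2 * j :=
      fun j => by
        push_cast
        ring
    simp only [e1, e2]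
    -- After the cancellation one term is left over, of index `l + k + 2`; it is the top term of the
    -- target sum.
    have e3 : l - (k : ℤ) + 2 * ((k + 1 : ℕ) : ℤ) =
        l - ((k + 2 : ℕ) : ℤ) + 2 * ((k + 2 : ℕ) : ℤ) := by
      push_cast
      ring
    rw [e3]
    ring

theorem S_mul_S_nat (k l : ℕ) :
    S R k * S R l = ∑ j : Fin (min k l + 1), S R (((k : ℤ) - l).natAbs + 2 * (j : ℕ)) := by
  rw [Fin.sum_univ_eq_sum_range fun j : ℕ => S R (((k : ℤ) - l).natAbs + 2 * j)]
  rcases le_total k l with h | h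
  · rw [S_mul_S, min_eq_left h, show (((k : ℤ) - l).natAbs : ℤ) = l - k by lia]
  · rw [mul_comm, S_mul_S, min_eq_right h, show (((k : ℤ) - l).natAbs : ℤ) = k - l by lia]

/-- The span of the `S_k` contains 1 and is stable under multiplication by `X`, so it is everything.
-/
theorem linearMap_ext_S {M : Type*} [AddCommGroup M] [Module R M] {f g : R[X] →ₗ[R] M}
    (h : ∀ k : ℕ, f (S R k) = g (S R k)) : f = g := by
  let V : Submodule R R[X] := Submodule.span R (Set.range fun k : ℕ => S R k)
  have hS (k : ℕ) : S R k ∈ V := Submodule.subset_span ⟨k, rfl⟩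
  have hX : ∀ P ∈ V, X * P ∈ V := by
    intro P hP
    induction hP using Submodule.span_induction with
    | mem P hP =>
      obtain ⟨k, rfl⟩ := hP
      rcases k with _ | k
      · have h1 := hS 1
        simpa using h1
      · have h1 := S_add_two R k
        have h2 : X * S R ((k + 1 : ℕ) : ℤ) = S R ((k + 2 : ℕ) : ℤ) + S R (k : ℤ) := by
          push_cast
          rw [h1]
          ring
        simp only [h2]
        exact add_mem (hS _) (hS _)
    | zero => simp
    | add P Q _ _ hP hQ => rw [mul_add]; exact add_mem hP hQ
    | smul c P _ hP => rw [mul_smul_comm]; exact V.smul_mem c hP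
  have hpow (n : ℕ) : (X : R[X]) ^ n ∈ V := by
    induction n with
    | zero => simpa using hS 0
    | succ n ih => rw [pow_succ']; exact hX _ ih
  refine LinearMap.ext_on_range (v := fun k : ℕ => S R k) (top_le_iff.mp fun P _ => ?_) h
  rw [P.as_sum_range_C_mul_X_pow]
  exact sum_mem fun n _ => by
    rw [← smul_eq_C_mul]
    exact V.smul_mem _ (hpow n)

theorem S_eval_ofReal (n : ℤ) (x : ℝ) : (S ℂ n).eval (x : ℂ) = ((S ℝ n).eval x : ℝ) := by
  rw [← map_S Complex.ofRealHom, eval_map, ← Complex.ofRealHom_eq_coe, eval₂_hom]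
  rfl

end Polynomial.Chebyshev

namespace Wigner

open MeasureTheory Polynomial

/-- The density of the semicircle law. -/
def density (x : ℝ) : ℝ := 1 / (2 * Real.pi) * Real.sqrt (4 - x ^ 2)

theorem density_nonneg (x : ℝ) : 0 ≤ density x := by
  unfold density
  positivity

theorem continuous_density : Continuous density := by
  unfold density
  fun_prop

theorem density_eq_zero {x : ℝ} (hx : x ∉ Set.Icc (-2 : ℝ) 2) : density x = 0 := by
  have h : 4 - x ^ 2 ≤ 0 := by
    by_contra! h
    exact hx ⟨by nlinarith, by nlinarith⟩
  rw [density, Real.sqrt_eq_zero_of_nonpos h, mul_zero]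

theorem hasCompactSupport_density : HasCompactSupport density :=
  HasCompactSupport.intro isCompact_Icc fun _ hx => density_eq_zero hx

theorem integrable_density_smul {f : ℝ → ℂ} (hf : Continuous f) :
    Integrable fun x => density x • f x :=
  (continuous_density.smul hf).integrable_of_hasCompactSupport
    (hasCompactSupport_density.smul_right)

theorem measurable_density : Measurable fun x => ENNReal.ofReal (density x) :=
  continuous_density.measurable.ennreal_ofReal

theorem integrable {f : ℝ → ℂ} (hf : Continuous f) : Integrable f wignerLaw := by
  refine (integrable_withDensity_iff_integrable_smul' (μ := volume) measurable_density
    (.of_forall fun x => ENNReal.ofReal_lt_top)).mpr ?_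
  simp only [ENNReal.toReal_ofReal (density_nonneg _)]
  exact integrable_density_smul hf

theorem integral_eq (f : ℝ → ℂ) : ∫ x, f x ∂wignerLaw = ∫ x in (-2)..2, density x • f x := by
  have h : ∫ x, f x ∂wignerLaw = ∫ x, density x • f x := by
    have h := integral_withDensity_eq_integral_toReal_smul (μ := volume) measurable_density
      (.of_forall fun x => ENNReal.ofReal_lt_top) f
    simp only [ENNReal.toReal_ofReal (density_nonneg _)] at h
    exact h
  rw [h, intervalIntegral.integral_of_le (by norm_num), ← integral_Icc_eq_integral_Ioc]
  refine (setIntegral_eq_integral_of_forall_compl_eq_zero fun x hx => ?_).symm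
  rw [density_eq_zero hx, zero_smul]

theorem integral_cos_nat_mul {n : ℕ} (hn : n ≠ 0) :
    ∫ x in (0 : ℝ)..Real.pi, Real.cos (n * x) = 0 := by
  rw [intervalIntegral.integral_comp_mul_left _ (Nat.cast_ne_zero.mpr hn), integral_cos,
    mul_zero, Real.sin_zero, Real.sin_nat_mul_pi, sub_zero, smul_zero]

theorem integral_sin_mul_sin (k : ℕ) :
    ∫ x in (0 : ℝ)..Real.pi, Real.sin x * Real.sin ((k + 1) * x) =
      if k = 0 then Real.pi / 2 else 0 := by
  have h (x : ℝ) : Real.sin x * Real.sin ((k + 1) * x) =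
      (1 / 2) * (Real.cos (k * x) - Real.cos ((k + 2 : ℕ) * x)) := by
    rw [Real.cos_sub_cos]
    have e1 : ((k : ℝ) * x + (k + 2 : ℕ) * x) / 2 = (k + 1) * x := by push_cast; ring
    have e2 : ((k : ℝ) * x - (k + 2 : ℕ) * x) / 2 = -x := by push_cast; ring
    rw [e1, e2, Real.sin_neg]
    ring
  simp only [h]
  rw [intervalIntegral.integral_const_mul, intervalIntegral.integral_sub
    (Continuous.intervalIntegrable (by fun_prop) _ _)
    (Continuous.intervalIntegrable (by fun_prop) _ _), integral_cos_nat_mul (by lia : k + 2 ≠ 0)]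
  split_ifs with hk
  · subst hk
    simp
    ring
  · rw [integral_cos_nat_mul hk]
    ring

/-- Under `x = 2 cos θ` the square root becomes `2 sin θ` and `S_k(x) sin θ = sin((k+1)θ)`, so this
is orthogonality of sines. The substitution reverses the orientation of the interval, which absorbs
the sign of the derivative. -/
theorem integral_density_mul_S (k : ℕ) :
    ∫ x in (-2 : ℝ)..2, density x * (Chebyshev.S ℝ k).eval x = if k = 0 then 1 else 0 := by
  have h := intervalIntegral.integral_comp_mul_deriv (a := 0) (b := Real.pi)
    (f := fun θ => 2 * Real.cos θ) (f' := fun θ => 2 * -Real.sin θ)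
    (g := fun x => density x * (Chebyshev.S ℝ k).eval x)
    (fun x _ => (Real.hasDerivAt_cos x).const_mul 2) (by fun_prop)
    (continuous_density.mul (Chebyshev.S ℝ k).continuous)
  simp only [Function.comp_apply, Real.cos_zero, Real.cos_pi] at h
  rw [mul_one, mul_neg_one] at h
  rw [intervalIntegral.integral_symm, ← h]
  have h2 : ∫ θ in (0 : ℝ)..Real.pi, density (2 * Real.cos θ) *
      (Chebyshev.S ℝ k).eval (2 * Real.cos θ) * (2 * -Real.sin θ) =
      ∫ θ in (0 : ℝ)..Real.pi, -(2 / Real.pi) * (Real.sin θ * Real.sin ((k + 1) * θ)) := by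
    refine intervalIntegral.integral_congr fun θ hθ => ?_
    rw [Set.uIcc_of_le Real.pi_pos.le] at hθ
    have hs := Real.sin_nonneg_of_mem_Icc hθ
    have h3 : Real.sqrt (4 - (2 * Real.cos θ) ^ 2) = 2 * Real.sin θ := by
      rw [show 4 - (2 * Real.cos θ) ^ 2 = (2 * Real.sin θ) ^ 2 by
        nlinarith [Real.sin_sq_add_cos_sq θ]]
      exact Real.sqrt_sq (by positivity)
    have h4 := Chebyshev.S_two_mul_real_cos θ k
    simp only [density, h3]
    rw [Int.cast_natCast] at h4
    rw [← h4]
    field_simp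
  rw [h2, intervalIntegral.integral_const_mul, integral_sin_mul_sin]
  split_ifs
  · field_simp
  · simp

theorem integral_S (k : ℕ) :
    ∫ x : ℝ, (Chebyshev.S ℂ k).eval (x : ℂ) ∂wignerLaw = if k = 0 then 1 else 0 := by
  rw [integral_eq]
  simp only [Chebyshev.S_eval_ofReal, Complex.real_smul, ← Complex.ofReal_mul]
  rw [intervalIntegral.integral_ofReal, integral_density_mul_S]
  split_ifs <;> simp

theorem continuous_eval (P : ℂ[X]) : Continuous fun x : ℝ => P.eval (x : ℂ) :=
  P.continuous.comp Complex.continuous_ofReal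

/-- The integration of polynomials. -/
def functional : ℂ[X] →ₗ[ℂ] ℂ where
  toFun P := ∫ x : ℝ, P.eval (x : ℂ) ∂wignerLaw
  map_add' P Q := by
    simp only [eval_add]
    exact integral_add (integrable (continuous_eval P)) (integrable (continuous_eval Q))
  map_smul' c P := by
    simp only [eval_smul, RingHom.id_apply]
    exact integral_smul c _

end Wigner

/-- A self-adjoint element whose Chebyshev polynomials have integral zero is semicircular. -/
theorem hasLaw_wignerLaw {A : Type*} [CStarAlgebra A] {h : A →ₗ[ℂ] ℂ} {a : A}
    (ha : IsSelfAdjoint a)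
    (hS : ∀ k : ℕ, h (Polynomial.aeval a (Polynomial.Chebyshev.S ℂ k)) = if k = 0 then 1 else 0) :
    HasLaw h a wignerLaw := by
  refine ⟨ha, fun P => ⟨Wigner.integrable (Wigner.continuous_eval P), ?_⟩⟩
  have h1 : h ∘ₗ (Polynomial.aeval a).toLinearMap = Wigner.functional :=
    Polynomial.Chebyshev.linearMap_ext_S fun k => (hS k).trans (Wigner.integral_S k).symm
  exact LinearMap.congr_fun h1 P

end

/-! ### Dimension formula, characters, and fusion rules -/

noncomputable section

open scoped Matrix

theorem Matrix.trace_map_algebraMap_mul_comm {ι κ A : Type*} [Fintype ι] [Fintype κ] [Ring A]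
    [Algebra ℂ A] (S : Matrix ι κ ℂ) (M : Matrix κ ι A) :
    (S.map (algebraMap ℂ A) * M).trace = (M * S.map (algebraMap ℂ A)).trace := by
  simp only [Matrix.trace, Matrix.diag_apply, Matrix.mul_apply, Matrix.map_apply]
  rw [Finset.sum_comm]
  simp only [Algebra.commutes]

theorem WoronowiczAlgebra.trace_tensor {N : ℕ} {G : WoronowiczAlgebra N} {ι κ : Type*} [Fintype ι]
    [Fintype κ] (v : Matrix ι ι G.A) (w : Matrix κ κ G.A) :
    (tensor v w).trace = v.trace * w.trace := by
  simp only [Matrix.trace, Matrix.diag_apply, tensor, Matrix.of_apply, Fintype.sum_prod_type,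
    Finset.sum_mul_sum]

namespace FreeOrthogonal

open WoronowiczAlgebra

variable {N : ℕ}

theorem dim_eq_div (hN : 2 < N) {q : ℝ} (hq : q ^ 2 - N * q + 1 = 0) (k : ℕ) :
    (dim N k : ℝ) = (q ^ (k + 1) - q⁻¹ ^ (k + 1)) / (q - q⁻¹) := by
  have hN' : (2 : ℝ) < N := by exact_mod_cast hN
  have hq0 : q ≠ 0 := by
    rintro rfl
    norm_num at hq
  -- Otherwise `q = ±1`, and the quadratic equation would give `N = ±2`.
  have hqq : q - q⁻¹ ≠ 0 := by
    intro h
    have h1 : q ^ 2 = 1 := by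
      field_simp at h
      linarith
    rcases (sq_eq_sq_iff_eq_or_eq_neg.mp (h1.trans (one_pow 2).symm)) with rfl | rfl <;> linarith
  have hsum : (N : ℝ) = q + q⁻¹ := by
    field_simp
    linarith
  rw [eq_div_iff hqq]
  induction k using Nat.twoStepInduction with
  | zero => simp [dim_zero]
  | one =>
    rw [show dim N 1 = N from rfl, hsum]
    ring
  | more k h1 h2 =>
    have h3 : (dim N (k + 2) : ℝ) = N * dim N (k + 1) - dim N k := by
      rw [eq_sub_iff_add_eq]
      exact_mod_cast dim_add_two hN.le k
    rw [h3, sub_mul, mul_assoc, h1, h2, hsum]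
    have h4 : q⁻¹ * q = 1 := inv_mul_cancel₀ hq0
    linear_combination (q ^ (k + 1) - q⁻¹ ^ (k + 1)) * h4

theorem dim_two_eq (k : ℕ) : dim 2 k = k + 1 := by
  induction k using Nat.twoStepInduction with
  | zero => rfl
  | one => rfl
  | more k h1 h2 =>
    have := dim_add_two le_rfl k
    lia

namespace CreationTower

variable (τ : CreationTower N)

theorem sum_cre_mul_ann (k : ℕ) : ∑ i, τ.cre k i * τ.ann k i = 1 := by
  simp only [cre, ann, ← Matrix.map_algebraMap_mul]
  refine (Matrix.map_sum_of_addMonoidHom (algebraMap ℂ (Alg N) : ℂ →+ Alg N) _ _).symm.trans ?_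
  rw [τ.sum_mul_star]
  exact Matrix.map_algebraMap_one

theorem sum_ann_mul_cre (k : ℕ) : ∑ i, τ.ann k i * τ.cre k i = ratio N k • 1 := by
  simp only [cre, ann, ← Matrix.map_algebraMap_mul]
  refine (Matrix.map_sum_of_addMonoidHom (algebraMap ℂ (Alg N) : ℂ →+ Alg N) _ _).symm.trans ?_
  rw [τ.sum_star_mul]
  exact (Matrix.map_algebraMap_smul _ _).trans (congrArg _ Matrix.map_algebraMap_one)

/-- The trace is not cyclic over a noncommutative algebra, but a scalar matrix can still be moved
around it. -/
theorem trace_ann_mul_mul_cre (k : ℕ) (M : Matrix (Fin (dim N (k + 1))) (Fin (dim N (k + 1)))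
    (Alg N)) : ∑ i, (τ.ann k i * M * τ.cre k i).trace = M.trace := by
  conv_rhs => rw [← Matrix.mul_one M, ← τ.sum_cre_mul_ann k, Matrix.mul_sum, Matrix.trace_sum]
  refine Finset.sum_congr rfl fun i _ => ?_
  rw [Matrix.mul_assoc, ← Matrix.mul_assoc M]
  exact Matrix.trace_map_algebraMap_mul_comm _ _

theorem trace_cre_mul_mul_ann (k : ℕ) (M : Matrix (Fin (dim N k)) (Fin (dim N k)) (Alg N)) :
    ∑ i, (τ.cre k i * M * τ.ann k i).trace = ratio N k • M.trace := by
  rw [← Matrix.trace_smul]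
  conv_rhs => rw [← Matrix.mul_one M, ← Matrix.mul_smul, ← τ.sum_ann_mul_cre k, Matrix.mul_sum,
    Matrix.trace_sum]
  refine Finset.sum_congr rfl fun i _ => ?_
  rw [Matrix.mul_assoc, ← Matrix.mul_assoc M]
  exact Matrix.trace_map_algebraMap_mul_comm _ _

theorem trace_irrep_zero : (τ.irrep 0).trace = 1 := by
  rw [show τ.irrep 0 = 1 from rfl, Matrix.trace_one, Fintype.card_fin]
  exact Nat.cast_one

theorem trace_coord_mul_trace (k : ℕ) :
    (coord (N := N)).trace * (τ.irrep k).trace = ∑ i : Fin N, (coord i i • τ.irrep k).trace := by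
  simp only [Matrix.trace_smul, smul_eq_mul, ← Finset.sum_mul]
  rfl

theorem trace_irrep_one : (τ.irrep 1).trace = (coord (N := N)).trace := by
  have h := τ.trace_coord_mul_trace 0
  simp only [coord_smul_irrep_zero] at h
  rw [trace_ann_mul_mul_cre, trace_irrep_zero, mul_one] at h
  exact h.symm

/-- The trace of the decomposition of `u ⊗ r_{k+1}`: the sum `∑ A_iᴴ A_i`, equal to the ratio,
cancels the constant in front of the `r_k` term. -/
theorem trace_irrep_add_two (hN : 2 ≤ N) (k : ℕ) : (τ.irrep (k + 2)).trace =
    (coord (N := N)).trace * (τ.irrep (k + 1)).trace - (τ.irrep k).trace := by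
  have h := τ.trace_coord_mul_trace (k + 1)
  simp only [coord_smul_irrep_succ, Matrix.trace_add, Finset.sum_add_distrib,
    Matrix.trace_smul] at h
  rw [trace_ann_mul_mul_cre, ← Finset.smul_sum, trace_cre_mul_mul_ann,
    inv_smul_smul₀ (ratio_ne_zero hN k)] at h
  rw [h, add_sub_cancel_right]

/-- The characters are the Chebyshev polynomials of the main character. -/
theorem trace_irrep (hN : 2 ≤ N) (k : ℕ) : (τ.irrep k).trace =
    Polynomial.aeval (coord (N := N)).trace (Polynomial.Chebyshev.S ℂ k) := by
  induction k using Nat.twoStepInduction with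
  | zero => simp [trace_irrep_zero]
  | one => simp [trace_irrep_one]
  | more k h1 h2 =>
    have h3 := Polynomial.Chebyshev.S_add_two ℂ k
    push_cast at h2 ⊢
    rw [h3, map_sub, map_mul, Polynomial.aeval_X, ← h1, ← h2, trace_irrep_add_two τ hN]

theorem trace_irrep_mul (hN : 2 ≤ N) (k l : ℕ) : (τ.irrep k).trace * (τ.irrep l).trace =
    ∑ j : Fin (min k l + 1), (τ.irrep (((k : ℤ) - l).natAbs + 2 * (j : ℕ))).trace := by
  simp only [τ.trace_irrep hN]
  rw [← map_mul, Polynomial.Chebyshev.S_mul_S_nat, map_sum]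
  push_cast
  rfl

/-- This recovers the dimension from the character. -/
theorem counit_trace {ι : Type*} [Fintype ι] [DecidableEq ι] {v : Matrix ι ι (Alg N)}
    (hv : (freeOrthogonal N).IsCorep v) :
    (freeOrthogonal N).counit v.trace = (Fintype.card ι : ℂ) := by
  have h : (freeOrthogonal N).counit v.trace = ∑ i, (freeOrthogonal N).counit (v i i) :=
    map_sum (freeOrthogonal N).counit _ _
  rw [h]
  simp [hv.counit_eq]

variable [hN : Fact (2 ≤ N)]

theorem haar_trace_irrep (k : ℕ) : τ.haar (τ.conj.irrep k).trace = if k = 0 then 1 else 0 := by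
  split_ifs with hk
  · subst hk
    rw [trace_irrep_zero, haar_one]
  · rw [Matrix.trace, map_sum]
    exact Finset.sum_eq_zero fun a _ => τ.isHaar_apply_irrep τ.isHaar_haar hk a a

theorem hasLaw_haar : HasLaw τ.haar (coord (N := N)).trace wignerLaw := by
  refine hasLaw_wignerLaw ?_ fun k => ?_
  · rw [IsSelfAdjoint, Matrix.trace, star_sum]
    exact Finset.sum_congr rfl fun i _ => coord_orthogonal.selfAdjoint i i
  · rw [← τ.conj.trace_irrep hN.out, haar_trace_irrep]

/-- As `κ` is injective, the character of `v` has coefficient exactly 1 on a diagonal entry of `r_{κ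
j}`. So some diagonal entry of `v` has a nonzero coefficient there, which is an entry of an
intertwiner. -/
theorem exists_isIntertwiner {ι : Type*} [Fintype ι] [DecidableEq ι] {v : Matrix ι ι (Alg N)}
    (hv : (freeOrthogonal N).IsCorep v) {m : ℕ} {κ : Fin m → ℕ} (hκ : Function.Injective κ)
    (htr : v.trace = ∑ j, (τ.conj.irrep (κ j)).trace) (j : Fin m) :
    ∃ C : Matrix ι (Fin (dim N (κ j))) ℂ, C ≠ 0 ∧
      IsIntertwiner (G := freeOrthogonal N) (τ.conj.irrep (κ j)) v C := by
  choose p hp using fun i j => τ.exists_toAlg_eq (hv.mem_smooth i j)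
  have h1 : ∑ i, p i i = ∑ j, ∑ a, Reg.elem (κ j) a a := by
    refine τ.toAlg_injective ?_
    simp only [map_sum, hp, toAlg_elem]
    exact htr
  let e : Fin (dim N (κ j)) := ⟨0, dim_pos hN.out _⟩
  have h2 := congrArg (fun x => Reg.coeff (κ j) x e e) h1
  simp only [map_sum, Matrix.sum_apply] at h2
  rw [Finset.sum_eq_single (a := j) (s := Finset.univ) (f := fun j' : Fin m => ∑ a, _)
    (fun j' _ hj => Finset.sum_eq_zero fun a _ => by
      rw [Reg.elem, Reg.coeff_single_ne (hκ.ne hj), Matrix.zero_apply])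
    (fun h => absurd (Finset.mem_univ _) h), Finset.sum_eq_single e] at h2
  rotate_left
  · intro a _ ha
    rw [Reg.elem, Reg.coeff_single_same, Matrix.single_apply_of_row_ne ha]
  · exact fun h => absurd (Finset.mem_univ _) h
  rw [Reg.elem, Reg.coeff_single_same, Matrix.single_apply_same] at h2
  obtain ⟨i, -, hi⟩ := Finset.exists_ne_zero_of_sum_ne_zero (h2.symm ▸ one_ne_zero)
  exact ⟨_, fun h => hi (congrFun (congrFun h i) e), τ.isIntertwiner_coeff hv hp (κ j) e i⟩

/-- Corepresentations whose character is a sum of distinct irreducible characters. -/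
theorem equivalent_directSum {ι : Type*} [Fintype ι] [DecidableEq ι] {v : Matrix ι ι (Alg N)}
    (hv : (freeOrthogonal N).IsCorep v) {m : ℕ} {κ : Fin m → ℕ} (hκ : Function.Injective κ)
    (htr : v.trace = ∑ j, (τ.conj.irrep (κ j)).trace) :
    Equivalent (G := freeOrthogonal N) v
      (directSum (G := freeOrthogonal N) fun j => τ.conj.irrep (κ j)) := by
  choose C hC0 hC using τ.exists_isIntertwiner hv hκ htr
  have hC' (j : Fin m) : IsIntertwiner (G := freeOrthogonal N) v (τ.conj.irrep (κ j)) (C j)ᴴ :=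
    (hC j).conjTranspose (τ.conj.isCorep_irrep _).mul_star_self hv.star_mul_self
  choose c hc using fun j => (τ.isIrreducible_irrep (κ j)).2.2 _ ((hC' j).comp (hC j))
  have hc0 (j : Fin m) : c j ≠ 0 := fun h => hC0 j <| by
    have h1 := hc j
    rw [h, zero_smul] at h1
    open scoped ComplexOrder in exact Matrix.conjTranspose_mul_self_eq_zero.mp h1
  -- `T` stacks the adjoint intertwiners `(C j)ᴴ`, and `T'` rescales the `C j` by `(C j)ᴴ C j = c
  -- j`. The off-diagonal blocks of `T T'` vanish because the `r_{κ j}` are disjoint.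
  let T : Matrix (Σ j, Fin (dim N (κ j))) ι ℂ := Matrix.of fun p i => (C p.1)ᴴ p.2 i
  let T' : Matrix ι (Σ j, Fin (dim N (κ j))) ℂ := Matrix.of fun i p => (c p.1)⁻¹ * C p.1 i p.2
  have hTT' : T * T' = 1 := by
    ext ⟨j, a⟩ ⟨l, b⟩
    have h1 : (T * T') ⟨j, a⟩ ⟨l, b⟩ = (c l)⁻¹ * ((C j)ᴴ * C l) a b := by
      simp only [T, T', Matrix.mul_apply, Matrix.of_apply, Finset.mul_sum]
      exact Finset.sum_congr rfl fun i _ => mul_left_comm _ _ _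
    rw [h1]
    by_cases hjl : j = l
    · subst hjl
      rw [hc, Matrix.smul_apply, smul_eq_mul, inv_mul_cancel_left₀ (hc0 j)]
      simp [Matrix.one_apply]
    · rw [τ.eq_zero_of_isIntertwiner (hκ.ne (Ne.symm hjl)) ((hC' j).comp (hC l)),
        Matrix.zero_apply, mul_zero, Matrix.one_apply_ne]
      exact fun h => hjl (congrArg Sigma.fst h)
  -- Applying the counit to the equality of characters shows that `T` is square, so a one-sided
  -- inverse suffices.
  have hcard : Fintype.card (Σ j, Fin (dim N (κ j))) = Fintype.card ι := by
    have h1 : ∑ j, (freeOrthogonal N).counit (τ.conj.irrep (κ j)).trace = (Fintype.card ι : ℂ) :=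
      (map_sum (freeOrthogonal N).counit _ _).symm.trans
        ((congrArg (freeOrthogonal N).counit htr.symm).trans (counit_trace hv))
    simp only [counit_trace (τ.conj.isCorep_irrep _)] at h1
    rw [Fintype.card_sigma]
    exact_mod_cast h1
  refine ⟨T, T', hTT', (Matrix.mul_eq_one_comm_of_card_eq _ _ _ hcard).mp hTT', ?_⟩
  refine Matrix.ext fun ⟨j, a⟩ i => ?_
  have h1 : ∑ l, algebraMap ℂ (Alg N) ((C j)ᴴ a l) * v l i =
      ∑ e, τ.conj.irrep (κ j) a e * algebraMap ℂ (Alg N) ((C j)ᴴ e i) :=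
    congrFun (congrFun (hC' j) a) i
  have h2 : ∑ q : Σ j, Fin (dim N (κ j)),
      Matrix.blockDiagonal' (fun j => τ.conj.irrep (κ j)) ⟨j, a⟩ q *
        algebraMap ℂ (Alg N) ((C q.1)ᴴ q.2 i) =
      ∑ e, τ.conj.irrep (κ j) a e * algebraMap ℂ (Alg N) ((C j)ᴴ e i) := by
    rw [Fintype.sum_sigma, Finset.sum_eq_single j]
    · simp only [Matrix.blockDiagonal'_apply_eq]
    · intro l _ hl
      exact Finset.sum_eq_zero fun e _ => by
        rw [Matrix.blockDiagonal'_apply_ne _ _ _ (Ne.symm hl), zero_mul]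
    · exact fun h => absurd (Finset.mem_univ _) h
  exact h1.trans h2.symm

theorem equivalent_tensor (k l : ℕ) : Equivalent (G := freeOrthogonal N)
    (tensor (G := freeOrthogonal N) (τ.conj.irrep k) (τ.conj.irrep l))
    (directSum (G := freeOrthogonal N) fun j : Fin (min k l + 1) =>
      τ.conj.irrep (((k : ℤ) - l).natAbs + 2 * (j : ℕ))) := by
  refine τ.equivalent_directSum ((τ.conj.isCorep_irrep k).tensor (τ.conj.isCorep_irrep l))
    (fun i j h => Fin.ext (by lia)) ?_
  exact (trace_tensor (G := freeOrthogonal N) _ _).trans (τ.conj.trace_irrep_mul hN.out k l)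

end CreationTower

end FreeOrthogonal
end

/-! ### The theorem -/

open WoronowiczAlgebra in
theorem theorem5p13 (N : ℕ) (hN : 2 ≤ N) :
    (∃! h : (freeOrthogonal N).A →ₗ[ℂ] ℂ, (freeOrthogonal N).IsHaar h) ∧
    (∀ h : (freeOrthogonal N).A →ₗ[ℂ] ℂ, (freeOrthogonal N).IsHaar h →
      HasLaw h (freeOrthogonal N).mainCharacter wignerLaw) ∧
    (∀ (n : ℕ) (v : Matrix (Fin n) (Fin n) (freeOrthogonal N).A),
      IsIrreducible v → Equivalent v (conj v)) ∧
    ∃ (d : ℕ → ℕ) (r : ∀ k, Matrix (Fin (d k)) (Fin (d k)) (freeOrthogonal N).A),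
      (∀ k, IsIrreducible (r k)) ∧
      (∀ k l, Equivalent (r k) (r l) → k = l) ∧
      (∀ (n : ℕ) (v : Matrix (Fin n) (Fin n) (freeOrthogonal N).A),
        IsIrreducible v → ∃ k, Equivalent v (r k)) ∧
      (∀ k l : ℕ, Equivalent (tensor (r k) (r l))
        (directSum fun j : Fin (min k l + 1) => r (((k : ℤ) - l).natAbs + 2 * (j : ℕ)))) ∧
      (∀ k, (2 < N → ∀ q : ℝ, q ^ 2 - N * q + 1 = 0 →
          (d k : ℝ) = (q ^ (k + 1) - q⁻¹ ^ (k + 1)) / (q - q⁻¹)) ∧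
        (N = 2 → d k = k + 1)) := by
  have : Fact (2 ≤ N) := ⟨hN⟩
  obtain ⟨τ⟩ := FreeOrthogonal.exists_creationTower hN
  refine ⟨τ.existsUnique_isHaar, fun h hh => ?_, fun n v hv => τ.equivalent_conj hv,
    FreeOrthogonal.dim N, τ.conj.irrep, τ.isIrreducible_irrep,
    fun k l h => τ.eq_of_equivalent_irrep h, fun n v hv => τ.exists_equivalent_irrep hv,
    τ.equivalent_tensor, fun k => ⟨fun h q hq => FreeOrthogonal.dim_eq_div h hq k, ?_⟩⟩
  · obtain rfl := τ.eq_haar hh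
    exact τ.hasLaw_haar
  · rintro rfl
    exact FreeOrthogonal.dim_two_eq k
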